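/- Let $d\ge 2$, let $D\subset\mathbb R^d$ be a bounded domain with Lipschitz boundary, $T>0$, $Q_T=(0,T)\times D$, $2\le p<\infty$, $p'=\frac{p}{p-1}$, and let $W^{-1,p'}(D)$ be the dual of $W_0^{1,p}(D)$. Let $(\Omega,\mathcal F,\mathbb P,(\mathcal F_t)_{t\ge0})$ be a probability space with a complete, right-continuous filtration and $W$ a cylindrical Wiener process in $L^2(D)$ on it; let $\Phi\in L^2(\Omega\times(0,T);HS(L^2(D)))$ be progressively measurable, where $HS(L^2(D))$ denotes the Hilbert–Schmidt operators on $L^2(D)$. Let $f:\mathbb R\to\mathbb R$ be Lipschitz continuous with $f(0)=0$, and let $a:D\times\mathbb R\times\mathbb R^d\to\mathbb R^d$ be a Carathéodory function such that, for a.e. $x\in D$ and all $\lambda,\lambda_1,\lambda_2\in\mathbb R$, $\xi,\zeta\in\mathbb R^d$, * (A1) $(a(x,\lambda,\xi)-a(x,\lambda,\zeta))\cdot(\xi-\zeta)\ge 0$; * (A2) $a(x,\lambda,\xi)\cdot\xi\ge\kappa(x)+C_1|\xi|^p$ and $|a(x,\lambda,\xi)|\le C_2|\xi|^{p-1}+C_3|\lambda|^{p-1}+g(x)$;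 * (A3) $|a(x,\lambda_1,\xi)-a(x,\lambda_2,\xi)|\le (C_4|\xi|^{p-1}+h(x))\,|\lambda_1-\lambda_2|$, for some $\kappa\in L^1(D)$, $C_1>0$, $C_2,C_3,C_4\ge0$ and nonnegative $g,h\in L^{p'}(D)$. Put $\mathcal W=\{v\in L^p(0,T;W^{1,p}_0(D)) : \partial_t v\in L^{p'}(0,T;W^{-1,p'}(D))\}$. For an $\mathcal F_0$-measurable $u_0\in L^2(\Omega\times D)$ with $u_0\ge0$ a.e., a solution with regular reflection of the obstacle problem $$du-\operatorname{div}a(\cdot,u,\nabla u)\,dt+f(u)\,dt=\Phi\,dW+d\eta,\quad u(0)=u_0,\quad u|_{(0,T)\times\partial D}=0,\quad u\ge0,\ \eta\ge0,\ \eta(u)=0 \tag{P}$$ is a pair $(u,\eta)$ such that 1. $u\in L^2_w(\Omega;L^\infty(0,T;L^2(D)))\cap L^p(\Omega;L^p(0,T;W^{1,p}_0(D)))$ and $u\ge0$ a.e. in $\Omega\times Q_T$; 2. $\mathbb P$-a.s. $u$ has a representative $[0,T)\to L^2(D)$, $t\mapsto u(t)$, that is right-continuous and satisfies $u(0)=u(0^+)=u_0$;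 3. $\eta\in L^{p'}(\Omega;\mathcal W')$ is a random non-negative Radon measure on $Q_T$ that is weak-$*$ adapted, i.e. $\omega\mapsto\int_{(0,t]\times D}\psi\,d\eta_\omega$ is $\mathcal F_t$-measurable for all $\psi\in C_c(Q_T)$, $t\in(0,T)$; and $\mathbb P$-a.s. $\partial_t\big[u-\int_0^\cdot\Phi\,dW\big]-\operatorname{div}a(\cdot,u,\nabla u)+f(u)=\eta$ in the sense of distributions on $Q_T$; 4. $\mathbb P$-a.s. $\eta\in L^{p'}(0,T;W^{-1,p'}(D))$ and $\langle\eta,u\rangle_{L^{p'}(0,T;W^{-1,p'}(D)),\,L^p(0,T;W_0^{1,p}(D))}=0$. **Theorem ($L^1$ contraction).** For every $T>0$ and $f$ as above there is a constant $C>0$, depending only on $T$ and $f$, such that the following holds for all other data as above: if $(u,\eta)$ and $(v,\nu)$ are solutions with regular reflection of (P) with initial values $u_0$ and $v_0$ respectively, then $\mathbb P$-a.s. the function $t\mapsto u(t)-v(t)$, formed with the right-continuous representatives, has a continuous extension $[0,T]\to L^2(D)$, and, $u(T)-v(T)$ being understood as the value of this extension, $$\sup_{t\in[0,T]}\|u(t)-v(t)\|_{L^1(D)}\le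 C\,\|u_0-v_0\|_{L^1(D)}.$$ -/

import Mathlib

open MeasureTheory ProbabilityTheory Set Filter Topology
open scoped NNReal ENNReal Gradient

noncomputable section

namespace Obstacle

/-! ### Domains and test functions -/

/-- The Euclidean space `ℝ^d`. -/
abbrev Euc (d : ℕ) : Type := EuclideanSpace ℝ (Fin d)

/-- `D` has a Lipschitz boundary: near every boundary point, after a rotation, `D` is the set
lying strictly above the graph of a Lipschitz function. Here `n` is the vertical direction and
`γ` is a Lipschitz function of the component orthogonal to `n`. -/
def HasLipschitzBoundary {d : ℕ} (D : Set (Euc d)) : Prop :=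
  ∀ x ∈ frontier D, ∃ (n : Euc d) (γ : Euc d → ℝ) (K : ℝ≥0),
    ‖n‖ = 1 ∧ LipschitzWith K γ ∧ (∀ (y : Euc d) (s : ℝ), γ (y + s • n) = γ y) ∧
      ∀ᶠ y in 𝓝 x, (y ∈ D ↔ γ y < inner ℝ n y)

/-- A bounded Lipschitz domain: nonempty, open, connected, bounded, with Lipschitz boundary. -/
structure IsBoundedLipschitzDomain {d : ℕ} (D : Set (Euc d)) : Prop where
  isOpen : IsOpen D
  isConnected : IsConnected D
  isBounded : Bornology.IsBounded D
  lipschitz : HasLipschitzBoundary D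

/-- `φ ∈ C_c^∞(U)`. -/
structure IsTest {X : Type*} [NormedAddCommGroup X] [NormedSpace ℝ X] (U : Set X) (φ : X → ℝ) :
    Prop where
  smooth : ContDiff ℝ (⊤ : ℕ∞) φ
  compact : HasCompactSupport φ
  support : tsupport φ ⊆ U

/-- Lebesgue measure on `D`. -/
abbrev spaceMeas {d : ℕ} (D : Set (Euc d)) : Measure (Euc d) := volume.restrict D

/-- Lebesgue measure on `(0,T)`. -/
abbrev timeMeas (T : ℝ) : Measure ℝ := volume.restrict (Ioo 0 T)

/-- The space-time cylinder `Q_T = (0,T) × D`. -/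
abbrev cyl {d : ℕ} (T : ℝ) (D : Set (Euc d)) : Set (ℝ × Euc d) := Ioo 0 T ×ˢ D

/-- The Hilbert space `L²(D)`. -/
abbrev L2 {d : ℕ} (D : Set (Euc d)) : Type := Lp ℝ 2 (spaceMeas D)

/-! ### Sobolev and Bochner spaces -/

section Spaces

variable {d : ℕ}

/-- `W_0^{1,p}(D)`: the closure in `L^p(D) × L^p(D)^d` of the pairs `(φ, ∇φ)`, `φ ∈ C_c^∞(D)`.
An element is a pair (function, weak gradient); the norm is equivalent to the usual one. -/
def W01 (p : ℝ≥0∞) [Fact (1 ≤ p)] (D : Set (Euc d)) :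
    Submodule ℝ (Lp ℝ p (spaceMeas D) × Lp (Euc d) p (spaceMeas D)) :=
  (Submodule.span ℝ {w | ∃ φ : Euc d → ℝ, IsTest D φ ∧
    w.1 =ᵐ[spaceMeas D] φ ∧ w.2 =ᵐ[spaceMeas D] fun x => ∇ φ x}).topologicalClosure

/-- The Banach space `W_0^{1,p}(D)` as a type. -/
abbrev V (p : ℝ≥0∞) [Fact (1 ≤ p)] (D : Set (Euc d)) : Type := W01 p D

/-- `W^{-1,p'}(D)`, the topological dual of `W_0^{1,p}(D)`. -/
abbrev V' (p : ℝ≥0∞) [Fact (1 ≤ p)] (D : Set (Euc d)) : Type := StrongDual ℝ (V p D)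

instance (p : ℝ≥0∞) [Fact (1 ≤ p)] (D : Set (Euc d)) : NormedAddCommGroup (V p D) :=
  inferInstance

instance (p : ℝ≥0∞) [Fact (1 ≤ p)] (D : Set (Euc d)) : NormedSpace ℝ (V p D) :=
  inferInstance

instance (p : ℝ≥0∞) [Fact (1 ≤ p)] (D : Set (Euc d)) : NormedAddCommGroup (V' p D) :=
  inferInstance

instance (p : ℝ≥0∞) [Fact (1 ≤ p)] (D : Set (Euc d)) : NormedSpace ℝ (V' p D) :=
  inferInstance

/-- The function underlying an element of `W_0^{1,p}(D)`. -/
def V.fn {p : ℝ≥0∞} [Fact (1 ≤ p)] {D : Set (Euc d)} (w : V p D) : Lp ℝ p (spaceMeas D) :=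
  (w : Lp ℝ p (spaceMeas D) × Lp (Euc d) p (spaceMeas D)).1

/-- The weak gradient of an element of `W_0^{1,p}(D)`. -/
def V.grad {p : ℝ≥0∞} [Fact (1 ≤ p)] {D : Set (Euc d)} (w : V p D) :
    Lp (Euc d) p (spaceMeas D) :=
  (w : Lp ℝ p (spaceMeas D) × Lp (Euc d) p (spaceMeas D)).2

/-- `L^p(0,T; W_0^{1,p}(D))`. -/
abbrev LpV (p : ℝ≥0∞) [Fact (1 ≤ p)] (T : ℝ) (D : Set (Euc d)) : Type :=
  Lp (V p D) p (timeMeas T)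

/-- `L^{p'}(0,T; W^{-1,p'}(D))` (with `p' = q`). -/
abbrev LqV' (p q : ℝ≥0∞) [Fact (1 ≤ p)] (T : ℝ) (D : Set (Euc d)) : Type :=
  Lp (V' p D) q (timeMeas T)

instance (p : ℝ≥0∞) [Fact (1 ≤ p)] (T : ℝ) (D : Set (Euc d)) :
    NormedAddCommGroup (LpV p T D) := inferInstance

instance (p : ℝ≥0∞) [Fact (1 ≤ p)] (T : ℝ) (D : Set (Euc d)) :
    NormedSpace ℝ (LpV p T D) := inferInstance

instance (p q : ℝ≥0∞) [Fact (1 ≤ p)] [Fact (1 ≤ q)] (T : ℝ) (D : Set (Euc d)) :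
    NormedAddCommGroup (LqV' p q T D) := inferInstance

instance (p q : ℝ≥0∞) [Fact (1 ≤ p)] [Fact (1 ≤ q)] (T : ℝ) (D : Set (Euc d)) :
    NormedSpace ℝ (LqV' p q T D) := inferInstance

/-- `g = ∂_t v` in the sense of distributions with values in `W^{-1,p'}(D)`. -/
def IsTimeDeriv {p q : ℝ≥0∞} [Fact (1 ≤ p)] {T : ℝ} {D : Set (Euc d)}
    (v : LpV p T D) (g : LqV' p q T D) : Prop :=
  ∀ (θ : ℝ → ℝ) (φ : Euc d → ℝ) (w : V p D), IsTest (Ioo 0 T) θ → IsTest D φ →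
    w.fn =ᵐ[spaceMeas D] φ →
      ∫ t, deriv θ t * ∫ x, (v t).fn x * φ x ∂(spaceMeas D) ∂(timeMeas T)
        = - ∫ t, θ t * g t w ∂(timeMeas T)

theorem spacePairing_exists {p q : ℝ≥0∞} [Fact (1 ≤ p)] [Fact (1 ≤ q)] [p.HolderConjugate q]
    {D : Set (Euc d)} {φ : Euc d → ℝ} (hφ : IsTest D φ) :
    ∃ L : V p D →L[ℝ] ℝ, ∀ w : V p D, L w = ∫ x, w.fn x * φ x ∂(spaceMeas D) := by
  have hm : MemLp φ q (spaceMeas D) :=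
    hφ.smooth.continuous.memLp_of_hasCompactSupport hφ.compact
  refine ⟨(((ContinuousLinearMap.mul ℝ ℝ).lpPairing (spaceMeas D) p q).flip (hm.toLp φ)).comp
    ((ContinuousLinearMap.fst ℝ _ _).comp (W01 p D).subtypeL), fun w => ?_⟩
  change (ContinuousLinearMap.mul ℝ ℝ).lpPairing (spaceMeas D) p q w.fn (hm.toLp φ) = _
  rw [ContinuousLinearMap.lpPairing_eq_integral]
  refine integral_congr_ae ?_
  filter_upwards [hm.coeFn_toLp] with x hx
  simp [hx]

theorem integrable_mul_clm {X : Type*} [NormedAddCommGroup X] [NormedSpace ℝ X] {r : ℝ≥0∞}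
    [hr : Fact (1 ≤ r)] {T : ℝ} {θ : ℝ → ℝ} (hθ : Continuous θ) (hc : HasCompactSupport θ)
    (v : Lp X r (timeMeas T)) (L : X →L[ℝ] ℝ) :
    Integrable (fun t => θ t * L (v t)) (timeMeas T) := by
  have h1 : Integrable (fun t => L (v t)) (timeMeas T) :=
    L.integrable_comp ((Lp.memLp v).integrable hr.out)
  obtain ⟨M, hM⟩ := hc.exists_bound_of_continuous hθ
  exact h1.bdd_mul hθ.aestronglyMeasurable (Eventually.of_forall hM)

/-- `𝒲 = {v ∈ L^p(0,T; W_0^{1,p}(D)) | ∂_t v ∈ L^{p'}(0,T; W^{-1,p'}(D))}`. An element is the pair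
`(v, ∂_t v)`; the norm is equivalent to the usual one. -/
def WT (p q : ℝ≥0∞) [Fact (1 ≤ p)] [Fact (1 ≤ q)] [p.HolderConjugate q] (T : ℝ)
    (D : Set (Euc d)) : Submodule ℝ (LpV p T D × LqV' p q T D) where
  carrier := {w | IsTimeDeriv w.1 w.2}
  zero_mem' := by
    intro θ φ w hθ hφ _
    obtain ⟨L, hL⟩ := spacePairing_exists (p := p) (q := q) hφ
    have e1 : (fun t => deriv θ t * ∫ x, ((0 : LpV p T D) t).fn x * φ x ∂(spaceMeas D))
        =ᵐ[timeMeas T] fun _ => (0 : ℝ) := by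
      filter_upwards [Lp.coeFn_zero (V p D) p (timeMeas T)] with t ht
      rw [← hL, ht]; simp
    have e2 : (fun t => θ t * (0 : LqV' p q T D) t w) =ᵐ[timeMeas T] fun _ => (0 : ℝ) := by
      filter_upwards [Lp.coeFn_zero (V' p D) q (timeMeas T)] with t ht
      rw [ht]; simp
    change ∫ t, deriv θ t * ∫ x, ((0 : LpV p T D) t).fn x * φ x ∂(spaceMeas D) ∂(timeMeas T)
        = - ∫ t, θ t * (0 : LqV' p q T D) t w ∂(timeMeas T)
    rw [integral_congr_ae e1, integral_congr_ae e2]; simp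
  add_mem' := by
    intro a b ha hb θ φ w hθ hφ hw
    obtain ⟨L, hL⟩ := spacePairing_exists (p := p) (q := q) hφ
    have h1 := ha θ φ w hθ hφ hw
    have h2 := hb θ φ w hθ hφ hw
    simp only [← hL] at h1 h2
    have hc : Continuous (deriv θ) := hθ.smooth.continuous_deriv (by simp)
    have hs : HasCompactSupport (deriv θ) := hθ.compact.deriv
    have e1 : (fun t => deriv θ t * ∫ x, ((a.1 + b.1) t).fn x * φ x ∂(spaceMeas D))
        =ᵐ[timeMeas T] fun t => deriv θ t * L (a.1 t) + deriv θ t * L (b.1 t) := by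
      filter_upwards [Lp.coeFn_add a.1 b.1] with t ht
      rw [← hL, ht]; simp [mul_add]
    have e2 : (fun t => θ t * (a.2 + b.2) t w)
        =ᵐ[timeMeas T] fun t => θ t * a.2 t w + θ t * b.2 t w := by
      filter_upwards [Lp.coeFn_add a.2 b.2] with t ht
      rw [ht]; simp [mul_add]
    change ∫ t, deriv θ t * ∫ x, ((a.1 + b.1) t).fn x * φ x ∂(spaceMeas D) ∂(timeMeas T)
        = - ∫ t, θ t * (a.2 + b.2) t w ∂(timeMeas T)
    have i1 : Integrable (fun t => θ t * a.2 t w) (timeMeas T) :=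
      integrable_mul_clm hθ.smooth.continuous hθ.compact a.2 (ContinuousLinearMap.apply ℝ ℝ w)
    have i2 : Integrable (fun t => θ t * b.2 t w) (timeMeas T) :=
      integrable_mul_clm hθ.smooth.continuous hθ.compact b.2 (ContinuousLinearMap.apply ℝ ℝ w)
    rw [integral_congr_ae e1, integral_congr_ae e2,
      integral_add (integrable_mul_clm hc hs a.1 L) (integrable_mul_clm hc hs b.1 L),
      integral_add i1 i2, h1, h2]
    ring
  smul_mem' := by
    intro c a ha θ φ w hθ hφ hw
    obtain ⟨L, hL⟩ := spacePairing_exists (p := p) (q := q) hφ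
    have h1 := ha θ φ w hθ hφ hw
    simp only [← hL] at h1
    have e1 : (fun t => deriv θ t * ∫ x, ((c • a.1) t).fn x * φ x ∂(spaceMeas D))
        =ᵐ[timeMeas T] fun t => c * (deriv θ t * L (a.1 t)) := by
      filter_upwards [Lp.coeFn_smul c a.1] with t ht
      rw [← hL, ht]; simp; ring
    have e2 : (fun t => θ t * (c • a.2) t w) =ᵐ[timeMeas T] fun t => c * (θ t * a.2 t w) := by
      filter_upwards [Lp.coeFn_smul c a.2] with t ht
      rw [ht]; simp; ring
    change ∫ t, deriv θ t * ∫ x, ((c • a.1) t).fn x * φ x ∂(spaceMeas D) ∂(timeMeas T)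
        = - ∫ t, θ t * (c • a.2) t w ∂(timeMeas T)
    rw [integral_congr_ae e1, integral_congr_ae e2, integral_const_mul, integral_const_mul, h1]
    ring

/-- The dual space `𝒲'`. -/
abbrev WTDual (p q : ℝ≥0∞) [Fact (1 ≤ p)] [Fact (1 ≤ q)] [p.HolderConjugate q] (T : ℝ)
    (D : Set (Euc d)) : Type := StrongDual ℝ (WT p q T D)

instance (p q : ℝ≥0∞) [Fact (1 ≤ p)] [Fact (1 ≤ q)] [p.HolderConjugate q] (T : ℝ)
    (D : Set (Euc d)) : NormedAddCommGroup (WT p q T D) := inferInstance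

instance (p q : ℝ≥0∞) [Fact (1 ≤ p)] [Fact (1 ≤ q)] [p.HolderConjugate q] (T : ℝ)
    (D : Set (Euc d)) : NormedSpace ℝ (WT p q T D) := inferInstance

instance (p q : ℝ≥0∞) [Fact (1 ≤ p)] [Fact (1 ≤ q)] [p.HolderConjugate q] (T : ℝ)
    (D : Set (Euc d)) : NormedAddCommGroup (WTDual p q T D) := inferInstance

instance (p q : ℝ≥0∞) [Fact (1 ≤ p)] [Fact (1 ≤ q)] [p.HolderConjugate q] (T : ℝ)
    (D : Set (Euc d)) : NormedSpace ℝ (WTDual p q T D) := inferInstance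

/-- The element `v` of `L^p(0,T; W_0^{1,p}(D))` is the function `φ` on `Q_T`. -/
def Realizes {p : ℝ≥0∞} [Fact (1 ≤ p)] {T : ℝ} {D : Set (Euc d)} (v : LpV p T D)
    (φ : ℝ × Euc d → ℝ) : Prop :=
  ∀ᵐ t ∂(timeMeas T), (v t).fn =ᵐ[spaceMeas D] fun x => φ (t, x)

end Spaces

/-! ### Cylindrical Wiener processes and the Itô integral -/

section Ito

variable {Ω : Type*} {mΩ : MeasurableSpace Ω}
variable {H : Type*} [NormedAddCommGroup H] [InnerProductSpace ℝ H]

/-- `W` is a cylindrical Wiener process in `H` on `(Ω, P)` with respect to the filtration `𝓕`: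
it is linear in `h ∈ H`, and `W h` is a real `𝓕`-Brownian motion for every unit vector `h`. -/
structure IsCylindricalWiener (P : Measure Ω) (𝓕 : Filtration ℝ≥0 mΩ) (W : H → ℝ≥0 → Ω → ℝ) :
    Prop where
  linear : ∀ (a b : ℝ) (h k : H) (t : ℝ≥0),
    W (a • h + b • k) t =ᵐ[P] fun ω => a * W h t ω + b * W k t ω
  brownian : ∀ h : H, ‖h‖ = 1 → IsBrownianReal (W h) P
  adapted : ∀ h : H, StronglyAdapted 𝓕 (W h)
  indep : ∀ (h : H) (s t : ℝ≥0), s ≤ t →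
    Indep (MeasurableSpace.comap (fun ω => W h t ω - W h s ω) inferInstance) (𝓕 s) P

/-- The square of the Hilbert–Schmidt norm: the supremum of `∑ ‖A e‖²` over all finite orthonormal
systems (equivalently, the sum over any orthonormal basis). -/
def hsNormSq (A : H →L[ℝ] H) : ℝ≥0∞ :=
  ⨆ (n : ℕ) (e : Fin n → H) (_ : Orthonormal ℝ e), ∑ i, ‖A (e i)‖ₑ ^ 2

/-- `Φ` is progressively measurable and belongs to `L²(Ω × (0,T); HS(H))`. -/
structure IsIntegrand (P : Measure Ω) (𝓕 : Filtration ℝ≥0 mΩ) (T : ℝ)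
    (Φ : ℝ≥0 → Ω → H →L[ℝ] H) : Prop where
  progressive : ∀ h : H, IsStronglyProgressive 𝓕 fun t ω => Φ t ω h
  sqIntegrable : ∫⁻ ω, ∫⁻ t, hsNormSq (Φ t.toNNReal ω) ∂(timeMeas T) ∂P < ∞

/-- Data of an elementary integrand `∑_i 1_{(s_i,t_i]} 1_{A_i} ⟨h_i, ·⟩ g_i`, `A_i ∈ 𝓕_{s_i}`. -/
structure Elementary (𝓕 : Filtration ℝ≥0 mΩ) (H : Type*) where
  n : ℕ
  s : Fin n → ℝ≥0
  t : Fin n → ℝ≥0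
  A : Fin n → Set Ω
  h : Fin n → H
  g : Fin n → H
  le : ∀ i, s i ≤ t i
  meas : ∀ i, MeasurableSet[𝓕 (s i)] (A i)

/-- The operator-valued process given by an elementary integrand. -/
def Elementary.process {𝓕 : Filtration ℝ≥0 mΩ} (S : Elementary 𝓕 H) (r : ℝ≥0) (ω : Ω) :
    H →L[ℝ] H :=
  ∑ i, ((Ioc (S.s i) (S.t i)).indicator (fun _ => (1 : ℝ)) r *
    (S.A i).indicator (fun _ => (1 : ℝ)) ω) • InnerProductSpace.rankOne ℝ (S.g i) (S.h i)

/-- The stochastic integral over `(0,r]` of an elementary integrand. -/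
def Elementary.integral {𝓕 : Filtration ℝ≥0 mΩ} (S : Elementary 𝓕 H) (W : H → ℝ≥0 → Ω → ℝ)
    (r : ℝ≥0) (ω : Ω) : H :=
  ∑ i, ((S.A i).indicator (fun _ => (1 : ℝ)) ω *
    (W (S.h i) (min (S.t i) r) ω - W (S.h i) (min (S.s i) r) ω)) • S.g i

/-- `I` is (a continuous version of) the Itô integral `∫_0^· Φ dW` on `[0,T]`: the limit in mean
square of the integrals of elementary integrands converging to `Φ` in `L²(Ω × (0,T); HS(H))`. -/
def IsItoIntegral (P : Measure Ω) (𝓕 : Filtration ℝ≥0 mΩ) (T : ℝ) (W : H → ℝ≥0 → Ω → ℝ)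
    (Φ : ℝ≥0 → Ω → H →L[ℝ] H) (I : ℝ≥0 → Ω → H) : Prop :=
  StronglyAdapted 𝓕 I ∧
  (∀ᵐ ω ∂P, ContinuousOn (fun t => I t ω) (Icc 0 T.toNNReal)) ∧
  ∃ S : ℕ → Elementary 𝓕 H,
    Tendsto (fun n => ∫⁻ ω, ∫⁻ t, hsNormSq ((S n).process t.toNNReal ω - Φ t.toNNReal ω)
      ∂(timeMeas T) ∂P) atTop (𝓝 0) ∧
    ∀ t ∈ Icc 0 T.toNNReal,
      Tendsto (fun n => ∫⁻ ω, ‖(S n).integral W t ω - I t ω‖ₑ ^ 2 ∂P) atTop (𝓝 0)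

open Classical in
/-- The Itô integral process `∫_0^· Φ dW`, in a continuous version (which exists for every
integrand and is unique up to indistinguishability). -/
def itoIntegral (P : Measure Ω) (𝓕 : Filtration ℝ≥0 mΩ) (T : ℝ) (W : H → ℝ≥0 → Ω → ℝ)
    (Φ : ℝ≥0 → Ω → H →L[ℝ] H) : ℝ≥0 → Ω → H :=
  if h : ∃ I, IsItoIntegral P 𝓕 T W Φ I then h.choose else 0

end Ito

/-! ### The nonlinearity -/

/-- `a` is a Carathéodory function satisfying monotonicity, coercivity, growth and
Lipschitz regularity in the second variable; `q = p'`. -/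
structure IsAdmissible {d : ℕ} (p q : ℝ≥0∞) (D : Set (Euc d)) (a : Euc d → ℝ → Euc d → Euc d) :
    Prop where
  measurable : ∀ (l : ℝ) (ξ : Euc d), AEStronglyMeasurable (fun x => a x l ξ) (spaceMeas D)
  continuous : ∀ᵐ x ∂(spaceMeas D), Continuous fun z : ℝ × Euc d => a x z.1 z.2
  monotone : ∀ᵐ x ∂(spaceMeas D), ∀ (l : ℝ) (ξ ζ : Euc d),
    0 ≤ inner ℝ (a x l ξ - a x l ζ) (ξ - ζ)
  coercive : ∃ (κ : Euc d → ℝ) (C₁ : ℝ), MemLp κ 1 (spaceMeas D) ∧ 0 < C₁ ∧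
    ∀ᵐ x ∂(spaceMeas D), ∀ (l : ℝ) (ξ : Euc d),
      κ x + C₁ * ‖ξ‖ ^ p.toReal ≤ inner ℝ (a x l ξ) ξ
  growth : ∃ (C₂ C₃ : ℝ) (g : Euc d → ℝ), 0 ≤ C₂ ∧ 0 ≤ C₃ ∧ MemLp g q (spaceMeas D) ∧
    (∀ x, 0 ≤ g x) ∧ ∀ᵐ x ∂(spaceMeas D), ∀ (l : ℝ) (ξ : Euc d),
      ‖a x l ξ‖ ≤ C₂ * ‖ξ‖ ^ (p.toReal - 1) + C₃ * |l| ^ (p.toReal - 1) + g x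
  lipschitz : ∃ (C₄ : ℝ) (h : Euc d → ℝ), 0 ≤ C₄ ∧ MemLp h q (spaceMeas D) ∧
    (∀ x, 0 ≤ h x) ∧ ∀ᵐ x ∂(spaceMeas D), ∀ (l₁ l₂ : ℝ) (ξ : Euc d),
      ‖a x l₁ ξ - a x l₂ ξ‖ ≤ (C₄ * ‖ξ‖ ^ (p.toReal - 1) + h x) * |l₁ - l₂|

/-! ### Random measures and solutions -/

section Solutions

variable {d : ℕ} {Ω : Type*} {mΩ : MeasurableSpace Ω}

/-- `η` is a weak-* adapted random non-negative Radon measure on `Q_T` (each `η ω` is regarded as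
a measure on `ℝ × ℝ^d` carried by `Q_T`). -/
structure IsAdaptedRadon (𝓕 : Filtration ℝ≥0 mΩ) (T : ℝ) (D : Set (Euc d))
    (η : Ω → Measure (ℝ × Euc d)) : Prop where
  carried : ∀ ω, η ω (cyl T D)ᶜ = 0
  radon : ∀ ω, ∀ K : Set (ℝ × Euc d), IsCompact K → K ⊆ cyl T D → η ω K < ∞
  adapted : ∀ ψ : ℝ × Euc d → ℝ, Continuous ψ → HasCompactSupport ψ → tsupport ψ ⊆ cyl T D →
    ∀ t ∈ Ioo 0 T, Measurable[𝓕 t.toNNReal] fun ω => ∫ y in Ioc 0 t ×ˢ D, ψ y ∂(η ω)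

/-- The Radon measure `η` on `Q_T` is the element `g` of `L^{p'}(0,T; W^{-1,p'}(D))`. -/
def IsFunctional {p q : ℝ≥0∞} [Fact (1 ≤ p)] {T : ℝ} {D : Set (Euc d)}
    (η : Measure (ℝ × Euc d)) (g : LqV' p q T D) : Prop :=
  ∀ (φ : ℝ × Euc d → ℝ) (v : LpV p T D), IsTest (cyl T D) φ → Realizes v φ →
    ∫ t, g t (v t) ∂(timeMeas T) = ∫ y, φ y ∂η

/-- For `P`-almost every `ω`, `ub ω` is a representative of `u ω` with values in `L²(D)` which is
right-continuous on `[0,T)` and takes the value `u₀ ω` at `0` (so `u(0⁺) = u₀`). -/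
def IsRightContRep {p : ℝ≥0∞} [Fact (1 ≤ p)] {T : ℝ} {D : Set (Euc d)} (P : Measure Ω)
    (u₀ : Ω → L2 D) (u : Ω → LpV p T D) (ub : Ω → ℝ → L2 D) : Prop :=
  ∀ᵐ ω ∂P, (∀ᵐ t ∂(timeMeas T), ub ω t =ᵐ[spaceMeas D] (u ω t).fn) ∧
    (∀ t ∈ Ico 0 T, ContinuousWithinAt (ub ω) (Ici t) t) ∧ ub ω 0 = u₀ ω

/-- An admissible initial value: `u₀ ∈ L²(Ω × D)`, `𝓕_0`-measurable and non-negative. -/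
structure IsInitialValue (P : Measure Ω) (𝓕 : Filtration ℝ≥0 mΩ) {D : Set (Euc d)}
    (u₀ : Ω → L2 D) : Prop where
  measurable : StronglyMeasurable[𝓕 0] u₀
  memLp : MemLp u₀ 2 P
  nonneg : ∀ᵐ ω ∂P, 0 ≤ᵐ[spaceMeas D] u₀ ω

/-- `(u, η)` is a solution with regular reflection of
`du - div a(·,u,∇u) dt + f(u) dt = Φ dW + dη`, `u(0) = u₀`, `u = 0` on the lateral boundary,
`u ≥ 0`, `η ≥ 0`, `η(u) = 0`, where regular means that `P`-almost surely
`η ∈ L^{p'}(0,T; W^{-1,p'}(D))`. -/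
structure IsRegularSolution (p q : ℝ≥0∞) [Fact (1 ≤ p)] [Fact (1 ≤ q)] [p.HolderConjugate q]
    (T : ℝ) (D : Set (Euc d)) (P : Measure Ω) (𝓕 : Filtration ℝ≥0 mΩ)
    (W : L2 D → ℝ≥0 → Ω → ℝ) (Φ : ℝ≥0 → Ω → L2 D →L[ℝ] L2 D) (f : ℝ → ℝ)
    (a : Euc d → ℝ → Euc d → Euc d) (u₀ : Ω → L2 D) (u : Ω → LpV p T D)
    (η : Ω → Measure (ℝ × Euc d)) : Prop where
  nonneg : ∀ᵐ ω ∂P, ∀ᵐ t ∂(timeMeas T), 0 ≤ᵐ[spaceMeas D] (u ω t).fn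
  /-- `u ∈ L^p(Ω; L^p(0,T; W_0^{1,p}(D)))` -/
  memLp : MemLp u p P
  /-- `u ∈ L²_w(Ω; L^∞(0,T; L²(D)))` -/
  memLinfty : ∫⁻ ω, (essSup (fun t => eLpNorm (u ω t).fn 2 (spaceMeas D)) (timeMeas T)) ^ 2 ∂P < ∞
  rightCont : ∃ ub : Ω → ℝ → L2 D, IsRightContRep P u₀ u ub
  adaptedRadon : IsAdaptedRadon 𝓕 T D η
  /-- `η ∈ L^{p'}(Ω; 𝒲')` -/
  memDual : ∃ N : Ω → WTDual p q T D, MemLp N q P ∧ ∀ᵐ ω ∂P,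
    ∀ (φ : ℝ × Euc d → ℝ) (w : WT p q T D), IsTest (cyl T D) φ → Realizes w.1.1 φ →
      N ω w = ∫ y, φ y ∂(η ω)
  /-- The equation `∂_t[u - ∫_0^· Φ dW] - div a(·,u,∇u) + f(u) = η` -/
  equation : ∀ᵐ ω ∂P, ∀ φ : ℝ × Euc d → ℝ, IsTest (cyl T D) φ →
    - (∫ t, ∫ x, ((u ω t).fn x - itoIntegral P 𝓕 T W Φ t.toNNReal ω x) *
          deriv (fun s => φ (s, x)) t ∂(spaceMeas D) ∂(timeMeas T))
      + (∫ t, ∫ x, inner ℝ (a x ((u ω t).fn x) ((u ω t).grad x)) (∇ (fun y => φ (t, y)) x)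
          ∂(spaceMeas D) ∂(timeMeas T))
      + (∫ t, ∫ x, f ((u ω t).fn x) * φ (t, x) ∂(spaceMeas D) ∂(timeMeas T))
      = ∫ y, φ y ∂(η ω)
  /-- `η ∈ L^{p'}(0,T; W^{-1,p'}(D))` and `η(u) = 0`, i.e. `⟨η, u⟩ = 0` in the duality of
  `L^{p'}(0,T; W^{-1,p'}(D))` and `L^p(0,T; W_0^{1,p}(D))` -/
  reflection : ∀ᵐ ω ∂P, ∃ g : LqV' p q T D,
    IsFunctional (η ω) g ∧ ∫ t, g t (u ω t) ∂(timeMeas T) = 0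

end Solutions

end Obstacle

end

/-! Fix `ω`. Both solutions carry the same additive noise, so the Itô integral cancels in `z = u -
v`. What remains is a deterministic equation `z' = G` in `W^{-1,p'}(D)`, with `G = (η - ν) + div
(a(·,u,∇u) - a(·,v,∇v)) - (f(u) - f(v))`. Formally one tests it with `sign (u - v)`. The rigorous
test function is `S_δ(u - v)`, where `S_δ(s) = s/√(s² + δ²)` (`signApprox`) is the derivative of the
convex function `A_δ(s) = √(s² + δ²) - δ` (`absApprox`), and then `δ → 0`.

Three terms have to be controlled. Reflection: `η` acts as a positive functional at almost every
time, and `η(u) = 0` forces it to annihilate `u(t)` for a.e. `t`. Since `S_δ(u - v) ≤ u/δ` for `u, v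
≥ 0`, the contribution of `η` is at most `0`, and by symmetry so is that of `-ν`
(`V.apply_sign_sub_nonpos`). Flux: monotonicity in the gradient gives a good sign, and the
dependence of `a` on `u` leaves an error with integrand `k(v) |∇(u - v)| · |u - v| S_δ'(u - v)`. As
`|s| S_δ'(s)` lies in `[0, 1]` and tends to `0`, the error vanishes by dominated convergence
(`IsAdmissible.exists_fluxError`). Lower order term: `|S_δ| ≤ 1` bounds it by `L ‖u - v‖_1`, where
`L` is a Lipschitz constant of `f`. Gronwall's inequality then gives `C = exp (L T)`.

The chain rule for `∫ A_δ(z)` is needed only as an inequality, which is `energy_inequality`.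
Convexity compares `z(r + h)` with `z(r)`, averaging over `r` turns the difference quotient into
boundary averages, and `h → 0` uses right-continuity of `z` together with continuity of translations
in Bochner spaces. The same inequality for half the squared norm, applied to `z(· + h) - z`, gives a
modulus of continuity uniform in time; this yields the continuous extension to `[0, T]`.

The Sobolev part justifies the test function and the positivity of `η`: superposition operators act
on `W_0^{1,p}(D)`, gradients vanish on zero sets, and non-negative elements are limits of
non-negative test functions. -/

namespace Obstacle

/-! ### Translations and duality pairings in Bochner spaces -/

section Bochner

variable {E : Type*} [NormedAddCommGroup E]

/-- Composition with measure-preserving maps is continuous in `L^p` for finite `p`, jointly with the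
map in the compact-open topology; translations form a continuous family of such maps. -/
theorem tendsto_eLpNorm_translate_sub {p : ℝ≥0∞} [hp1 : Fact (1 ≤ p)] (hp : p ≠ ∞) {f : ℝ → E}
    (hf : MemLp f p volume) :
    Tendsto (fun h : ℝ => (eLpNorm (fun x => f (x + h) - f x) p volume).toReal) (𝓝 0) (𝓝 0) := by
  let g : C(ℝ, C(ℝ, ℝ)) := (ContinuousMap.mk (fun a : ℝ × ℝ => a.2 + a.1) (by fun_prop)).curry
  have hmp : ∀ h : ℝ, MeasurePreserving (g h) volume volume :=
    fun h => measurePreserving_add_right volume h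
  have hg : Continuous fun h : ℝ => Lp.compMeasurePreserving (g h) (hmp h) (hf.toLp f) :=
    continuous_const.compMeasurePreservingLp g.continuous hmp hp
  have h0 : Lp.compMeasurePreserving (g 0) (hmp 0) (hf.toLp f) = hf.toLp f := by
    rw [Lp.toLp_compMeasurePreserving]
    exact MemLp.toLp_congr _ _ (Eventually.of_forall fun x => by simp [g])
  have h1 := ((hg.sub continuous_const).norm.tendsto 0 :
    Tendsto (fun h : ℝ => ‖Lp.compMeasurePreserving (g h) (hmp h) (hf.toLp f) - hf.toLp f‖) _ _)
  simp only [Pi.sub_apply] at h1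
  rw [h0, sub_self, norm_zero] at h1
  refine h1.congr fun h => ?_
  rw [Lp.toLp_compMeasurePreserving, ← MemLp.toLp_sub, Lp.norm_toLp]
  rfl

theorem memLp_translate {p : ℝ≥0∞} {f : ℝ → E} (hf : MemLp f p volume) (h : ℝ) :
    MemLp (fun x => f (x + h)) p volume :=
  hf.comp_measurePreserving (measurePreserving_add_right volume h)

variable [NormedSpace ℝ E] {α : Type*} {mα : MeasurableSpace α} {μ : Measure α}

theorem integrable_pairing {p q : ℝ≥0∞} [p.HolderConjugate q] {G : α → StrongDual ℝ E}
    {w : α → E} (hG : MemLp G q μ) (hw : MemLp w p μ) :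
    Integrable (fun r => G r (w r)) μ ∧
      ∫ r, ‖G r (w r)‖ ∂μ ≤ (eLpNorm G q μ).toReal * (eLpNorm w p μ).toReal := by
  have hm : AEStronglyMeasurable (fun r => G r (w r)) μ :=
    (ContinuousLinearMap.apply ℝ ℝ).aestronglyMeasurable_comp₂ hw.1 hG.1
  have h1 : eLpNorm (fun r => G r (w r)) 1 μ ≤ eLpNorm G q μ * eLpNorm w p μ := by
    have := eLpNorm_le_eLpNorm_mul_eLpNorm_of_nnnorm (p := q) (q := p) (r := 1) hG.1 hw.1
      (fun (L : StrongDual ℝ E) x => L x) 1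
      (Eventually.of_forall fun r => by simpa using (G r).le_opNNNorm (w r))
    simpa using this
  have h2 : eLpNorm G q μ * eLpNorm w p μ ≠ ∞ := ENNReal.mul_ne_top hG.2.ne hw.2.ne
  have hi : Integrable (fun r => G r (w r)) μ :=
    memLp_one_iff_integrable.1 ⟨hm, h1.trans_lt h2.lt_top⟩
  refine ⟨hi, ?_⟩
  rw [integral_norm_eq_lintegral_enorm hm, ← ENNReal.toReal_mul, ← eLpNorm_one_eq_lintegral_enorm]
  exact ENNReal.toReal_mono h2 h1

theorem abs_setIntegral_pairing_le {p q : ℝ≥0∞} [p.HolderConjugate q] {G : ℝ → StrongDual ℝ E}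
    {w : ℝ → E} (hG : MemLp G q volume) (hw : MemLp w p volume) {s t : ℝ} (hst : s ≤ t) :
    |∫ r in s..t, G r (w r)| ≤ (eLpNorm G q volume).toReal * (eLpNorm w p volume).toReal := by
  obtain ⟨hi, hle⟩ := integrable_pairing hG hw
  rw [intervalIntegral.integral_of_le hst]
  calc _ ≤ ∫ r in Ioc s t, ‖G r (w r)‖ := norm_integral_le_integral_norm _
    _ ≤ ∫ r, ‖G r (w r)‖ := setIntegral_le_integral hi.norm (Eventually.of_forall fun _ => norm_nonneg _)
    _ ≤ _ := hle

/-- The two factors carry independent shifts, because the averaged energy estimate moves the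
functional by `h σ` and its argument by `h`. One factor is changed at a time, and norms are
translation invariant. -/
theorem abs_integral_translate_pairing_sub_le {p q : ℝ≥0∞} [p.HolderConjugate q]
    {G : ℝ → StrongDual ℝ E} {n : ℝ → E} (hG : MemLp G q volume) (hn : MemLp n p volume)
    {s t : ℝ} (hst : s ≤ t) (a b : ℝ) :
    |(∫ r in s..t, G (r + a) (n (r + b))) - ∫ r in s..t, G r (n r)| ≤
      (eLpNorm (fun r => G (r + a) - G r) q volume).toReal * (eLpNorm n p volume).toReal +
        (eLpNorm G q volume).toReal * (eLpNorm (fun r => n (r + b) - n r) p volume).toReal := by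
  have hGa := memLp_translate hG a
  have hnb := memLp_translate hn b
  have e : (∫ r in s..t, G (r + a) (n (r + b))) - ∫ r in s..t, G r (n r) =
      (∫ r in s..t, (G (r + a) - G r) (n (r + b))) + ∫ r in s..t, G r (n (r + b) - n r) := by
    have i1 : IntervalIntegrable (fun r => (G (r + a) - G r) (n (r + b))) volume s t :=
      (integrable_pairing (hGa.sub hG) hnb).1.intervalIntegrable
    have i2 : IntervalIntegrable (fun r => G r (n (r + b) - n r)) volume s t :=
      (integrable_pairing hG (hnb.sub hn)).1.intervalIntegrable
    rw [← intervalIntegral.integral_sub (integrable_pairing hGa hnb).1.intervalIntegrable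
      (integrable_pairing hG hn).1.intervalIntegrable, ← intervalIntegral.integral_add i1 i2]
    exact intervalIntegral.integral_congr fun r _ => by simp
  have hnorm : eLpNorm (fun r => n (r + b)) p volume = eLpNorm n p volume :=
    eLpNorm_comp_measurePreserving hn.1 (measurePreserving_add_right volume b)
  rw [e]
  refine (abs_add_le _ _).trans (add_le_add ?_ ?_)
  · have := abs_setIntegral_pairing_le (hGa.sub hG) hnb hst
    rw [hnorm] at this
    exact this
  · exact abs_setIntegral_pairing_le hG (hnb.sub hn) hst

end Bochner
end Obstacle

/-! ### Energy inequality for convex functionals and continuity in time -/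

namespace Obstacle

/-- The one-sided fundamental theorem of calculus; only right-continuity is available at this stage.
-/
theorem tendsto_average_right {j : ℝ → ℝ} {c T : ℝ} (hcT : c < T)
    (hj : ContinuousWithinAt j (Ici c) c) (hi : IntegrableOn j (Ioo c T)) :
    Tendsto (fun h => h⁻¹ * ∫ r in c..c + h, j r) (𝓝[>] 0) (𝓝 (j c)) := by
  have hm : StronglyMeasurableAtFilter j (𝓝[>] c) volume :=
    ⟨Ioo c T, Ioo_mem_nhdsGT hcT, hi.1⟩
  have h1 : HasDerivWithinAt (fun u => ∫ x in c..u, j x) (j c) (Ici c) c :=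
    intervalIntegral.integral_hasDerivWithinAt_right (by simp) hm
      (hj.mono Ioi_subset_Ici_self)
  have h2 := (hasDerivWithinAt_iff_tendsto_slope.1 h1)
  have h3 : Tendsto (fun h : ℝ => c + h) (𝓝[>] 0) (𝓝[Ici c \ {c}] c) := by
    refine tendsto_nhdsWithin_iff.2 ⟨?_, ?_⟩
    · have : Tendsto (fun h : ℝ => c + h) (𝓝 0) (𝓝 (c + 0)) := by
        exact (continuous_const.add continuous_id).tendsto 0
      rw [add_zero] at this
      exact this.mono_left nhdsWithin_le_nhds
    · filter_upwards [self_mem_nhdsWithin] with h hh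
      have : (0 : ℝ) < h := hh
      exact ⟨by simpa using this.le, by simpa using this.ne'⟩
  refine (h2.comp h3).congr fun h => ?_
  simp [slope]

section Energy

variable {E : Type*} [NormedAddCommGroup E] [NormedSpace ℝ E]
  {X : Type*} [NormedAddCommGroup X] [InnerProductSpace ℝ X]

/-- Needed for Fubini in the averaged estimate. Measurability of `G (r + h σ)` comes from the shear
`(σ, r) ↦ (σ, r + h σ)`, which preserves the product measure; Hölder's inequality bounds the inner
integrals uniformly in `σ`. -/
theorem integrable_translate_pairing_prod {p q : ℝ≥0∞} [p.HolderConjugate q]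
    {G : ℝ → StrongDual ℝ E} {n : ℝ → E} (hG : MemLp G q volume) (hn : MemLp n p volume)
    (s t h : ℝ) :
    Integrable (fun y : ℝ × ℝ => G (y.2 + h * y.1) (n (y.2 + h)))
      ((volume.restrict (Ioc 0 1)).prod (volume.restrict (Ioc s t))) := by
  have hle : ((volume.restrict (Ioc (0 : ℝ) 1)).prod (volume.restrict (Ioc s t))) ≤
      (volume.restrict (Ioc (0 : ℝ) 1)).prod volume :=
    Measure.prod_mono le_rfl Measure.restrict_le_self
  refine Integrable.mono_measure ?_ hle
  have hshear : MeasurePreserving (fun y : ℝ × ℝ => (y.1, y.2 + h * y.1))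
      ((volume.restrict (Ioc (0 : ℝ) 1)).prod volume)
      ((volume.restrict (Ioc (0 : ℝ) 1)).prod volume) :=
    (MeasurePreserving.id _).skew_product (g := fun a c : ℝ => c + h * a) (by fun_prop)
      (Eventually.of_forall fun a => (measurePreserving_add_right volume (h * a)).map_eq)
  have m1 : AEStronglyMeasurable (fun y : ℝ × ℝ => G (y.2 + h * y.1))
      ((volume.restrict (Ioc (0 : ℝ) 1)).prod volume) :=
    hG.1.comp_quasiMeasurePreserving
      (Measure.quasiMeasurePreserving_snd.comp hshear.quasiMeasurePreserving)
  have m2 : AEStronglyMeasurable (fun y : ℝ × ℝ => n (y.2 + h))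
      ((volume.restrict (Ioc (0 : ℝ) 1)).prod volume) :=
    hn.1.comp_quasiMeasurePreserving
      ((measurePreserving_add_right volume h).quasiMeasurePreserving.comp
        Measure.quasiMeasurePreserving_snd)
  have m : AEStronglyMeasurable (fun y : ℝ × ℝ => G (y.2 + h * y.1) (n (y.2 + h)))
      ((volume.restrict (Ioc (0 : ℝ) 1)).prod volume) :=
    (ContinuousLinearMap.apply ℝ ℝ).aestronglyMeasurable_comp₂ m2 m1
  rw [integrable_prod_iff m]
  refine ⟨Eventually.of_forall fun a =>
    (integrable_pairing (memLp_translate hG (h * a)) (memLp_translate hn h)).1, ?_⟩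
  refine Integrable.mono' (integrable_const ((eLpNorm G q volume).toReal *
    (eLpNorm n p volume).toReal)) m.norm.integral_prod_right' (Eventually.of_forall fun a => ?_)
  rw [Real.norm_of_nonneg (integral_nonneg fun _ => norm_nonneg _)]
  have h1 := (integrable_pairing (memLp_translate hG (h * a)) (memLp_translate hn h)).2
  have n1 : eLpNorm (fun x => G (x + h * a)) q volume = eLpNorm G q volume :=
    eLpNorm_comp_measurePreserving hG.1 (measurePreserving_add_right volume (h * a))
  have n2 : eLpNorm (fun x => n (x + h)) p volume = eLpNorm n p volume :=
    eLpNorm_comp_measurePreserving hn.1 (measurePreserving_add_right volume h)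
  rwa [n1, n2] at h1

/-- For `0 < σ ≤ 1` the shift `h σ` is no larger than `h`, so the convergence of the inner integral
is uniform in `σ`. -/
theorem tendsto_integral_translate_pairing {p q : ℝ≥0∞} [hp1 : Fact (1 ≤ p)] [hq1 : Fact (1 ≤ q)]
    [p.HolderConjugate q] (hp : p ≠ ∞) (hq : q ≠ ∞)
    {G : ℝ → StrongDual ℝ E} {n : ℝ → E} (hG : MemLp G q volume) (hn : MemLp n p volume)
    {s t : ℝ} (hst : s ≤ t) :
    Tendsto (fun h => ∫ σ in (0 : ℝ)..1, ∫ r in s..t, G (r + h * σ) (n (r + h))) (𝓝[>] 0)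
      (𝓝 (∫ r in s..t, G r (n r))) := by
  have hGn : 0 ≤ (eLpNorm G q volume).toReal := ENNReal.toReal_nonneg
  have hnn : 0 ≤ (eLpNorm n p volume).toReal := ENNReal.toReal_nonneg
  rw [Metric.tendsto_nhds]
  intro ε hε
  -- With both translation errors below `ε / (2 M)`, the total error is at most `(M - 1) ε / (2 M) <
  -- ε`; the summand `1` keeps `M` positive.
  set M := (eLpNorm G q volume).toReal + (eLpNorm n p volume).toReal + 1 with hM
  have hMpos : 0 < M := by positivity
  have e1 := Metric.tendsto_nhds.1 (tendsto_eLpNorm_translate_sub hq hG) (ε / (2 * M)) (by positivity)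
  have e2 := Metric.tendsto_nhds.1 (tendsto_eLpNorm_translate_sub hp hn) (ε / (2 * M)) (by positivity)
  obtain ⟨δ, hδ, hδ'⟩ := Metric.eventually_nhds_iff.1 (e1.and e2)
  filter_upwards [Ioo_mem_nhdsGT hδ] with h hh
  have hK : ∀ σ ∈ Ioc (0 : ℝ) 1, ‖(∫ r in s..t, G (r + h * σ) (n (r + h))) -
      ∫ r in s..t, G r (n r)‖ ≤ ε * (M - 1) / (2 * M) := by
    intro σ hσ
    have b1 := (hδ' (y := h * σ) (by
      rw [Real.dist_0_eq_abs, abs_of_nonneg (mul_nonneg hh.1.le hσ.1.le)]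
      exact lt_of_le_of_lt (mul_le_of_le_one_right hh.1.le hσ.2) hh.2)).1
    have b2 := (hδ' (y := h) (by rw [Real.dist_0_eq_abs, abs_of_nonneg hh.1.le]; exact hh.2)).2
    rw [Real.dist_0_eq_abs, abs_of_nonneg ENNReal.toReal_nonneg] at b1 b2
    refine (abs_integral_translate_pairing_sub_le hG hn hst (h * σ) h).trans ?_
    have c1 := mul_le_mul_of_nonneg_right b1.le hnn
    have c2 := mul_le_mul_of_nonneg_left b2.le hGn
    refine (add_le_add c1 c2).trans (le_of_eq ?_)
    rw [hM]; ring
  have hint : IntervalIntegrable (fun σ => ∫ r in s..t, G (r + h * σ) (n (r + h))) volume 0 1 := by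
    rw [intervalIntegrable_iff_integrableOn_Ioc_of_le zero_le_one]
    have := (integrable_translate_pairing_prod hG hn s t h).integral_prod_left
    refine this.congr (Eventually.of_forall fun σ => ?_)
    simp only [intervalIntegral.integral_of_le hst]
  have e : (∫ σ in (0 : ℝ)..1, ∫ r in s..t, G (r + h * σ) (n (r + h))) - ∫ r in s..t, G r (n r) =
      ∫ σ in (0 : ℝ)..1, ((∫ r in s..t, G (r + h * σ) (n (r + h))) - ∫ r in s..t, G r (n r)) := by
    rw [intervalIntegral.integral_sub hint intervalIntegrable_const]; simp
  rw [dist_eq_norm, e]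
  refine (intervalIntegral.norm_integral_le_of_norm_le_const
    (fun σ hσ => hK σ (by rwa [uIoc_of_le zero_le_one] at hσ))).trans_lt ?_
  rw [sub_zero, abs_one, mul_one, div_lt_iff₀ (by positivity)]
  nlinarith

/-- By `hconv`, `ι (N x)` is a subgradient of `J` at `ι x`. Using it at the later time gives `J (z
(r + h)) - J (z r) ≤ ∫ G τ (N (w (r + h))) dτ` over `[r, r + h]`, for a.e. `r`. Dividing by `h` and
integrating over `r ∈ [s, t]` makes the left side telescope to averages of `J ∘ z` just after `t`
and just after `s`, while the right side converges by continuity of translations. No time derivative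
of `w` or of `N ∘ w` is required. -/
theorem energy_inequality {p q : ℝ≥0∞} [hp1 : Fact (1 ≤ p)] [hq1 : Fact (1 ≤ q)]
    [p.HolderConjugate q] (hp : p ≠ ∞) (hq : q ≠ ∞) {T : ℝ} {ι : E →L[ℝ] X} {z : ℝ → X}
    {w : ℝ → E} {G : ℝ → StrongDual ℝ E} (hz : ∀ t ∈ Ico 0 T, ContinuousWithinAt z (Ici t) t)
    (hzw : ∀ᵐ r : ℝ, r ∈ Ioo 0 T → z r = ι (w r)) (hG : MemLp G q volume)
    (heq : ∀ s t, 0 ≤ s → s ≤ t → t < T → ∀ ψ : E,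
      inner ℝ (z t - z s) (ι ψ) = ∫ r in s..t, G r ψ)
    {J : X → ℝ} {N : E → E} (hJ : Continuous J) (hN : MemLp (fun r => N (w r)) p volume)
    (hJi : IntegrableOn (fun r => J (z r)) (Ioo 0 T))
    (hconv : ∀ (x : E) (a : X), J (ι x) - J a ≤ inner ℝ (ι x - a) (ι (N x)))
    {s t : ℝ} (hs : 0 ≤ s) (hst : s ≤ t) (ht : t < T) :
    J (z t) - J (z s) ≤ ∫ r in s..t, G r (N (w r)) := by
  have hjc : ∀ c ∈ Ico 0 T, ContinuousWithinAt (fun r => J (z r)) (Ici c) c :=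
    fun c hc => hJ.continuousAt.comp_continuousWithinAt (hz c hc)
  have ii : ∀ a b, 0 ≤ a → a < T → 0 ≤ b → b < T →
      IntervalIntegrable (fun r => J (z r)) volume a b := by
    intro a b ha ha' hb hb'
    rw [intervalIntegrable_iff]
    have : uIoc a b ⊆ Ioo 0 T := fun r hr => by
      rw [mem_uIoc] at hr
      rcases hr with hr | hr
      exacts [⟨ha.trans_lt hr.1, hr.2.trans_lt hb'⟩, ⟨hb.trans_lt hr.1, hr.2.trans_lt ha'⟩]
    exact hJi.mono_set this
  have lim1 := (tendsto_average_right ht (hjc t ⟨hs.trans hst, ht⟩)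
    (hJi.mono_set (Ioo_subset_Ioo_left (hs.trans hst)))).sub
    (tendsto_average_right (hst.trans_lt ht) (hjc s ⟨hs, hst.trans_lt ht⟩)
    (hJi.mono_set (Ioo_subset_Ioo_left hs)))
  refine le_of_tendsto_of_tendsto lim1 (tendsto_integral_translate_pairing hp hq hG hN hst) ?_
  filter_upwards [Ioo_mem_nhdsGT (sub_pos.2 ht)] with h hh
  have hh0 : 0 < h := hh.1
  have hhT : t + h < T := by have := hh.2; linarith
  have hi1 : IntervalIntegrable (fun r => J (z (r + h))) volume s t := by
    have := (ii (s + h) (t + h) (by linarith) (by linarith) (by linarith) hhT).comp_add_right h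
    simpa using this
  have hi0 := ii s t hs (hst.trans_lt ht) (hs.trans hst) ht
  -- The integrals over the common interval `[s + h, t]` cancel (in the oriented sense if `t < s +
  -- h`).
  have shift : (∫ r in t..t + h, J (z r)) - ∫ r in s..s + h, J (z r) =
      ∫ r in s..t, (J (z (r + h)) - J (z r)) := by
    rw [intervalIntegral.integral_sub hi1 hi0,
      intervalIntegral.integral_comp_add_right (fun r => J (z r)) h]
    have a1 := intervalIntegral.integral_add_adjacent_intervals
      (ii s t hs (hst.trans_lt ht) (hs.trans hst) ht)
      (ii t (t + h) (hs.trans hst) ht (by linarith) hhT)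
    have a2 := intervalIntegral.integral_add_adjacent_intervals
      (ii s (s + h) hs (hst.trans_lt ht) (by linarith) (by linarith))
      (ii (s + h) (t + h) (by linarith) (by linarith) (by linarith) hhT)
    linarith
  rw [← mul_sub, shift, inv_mul_le_iff₀ hh0]
  have hprod := integrable_translate_pairing_prod hG hN s t h
  have swap : (∫ σ in (0 : ℝ)..1, ∫ r in s..t, G (r + h * σ) (N (w (r + h)))) =
      ∫ r in s..t, ∫ σ in (0 : ℝ)..1, G (r + h * σ) (N (w (r + h))) := by
    simp only [intervalIntegral.integral_of_le hst, intervalIntegral.integral_of_le zero_le_one]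
    exact integral_integral_swap (f := fun σ r => G (r + h * σ) (N (w (r + h)))) hprod
  rw [swap, ← intervalIntegral.integral_const_mul]
  refine intervalIntegral.integral_mono_ae_restrict hst (hi1.sub hi0) ?_ ?_
  · rw [intervalIntegrable_iff_integrableOn_Ioc_of_le hst]
    refine (hprod.integral_prod_right.const_mul h).congr (Eventually.of_forall fun r => ?_)
    simp only [intervalIntegral.integral_of_le zero_le_one]
  · have hzw' : ∀ᵐ r : ℝ, r + h ∈ Ioo 0 T → z (r + h) = ι (w (r + h)) :=
      (measurePreserving_add_right volume h).quasiMeasurePreserving.ae hzw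
    filter_upwards [ae_restrict_of_ae hzw', ae_restrict_mem measurableSet_Icc] with r hr hrm
    have hr' := hr ⟨by linarith [hrm.1], by linarith [hrm.2]⟩
    -- The subgradient is taken at `r + h`, where `z` is the image of `w`; at time `r` the value `z
    -- r` need not be in the range of `ι`.
    have key := hconv (w (r + h)) (z r)
    rw [← hr', heq r (r + h) (hs.trans hrm.1) (by linarith) (by linarith [hrm.2])] at key
    have sub := intervalIntegral.mul_integral_comp_add_mul (a := 0) (b := 1)
      (f := fun τ => G τ (N (w (r + h)))) h r
    simp only [mul_zero, add_zero, mul_one] at sub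
    rw [sub]
    exact key

/-- A right-continuous solution of `z' = G` in the dual of `E` is uniformly continuous with values
in the pivot space. -/
theorem norm_translate_sub_le {p q : ℝ≥0∞} [hp1 : Fact (1 ≤ p)] [hq1 : Fact (1 ≤ q)]
    [p.HolderConjugate q] (hp : p ≠ ∞) (hq : q ≠ ∞) {T : ℝ} {ι : E →L[ℝ] X} {z : ℝ → X}
    {w : ℝ → E} {G : ℝ → StrongDual ℝ E} (hz : ∀ t ∈ Ico 0 T, ContinuousWithinAt z (Ici t) t)
    (hzw : ∀ᵐ r : ℝ, r ∈ Ioo 0 T → z r = ι (w r)) (hG : MemLp G q volume)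
    (hw : MemLp w p volume) (hp2 : 2 ≤ p)
    (heq : ∀ s t, 0 ≤ s → s ≤ t → t < T → ∀ ψ : E,
      inner ℝ (z t - z s) (ι ψ) = ∫ r in s..t, G r ψ)
    {t h : ℝ} (ht : 0 ≤ t) (hh : 0 ≤ h) (hth : t + h < T) :
    ‖z (t + h) - z t‖ ^ 2 / 2 ≤ ‖z h - z 0‖ ^ 2 / 2 +
      (eLpNorm (fun r => G (r + h) - G r) q volume).toReal *
        (eLpNorm (fun r => w (r + h) - w r) p volume).toReal := by
  have hzw' : ∀ᵐ r : ℝ, r + h ∈ Ioo 0 T → z (r + h) = ι (w (r + h)) :=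
    (measurePreserving_add_right volume h).quasiMeasurePreserving.ae hzw
  have hGh : MemLp (fun r => G (r + h) - G r) q volume := (memLp_translate hG h).sub hG
  have hwh : MemLp (fun r => w (r + h) - w r) p volume := (memLp_translate hw h).sub hw
  have hzwh : ∀ᵐ r : ℝ, r ∈ Ioo 0 (T - h) → z (r + h) - z r = ι (w (r + h) - w r) := by
    filter_upwards [hzw, hzw'] with r h1 h2 hr
    rw [h2 ⟨by linarith [hr.1], by linarith [hr.2]⟩, h1 ⟨hr.1, by linarith [hr.2]⟩, map_sub]
  -- The increment `z(· + h) - z` solves the equation with right side `G(· + h) - G` on `[0, T -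
  -- h)`, so the energy inequality with `N = id` compares its norm at `t` with its norm at `0`.
  have key := energy_inequality (T := T - h) (ι := ι) (z := fun r => z (r + h) - z r)
    (w := fun r => w (r + h) - w r) (G := fun r => G (r + h) - G r)
    (J := fun x => ‖x‖ ^ 2 / 2) (N := id) hp hq ?_ hzwh hGh ?_ (by fun_prop) hwh ?_ ?_
    le_rfl ht (by linarith)
  · simp only [zero_add] at key
    have b := abs_setIntegral_pairing_le hGh hwh ht
    have := (le_abs_self _).trans b
    simp only [id] at key
    linarith
  · intro r hr
    refine ContinuousWithinAt.sub ?_ (hz r ⟨hr.1, by linarith [hr.2]⟩)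
    refine (hz (r + h) ⟨by linarith [hr.1], by linarith [hr.2]⟩).comp
      (f := fun r => r + h) (by fun_prop) fun x hx => ?_
    simpa using hx
  · intro s t hs hst ht ψ
    have i1 : ∀ a b, IntervalIntegrable (fun r => G r ψ) volume a b := by
      intro a b
      have : MemLp (fun r => G r ψ) q volume :=
        (ContinuousLinearMap.apply ℝ ℝ ψ).comp_memLp' hG
      exact (this.locallyIntegrable hq1.out |>.integrableOn_isCompact isCompact_uIcc).intervalIntegrable
    have i2 : IntervalIntegrable (fun r => G (r + h) ψ) volume s t := by
      have := (i1 (s + h) (t + h)).comp_add_right h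
      simpa using this
    have e1 := heq (s + h) (t + h) (by linarith) (by linarith) (by linarith) ψ
    have e0 := heq s t hs hst (by linarith) ψ
    simp only [_root_.sub_apply]
    rw [intervalIntegral.integral_sub i2 (i1 s t),
      intervalIntegral.integral_comp_add_right (fun r => G r ψ) h, ← e1, ← e0, ← inner_sub_left]
    congr 1
    abel
  · have m2 : MemLp (fun r => ι (w (r + h) - w r)) 2 (volume.restrict (Ioo 0 (T - h))) :=
      ((ι.comp_memLp' hwh).restrict _).mono_exponent hp2
    have : Integrable (fun r => ‖ι (w (r + h) - w r)‖ ^ 2 / 2) (volume.restrict (Ioo 0 (T - h))) :=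
      ((memLp_two_iff_integrable_sq_norm m2.1).1 m2).div_const 2
    refine this.congr ?_
    filter_upwards [ae_restrict_of_ae hzwh, ae_restrict_mem measurableSet_Ioo] with r h1 h2
    rw [h1 h2]
  · intro x a
    have := sq_nonneg ‖ι x - a‖
    have e := norm_sub_sq_real (ι x) a
    simp only [id, inner_sub_left, real_inner_self_eq_norm_sq, real_inner_comm (ι x) a]
    nlinarith

end Energy

/-- The modulus `ρ` does not depend on `t`, so `z` is uniformly continuous on `[0, T)`. Completeness
then provides the limit at `T`. -/
theorem exists_continuousOn_Icc_of_translate {X : Type*} [NormedAddCommGroup X] [CompleteSpace X]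
    {T : ℝ} (hT : 0 < T) {z : ℝ → X}
    {ρ : ℝ → ℝ} (hρ : Tendsto ρ (𝓝[≥] 0) (𝓝 0))
    (h : ∀ t h, 0 ≤ t → 0 ≤ h → t + h < T → ‖z (t + h) - z t‖ ^ 2 ≤ ρ h) :
    ∃ Z : ℝ → X, ContinuousOn Z (Icc 0 T) ∧ ∀ t ∈ Ico 0 T, Z t = z t := by
  have huc : UniformContinuousOn z (Ico 0 T) := by
    rw [Metric.uniformContinuousOn_iff]
    intro ε hε
    have e := Metric.tendsto_nhds.1 hρ (ε ^ 2) (by positivity)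
    rw [eventually_nhdsWithin_iff] at e
    obtain ⟨δ, hδ, hδ'⟩ := Metric.eventually_nhds_iff.1 e
    have main : ∀ x y, x ∈ Ico 0 T → y ∈ Ico 0 T → x ≤ y → dist x y < δ → dist (z x) (z y) < ε := by
      intro x y hx hy hxy hd
      have h1 := h x (y - x) hx.1 (by linarith) (by linarith [hy.2])
      have h2 := hδ' (y := y - x) (by rw [Real.dist_0_eq_abs, ← Real.dist_eq, dist_comm]; exact hd)
        (by simpa using hxy)
      rw [Real.dist_0_eq_abs] at h2
      rw [add_sub_cancel] at h1
      rw [dist_comm, dist_eq_norm]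
      exact lt_of_pow_lt_pow_left₀ 2 hε.le ((h1.trans (le_abs_self _)).trans_lt h2)
    refine ⟨δ, hδ, fun x hx y hy hd => ?_⟩
    rcases le_total x y with hxy | hxy
    · exact main x y hx hy hxy hd
    · rw [dist_comm]
      exact main y x hy hx hxy (by rwa [dist_comm])
  have hne : (𝓝[Ico 0 T] T).NeBot := by
    rw [← mem_closure_iff_nhdsWithin_neBot, closure_Ico hT.ne]
    exact right_mem_Icc.2 hT.le
  have hcau : Cauchy (map z (𝓝[Ico 0 T] T)) := by
    refine ⟨hne.map z, ?_⟩
    have h1 : Tendsto (fun y : ℝ × ℝ => (z y.1, z y.2))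
        (uniformity ℝ ⊓ 𝓟 (Ico 0 T ×ˢ Ico 0 T)) (uniformity X) := huc
    rw [prod_map_map_eq]
    refine h1.mono_left (le_inf ?_ ?_)
    · exact (Filter.prod_mono inf_le_left inf_le_left).trans
        (by rw [← nhds_prod_eq]; exact nhds_le_uniformity T)
    · rw [← Filter.prod_principal_principal]
      exact Filter.prod_mono inf_le_right inf_le_right
  obtain ⟨L, hL⟩ := CompleteSpace.complete hcau
  refine ⟨Function.update z T L, ?_, fun t ht => Function.update_of_ne ht.2.ne _ _⟩
  rw [← Ico_insert_right hT.le]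
  intro x hx
  rcases hx with rfl | hx
  · rw [continuousWithinAt_update_same]
    have : insert x (Ico 0 x) \ {x} = Ico 0 x := by
      ext y; simp only [Set.mem_sdiff, mem_insert_iff, mem_singleton_iff, mem_Ico]
      constructor
      · rintro ⟨h | h, h'⟩
        exacts [absurd h h', h]
      · exact fun h => ⟨Or.inr h, h.2.ne⟩
    rw [this]
    exact hL
  · rw [continuousWithinAt_update_of_ne hx.2.ne]
    have hc := huc.continuousOn x hx
    refine hc.mono_of_mem_nhdsWithin ?_
    refine mem_nhdsWithin.2 ⟨Iio T, isOpen_Iio, hx.2, ?_⟩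
    rintro y ⟨hy, hy'⟩
    rcases hy' with rfl | hy'
    exacts [absurd (mem_Iio.1 hy) (lt_irrefl _), hy']

end Obstacle

/-! ### Smooth cutoffs in time and the fundamental lemma -/

namespace Obstacle

/-- A smooth function equal to `1` on `[s + ε, t]` and to `0` outside `[s, t + ε]`. -/
noncomputable def cutoff (s t ε : ℝ) (r : ℝ) : ℝ :=
  Real.smoothTransition ((r - s) / ε) - Real.smoothTransition ((r - t) / ε)

theorem cutoff_nonneg {s t ε : ℝ} (hst : s ≤ t) (hε : 0 < ε) (r : ℝ) : 0 ≤ cutoff s t ε r :=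
  sub_nonneg.2 (Real.smoothTransition.monotone (by gcongr))

theorem cutoff_le_one (s t ε r : ℝ) : cutoff s t ε r ≤ 1 := by
  have h1 := Real.smoothTransition.le_one ((r - s) / ε)
  have h2 := Real.smoothTransition.nonneg ((r - t) / ε)
  unfold cutoff; linarith

theorem isTest_cutoff {s t ε T : ℝ} (hs : 0 < s) (hst : s ≤ t) (hε : 0 < ε) (htT : t + ε < T) :
    IsTest (Ioo 0 T) (cutoff s t ε) := by
  have hsupp : Function.support (cutoff s t ε) ⊆ Icc s (t + ε) := by
    intro r hr
    by_contra hc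
    apply hr
    rcases not_and_or.1 hc with h | h
    · have h1 : (r - s) / ε ≤ 0 := div_nonpos_of_nonpos_of_nonneg (by linarith) hε.le
      have h2 : (r - t) / ε ≤ 0 := div_nonpos_of_nonpos_of_nonneg (by linarith) hε.le
      simp [cutoff, Real.smoothTransition.zero_of_nonpos h1,
        Real.smoothTransition.zero_of_nonpos h2]
    · have h1 : 1 ≤ (r - s) / ε := by rw [le_div_iff₀ hε]; linarith
      have h2 : 1 ≤ (r - t) / ε := by rw [le_div_iff₀ hε]; linarith
      simp [cutoff, Real.smoothTransition.one_of_one_le h1,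
        Real.smoothTransition.one_of_one_le h2]
  have hts : tsupport (cutoff s t ε) ⊆ Icc s (t + ε) := closure_minimal hsupp isClosed_Icc
  refine ⟨?_, isCompact_Icc.of_isClosed_subset (isClosed_tsupport _) hts,
    hts.trans fun r hr => ⟨hs.trans_le hr.1, hr.2.trans_lt htT⟩⟩
  exact (Real.smoothTransition.contDiff.comp ((contDiff_id.sub contDiff_const).div_const ε)).sub
    (Real.smoothTransition.contDiff.comp ((contDiff_id.sub contDiff_const).div_const ε))

theorem tendsto_smoothTransition (c r : ℝ) :
    Tendsto (fun ε => Real.smoothTransition ((r - c) / ε)) (𝓝[>] 0)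
      (𝓝 ((Ioi c).indicator (fun _ => 1) r)) := by
  by_cases h : c < r
  · rw [indicator_of_mem (mem_Ioi.2 h)]
    refine tendsto_const_nhds.congr' ?_
    filter_upwards [Ioo_mem_nhdsGT (sub_pos.2 h)] with ε hε
    exact (Real.smoothTransition.one_of_one_le ((one_le_div hε.1).2 hε.2.le)).symm
  · rw [indicator_of_notMem (by simpa using h)]
    refine tendsto_const_nhds.congr' ?_
    filter_upwards [self_mem_nhdsWithin] with ε hε
    exact (Real.smoothTransition.zero_of_nonpos (div_nonpos_of_nonpos_of_nonneg
      (by linarith [not_lt.1 h]) (le_of_lt hε))).symm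

theorem tendsto_integral_cutoff_mul {s t T : ℝ} (hs : 0 ≤ s) (hst : s ≤ t) (ht : t < T)
    {γ : ℝ → ℝ} (hγ : Integrable γ (timeMeas T)) :
    Tendsto (fun ε => ∫ r, cutoff s t ε r * γ r ∂(timeMeas T)) (𝓝[>] 0)
      (𝓝 (∫ r in s..t, γ r)) := by
  have e : ∫ r in s..t, γ r = ∫ r, (Ioc s t).indicator γ r ∂(timeMeas T) := by
    rw [intervalIntegral.integral_of_le hst, integral_indicator measurableSet_Ioc,
      Measure.restrict_restrict measurableSet_Ioc, inter_eq_left.2]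
    exact fun r hr => ⟨hs.trans_lt hr.1, hr.2.trans_lt ht⟩
  rw [e]
  refine tendsto_integral_filter_of_dominated_convergence (fun r => ‖γ r‖) ?_ ?_ hγ.norm ?_
  · refine Eventually.of_forall fun ε => ?_
    have : Continuous (cutoff s t ε) := by
      unfold cutoff
      exact (Real.smoothTransition.continuous.comp (by fun_prop)).sub
        (Real.smoothTransition.continuous.comp (by fun_prop))
    exact this.aestronglyMeasurable.mul hγ.1
  · filter_upwards [self_mem_nhdsWithin] with ε hε
    refine Eventually.of_forall fun r => ?_
    rw [norm_mul, Real.norm_of_nonneg (cutoff_nonneg hst hε r)]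
    exact mul_le_of_le_one_left (norm_nonneg _) (cutoff_le_one s t ε r)
  · refine Eventually.of_forall fun r => ?_
    have h := ((tendsto_smoothTransition s r).sub (tendsto_smoothTransition t r)).mul_const (γ r)
    have e : (Ioc s t).indicator γ r =
        ((Ioi s).indicator (fun _ => 1) r - (Ioi t).indicator (fun _ => 1) r) * γ r := by
      by_cases h1 : s < r <;> by_cases h2 : t < r
      · simp [indicator, h1, h2, not_le.2 h2]
      · simp [indicator, h1, h2, not_lt.1 h2]
      · exact absurd (hst.trans_lt h2) h1
      · simp [indicator, h1, h2]
    rw [e]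
    exact h

theorem deriv_smoothTransition_eq_zero {x : ℝ} (hx : x ∉ Icc (0 : ℝ) 1) :
    deriv Real.smoothTransition x = 0 := by
  rcases not_and_or.1 hx with h | h
  · have : Real.smoothTransition =ᶠ[𝓝 x] fun _ => 0 := by
      filter_upwards [Iio_mem_nhds (not_le.1 h)] with y hy
      exact Real.smoothTransition.zero_of_nonpos (le_of_lt hy)
    rw [this.deriv_eq]; simp
  · have : Real.smoothTransition =ᶠ[𝓝 x] fun _ => 1 := by
      filter_upwards [Ioi_mem_nhds (not_le.1 h)] with y hy
      exact Real.smoothTransition.one_of_one_le (le_of_lt hy)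
    rw [this.deriv_eq]; simp

theorem hasDerivAt_smoothTransition_scaled (c ε r : ℝ) :
    HasDerivAt (fun r => Real.smoothTransition ((r - c) / ε))
      (deriv Real.smoothTransition ((r - c) / ε) / ε) r := by
  have h1 : HasDerivAt (fun r : ℝ => (r - c) / ε) (1 / ε) r :=
    ((hasDerivAt_id r).sub_const c).div_const ε
  have h2 : HasDerivAt Real.smoothTransition (deriv Real.smoothTransition ((r - c) / ε))
      ((r - c) / ε) :=
    ((Real.smoothTransition.contDiff (n := 1)).differentiable (by simp) _).hasDerivAt
  have := h2.comp r h1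
  rw [mul_one_div] at this
  exact this

theorem continuous_deriv_smoothTransition : Continuous (deriv Real.smoothTransition) :=
  (Real.smoothTransition.contDiff (n := 1)).continuous_deriv le_rfl

/-- The rescaled derivative has integral `1` and is supported in `[c, c + ε]`. It is an approximate
identity concentrated to the right of `c`, and right-continuity at `c` therefore suffices. -/
theorem tendsto_integral_deriv_smoothTransition_mul {c T : ℝ} (hc : 0 ≤ c) (hcT : c < T) {m : ℝ → ℝ}
    (hm : ContinuousWithinAt m (Ici c) c) (hi : Integrable m (timeMeas T)) :
    Tendsto (fun ε => ∫ r, deriv Real.smoothTransition ((r - c) / ε) / ε * m r ∂(timeMeas T))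
      (𝓝[>] 0) (𝓝 (m c)) := by
  obtain ⟨M, hM⟩ : ∃ M, ∀ x, |deriv Real.smoothTransition x| ≤ M := by
    obtain ⟨M, hM⟩ := (isCompact_Icc (a := (0 : ℝ)) (b := 1)).exists_bound_of_continuousOn
      continuous_deriv_smoothTransition.continuousOn
    refine ⟨max M 0, fun x => ?_⟩
    by_cases hx : x ∈ Icc (0 : ℝ) 1
    · exact (hM x hx).trans (le_max_left _ _)
    · simp [deriv_smoothTransition_eq_zero hx]
  have hM0 : 0 ≤ M := (abs_nonneg _).trans (hM 0)
  rw [Metric.tendsto_nhds]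
  intro e he
  obtain ⟨δ, hδ, hδ'⟩ := Metric.continuousWithinAt_iff.1 hm (e / (M + 1)) (by positivity)
  filter_upwards [Ioo_mem_nhdsGT (lt_min hδ (sub_pos.2 hcT))] with ε hε
  have hε0 : 0 < ε := hε.1
  have hεδ : ε < δ := hε.2.trans_le (min_le_left _ _)
  have hεT : c + ε < T := by linarith [hε.2.trans_le (min_le_right _ _)]
  have hsub : Ioc c (c + ε) ⊆ Ioo 0 T := fun r hr => ⟨hc.trans_lt hr.1, hr.2.trans_lt hεT⟩
  have cont : Continuous fun r => deriv Real.smoothTransition ((r - c) / ε) / ε :=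
    (continuous_deriv_smoothTransition.comp (by fun_prop)).div_const ε
  have e1 : ∫ r, deriv Real.smoothTransition ((r - c) / ε) / ε * m r ∂(timeMeas T) =
      ∫ r in c..c + ε, deriv Real.smoothTransition ((r - c) / ε) / ε * m r := by
    rw [intervalIntegral.integral_of_le (by linarith)]
    refine setIntegral_eq_of_subset_of_ae_sdiff_eq_zero measurableSet_Ioo.nullMeasurableSet hsub ?_
    have hne : ∀ᵐ r : ℝ, r ≠ c := by simp [ae_iff]
    filter_upwards [hne] with r hrc hr
    have : (r - c) / ε ∉ Icc (0 : ℝ) 1 := by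
      rintro ⟨h1, h2⟩
      apply hr.2
      rw [div_le_one hε0] at h2
      have h3 : 0 ≤ r - c := by
        have := mul_nonneg h1 hε0.le
        rwa [div_mul_cancel₀ _ hε0.ne'] at this
      exact ⟨lt_of_le_of_ne (by linarith) (Ne.symm hrc), by linarith⟩
    rw [deriv_smoothTransition_eq_zero this]; simp
  have im : IntervalIntegrable m volume c (c + ε) := by
    rw [intervalIntegrable_iff_integrableOn_Ioc_of_le (by linarith)]
    exact IntegrableOn.mono_set hi hsub
  have e2 : ∫ r in c..c + ε, deriv Real.smoothTransition ((r - c) / ε) / ε * m c = m c := by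
    rw [intervalIntegral.integral_mul_const,
      intervalIntegral.integral_eq_sub_of_hasDerivAt
        (fun r _ => hasDerivAt_smoothTransition_scaled c ε r) (cont.intervalIntegrable _ _)]
    simp [hε0.ne']
  have e3 : (∫ r in c..c + ε, deriv Real.smoothTransition ((r - c) / ε) / ε * m r) - m c =
      ∫ r in c..c + ε, deriv Real.smoothTransition ((r - c) / ε) / ε * (m r - m c) := by
    have i2 : IntervalIntegrable (fun r => deriv Real.smoothTransition ((r - c) / ε) / ε * m c)
        volume c (c + ε) := (cont.mul continuous_const).intervalIntegrable _ _
    simp only [mul_sub]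
    rw [intervalIntegral.integral_sub (im.continuousOn_mul cont.continuousOn) i2, e2]
  rw [dist_eq_norm, e1, e3]
  have hb : ∀ r ∈ uIoc c (c + ε), ‖deriv Real.smoothTransition ((r - c) / ε) / ε * (m r - m c)‖ ≤
      M / ε * (e / (M + 1)) := by
    intro r hr
    rw [uIoc_of_le (by linarith)] at hr
    rw [norm_mul, norm_div, Real.norm_eq_abs, Real.norm_of_nonneg hε0.le]
    have : dist (m r) (m c) < e / (M + 1) := hδ' hr.1.le (by
      rw [Real.dist_eq, abs_of_pos (by linarith [hr.1])]; linarith [hr.2])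
    rw [dist_eq_norm] at this
    gcongr
    exact hM _
  refine (intervalIntegral.norm_integral_le_of_norm_le_const hb).trans_lt ?_
  rw [add_sub_cancel_left, abs_of_pos hε0]
  have : M / ε * (e / (M + 1)) * ε = e * (M / (M + 1)) := by field_simp
  rw [this]
  exact mul_lt_of_lt_one_right he (by rw [div_lt_one (by positivity)]; linarith)

/-- The fundamental lemma of the calculus of variations for a right-continuous function. -/
theorem eq_integral_of_weak_deriv {T : ℝ} {m γ : ℝ → ℝ}
    (hm : ∀ t ∈ Ico 0 T, ContinuousWithinAt m (Ici t) t) (hmi : Integrable m (timeMeas T))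
    (hγ : Integrable γ (timeMeas T))
    (h : ∀ θ, IsTest (Ioo 0 T) θ →
      ∫ t, deriv θ t * m t ∂(timeMeas T) = - ∫ t, θ t * γ t ∂(timeMeas T))
    {s t : ℝ} (hs : 0 ≤ s) (hst : s ≤ t) (ht : t < T) : m t - m s = ∫ r in s..t, γ r := by
  -- Test with `cutoff s t ε`: its derivative is a unit bump just after `s` minus one just after
  -- `t`, and the cutoff itself tends to the indicator of `(s, t]`.
  have pos : ∀ s, 0 < s → s ≤ t → m t - m s = ∫ r in s..t, γ r := by
    intro s hs hst
    have l1 := (tendsto_integral_deriv_smoothTransition_mul hs.le (hst.trans_lt ht)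
      (hm s ⟨hs.le, hst.trans_lt ht⟩) hmi).sub
      (tendsto_integral_deriv_smoothTransition_mul (hs.le.trans hst) ht
      (hm t ⟨hs.le.trans hst, ht⟩) hmi)
    have l2 := (tendsto_integral_cutoff_mul hs.le hst ht hγ).neg
    have := tendsto_nhds_unique (l1.congr' ?_) l2
    · linarith
    filter_upwards [Ioo_mem_nhdsGT (sub_pos.2 ht)] with ε hε
    have hθ := isTest_cutoff hs hst hε.1 (by linarith [hε.2] : t + ε < T)
    rw [← h _ hθ, ← integral_sub]
    · refine integral_congr_ae (Eventually.of_forall fun r => ?_)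
      have hd : HasDerivAt (cutoff s t ε) _ r :=
        (hasDerivAt_smoothTransition_scaled s ε r).sub (hasDerivAt_smoothTransition_scaled t ε r)
      simp only [hd.deriv, sub_mul]
    all_goals
      have cont : ∀ c, Continuous fun r => deriv Real.smoothTransition ((r - c) / ε) / ε :=
        fun c => (continuous_deriv_smoothTransition.comp (by fun_prop)).div_const ε
      obtain ⟨M, hM⟩ := (isCompact_Icc (a := 0) (b := T)).exists_bound_of_continuousOn
        (cont _).continuousOn
      refine hmi.bdd_mul (c := M) (cont _).aestronglyMeasurable ?_
      filter_upwards [ae_restrict_mem measurableSet_Ioo] with r hr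
      exact hM r (Ioo_subset_Icc_self hr)
  -- When `0 = s < t`, the support of the cutoff reaches the boundary point `0`, which test
  -- functions on `(0, T)` may not do. The identity at `0` follows by letting `s` decrease to `0`.
  rcases hs.eq_or_lt with rfl | hs
  · rcases hst.eq_or_lt with rfl | hst
    · simp
    have ii : IntegrableOn γ (uIcc 0 t) := by
      rw [uIcc_of_le hst.le, integrableOn_Icc_iff_integrableOn_Ioc]
      exact IntegrableOn.mono_set hγ fun r hr => ⟨hr.1, hr.2.trans_lt ht⟩
    have hc := (intervalIntegral.continuousOn_primitive_interval_left ii) 0 left_mem_uIcc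
    have l1 : Tendsto (fun s => ∫ r in s..t, γ r) (𝓝[>] 0) (𝓝 (∫ r in (0 : ℝ)..t, γ r)) := by
      refine hc.tendsto.mono_left ?_
      rw [uIcc_of_le hst.le, ← nhdsWithin_Ioo_eq_nhdsGT hst]
      exact nhdsWithin_mono _ Ioo_subset_Icc_self
    have l2 : Tendsto (fun s => m t - m s) (𝓝[>] 0) (𝓝 (m t - m 0)) :=
      ((hm 0 ⟨le_rfl, hst.trans ht⟩).mono Ioi_subset_Ici_self).const_sub (m t)
    refine tendsto_nhds_unique l2 (l1.congr' ?_)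
    filter_upwards [Ioo_mem_nhdsGT hst] with s hs
    exact (pos s hs.1 hs.2.le).symm
  · exact pos s hs hst

/-- Cutoffs approximate indicators of intervals, so integrals of `γ` over intervals `[t, b]` inside
`(0, T)` are non-negative; Lebesgue differentiation concludes. -/
theorem ae_nonneg_of_integral_test_mul_nonneg {T : ℝ} {γ : ℝ → ℝ}
    (hγ : Integrable γ (timeMeas T))
    (h : ∀ θ, IsTest (Ioo 0 T) θ → (∀ t, 0 ≤ θ t) → 0 ≤ ∫ t, θ t * γ t ∂(timeMeas T)) :
    ∀ᵐ t ∂(timeMeas T), 0 ≤ γ t := by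
  have hli : LocallyIntegrable ((Ioo 0 T).indicator γ) volume :=
    ((integrable_indicator_iff measurableSet_Ioo).2 hγ).locallyIntegrable
  rw [ae_restrict_iff' measurableSet_Ioo]
  filter_upwards [LocallyIntegrable.ae_hasDerivAt_integral hli] with t hd ht
  have hsub : Ioi t ⊆ {t}ᶜ := fun b hb => (mem_Ioi.1 hb).ne'
  have h1 := (hasDerivAt_iff_tendsto_slope.1 (hd t)).mono_left (nhdsWithin_mono t hsub)
  rw [indicator_of_mem ht] at h1
  refine ge_of_tendsto h1 ?_
  filter_upwards [Ioo_mem_nhdsGT ht.2] with b hb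
  have e : ∫ r in t..b, (Ioo 0 T).indicator γ r = ∫ r in t..b, γ r := by
    refine intervalIntegral.integral_congr fun r hr => ?_
    rw [uIcc_of_le hb.1.le] at hr
    exact indicator_of_mem (show r ∈ Ioo 0 T from ⟨ht.1.trans_le hr.1, hr.2.trans_lt hb.2⟩) _
  have nn : 0 ≤ ∫ r in t..b, γ r := by
    refine ge_of_tendsto (tendsto_integral_cutoff_mul ht.1.le hb.1.le hb.2 hγ) ?_
    filter_upwards [Ioo_mem_nhdsGT (sub_pos.2 hb.2)] with ε hε
    exact h _ (isTest_cutoff ht.1 hb.1.le hε.1 (by linarith [hε.2])) (cutoff_nonneg hb.1.le hε.1)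
  rw [slope_def_field, e, intervalIntegral.integral_same, sub_zero]
  exact div_nonneg nn (by linarith [hb.1])

end Obstacle

/-! ### Convergence in `L^p` and the chain rule map -/

namespace Obstacle

section LpTools

variable {α : Type*} {mα : MeasurableSpace α} {μ : Measure α}
  {E F : Type*} [NormedAddCommGroup E] [NormedAddCommGroup F]

theorem tendsto_toLp_of_dominated {p : ℝ≥0∞} [hp1 : Fact (1 ≤ p)] (hp : p ≠ ∞) {f : ℕ → α → E}
    {g : α → E} {b : α → ℝ} (hf : ∀ n, MemLp (f n) p μ) (hg : MemLp g p μ) (hb : MemLp b p μ)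
    (hle : ∀ n, ∀ᵐ x ∂μ, ‖f n x - g x‖ ≤ b x)
    (hlim : ∀ᵐ x ∂μ, Tendsto (fun n => f n x) atTop (𝓝 (g x))) :
    Tendsto (fun n => (hf n).toLp (f n)) atTop (𝓝 (hg.toLp g)) := by
  have hp0 : p ≠ 0 := (zero_lt_one.trans_le hp1.out).ne'
  have hpr : 0 < p.toReal := ENNReal.toReal_pos hp0 hp
  rw [Lp.tendsto_Lp_iff_tendsto_eLpNorm'']
  simp only [eLpNorm_eq_lintegral_rpow_enorm_toReal hp0 hp]
  have h0 : Tendsto (fun n => ∫⁻ x, ‖(f n - g) x‖ₑ ^ p.toReal ∂μ) atTop (𝓝 (∫⁻ _, 0 ∂μ)) := by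
    refine tendsto_lintegral_of_dominated_convergence' (fun x => ‖b x‖ₑ ^ p.toReal)
      (fun n => ((hf n).sub hg).1.enorm.pow_const _) (fun n => ?_) ?_ ?_
    · filter_upwards [hle n] with x hx
      refine ENNReal.rpow_le_rpow ?_ hpr.le
      rw [enorm_le_iff_norm_le]
      exact hx.trans (le_abs_self _)
    · exact (lintegral_rpow_enorm_lt_top_of_eLpNorm_lt_top hp0 hp hb.2).ne
    · filter_upwards [hlim] with x hx
      have h1 : Tendsto (fun n => ‖(f n - g) x‖ₑ) atTop (𝓝 0) := by
        have := (hx.sub_const (g x)).enorm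
        simpa using this
      have := h1.ennrpow_const p.toReal
      rwa [ENNReal.zero_rpow_of_pos hpr] at this
  rw [lintegral_zero] at h0
  have := h0.ennrpow_const (1 / p.toReal)
  rwa [ENNReal.zero_rpow_of_pos (by positivity)] at this

theorem exists_subseq_ae_tendsto_prod {p : ℝ≥0∞} [Fact (1 ≤ p)] {w : ℕ → Lp E p μ × Lp F p μ}
    {w₀ : Lp E p μ × Lp F p μ} (hw : Tendsto w atTop (𝓝 w₀)) :
    ∃ ns : ℕ → ℕ, StrictMono ns ∧ ∀ᵐ x ∂μ,
      Tendsto (fun i => ((w (ns i)).1 x, (w (ns i)).2 x)) atTop (𝓝 (w₀.1 x, w₀.2 x)) := by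
  have h1 : Tendsto (fun n => (w n).1) atTop (𝓝 w₀.1) := (continuous_fst.tendsto w₀).comp hw
  have h2 : Tendsto (fun n => (w n).2) atTop (𝓝 w₀.2) := (continuous_snd.tendsto w₀).comp hw
  obtain ⟨ns, hns, hae⟩ := (tendstoInMeasure_of_tendsto_Lp h1).exists_seq_tendsto_ae
  obtain ⟨ms, hms, hae'⟩ :=
    (tendstoInMeasure_of_tendsto_Lp (h2.comp hns.tendsto_atTop)).exists_seq_tendsto_ae
  refine ⟨ns ∘ ms, hns.comp hms, ?_⟩
  filter_upwards [hae, hae'] with x hx hx'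
  exact (hx.comp hms.tendsto_atTop).prodMk_nhds hx'

/-- Convergence in `L^p` gives a.e. convergence only along subsequences. This is enough, since a
sequence converges once every subsequence has a further subsequence with the same limit. -/
theorem tendsto_of_subseq_ae {Y : Type*} [TopologicalSpace Y] {p : ℝ≥0∞} [Fact (1 ≤ p)]
    {B : ℕ → Y} {B₀ : Y} {w : ℕ → Lp E p μ × Lp F p μ} {w₀ : Lp E p μ × Lp F p μ}
    (hw : Tendsto w atTop (𝓝 w₀))
    (h : ∀ ns : ℕ → ℕ, (∀ᵐ x ∂μ,
      Tendsto (fun i => ((w (ns i)).1 x, (w (ns i)).2 x)) atTop (𝓝 (w₀.1 x, w₀.2 x))) →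
      Tendsto (fun i => B (ns i)) atTop (𝓝 B₀)) : Tendsto B atTop (𝓝 B₀) := by
  refine tendsto_of_subseq_tendsto fun ns hns => ?_
  obtain ⟨ms, -, hae⟩ := exists_subseq_ae_tendsto_prod (hw.comp hns)
  exact ⟨ms, h (ns ∘ ms) hae⟩

variable [NormedSpace ℝ F]

/-- A Lipschitz function of class `C¹` vanishing at `0`. -/
structure IsTruncation (H : ℝ → ℝ) (K : ℝ≥0) : Prop where
  contDiff : ContDiff ℝ 1 H
  zero : H 0 = 0
  deriv_le : ∀ x, |deriv H x| ≤ K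

theorem IsTruncation.lipschitz {H : ℝ → ℝ} {K : ℝ≥0} (hH : IsTruncation H K) : LipschitzWith K H :=
  lipschitzWith_of_nnnorm_deriv_le (hH.contDiff.differentiable (by simp)) fun x => by
    have := hH.deriv_le x
    rw [← Real.norm_eq_abs] at this
    exact this

theorem IsTruncation.continuous_deriv {H : ℝ → ℝ} {K : ℝ≥0} (hH : IsTruncation H K) :
    Continuous (deriv H) := hH.contDiff.continuous_deriv le_rfl

theorem IsTruncation.memLp_smul {H : ℝ → ℝ} {K : ℝ≥0} (hH : IsTruncation H K) {p : ℝ≥0∞}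
    {u : α → ℝ} (hu : AEStronglyMeasurable u μ) {f : α → F} (hf : MemLp f p μ) :
    MemLp (fun x => deriv H (u x) • f x) p μ := by
  refine MemLp.of_le_mul (c := K) hf
    ((hH.continuous_deriv.comp_aestronglyMeasurable hu).smul hf.1) (Eventually.of_forall fun x => ?_)
  rw [norm_smul]
  exact mul_le_mul_of_nonneg_right (hH.deriv_le _) (norm_nonneg _)

/-- The chain rule map `(u, f) ↦ (H(u), H'(u) f)`. -/
noncomputable def IsTruncation.chain {H : ℝ → ℝ} {K : ℝ≥0} (hH : IsTruncation H K) {p : ℝ≥0∞}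
    (w : Lp ℝ p μ × Lp F p μ) : Lp ℝ p μ × Lp F p μ :=
  (hH.lipschitz.compLp hH.zero w.1,
    (hH.memLp_smul (Lp.aestronglyMeasurable w.1) (Lp.memLp w.2)).toLp _)

/-- Write `H'(uₙ) fₙ - H'(u) f = H'(uₙ) (fₙ - f) + (H'(uₙ) - H'(u)) f`. The bound on `H'` controls
the first term. In the second, `f` is fixed and `2 K |f|` dominates, so dominated convergence
applies along a.e. convergent subsequences. -/
theorem IsTruncation.continuous_chain {H : ℝ → ℝ} {K : ℝ≥0} (hH : IsTruncation H K) {p : ℝ≥0∞}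
    [hp1 : Fact (1 ≤ p)] (hp : p ≠ ∞) :
    Continuous (hH.chain : Lp ℝ p μ × Lp F p μ → Lp ℝ p μ × Lp F p μ) := by
  refine ((hH.lipschitz.continuous_compLp hH.zero).comp continuous_fst).prodMk ?_
  refine continuous_iff_seqContinuous.2 fun w w₀ hw => ?_
  have hB : ∀ n, MemLp (fun x => (deriv H ((w n).1 x)) • w₀.2 x) p μ :=
    fun n => hH.memLp_smul (Lp.aestronglyMeasurable _) (Lp.memLp w₀.2)
  have hB0 : MemLp (fun x => (deriv H (w₀.1 x)) • w₀.2 x) p μ :=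
    hH.memLp_smul (Lp.aestronglyMeasurable _) (Lp.memLp w₀.2)
  have t1 : Tendsto (fun n => (hB n).toLp _) atTop (𝓝 (hB0.toLp _)) := by
    refine tendsto_of_subseq_ae hw fun ns hns => ?_
    refine tendsto_toLp_of_dominated hp (fun n => hB (ns n)) hB0
      ((Lp.memLp w₀.2).norm.const_mul (2 * (K : ℝ))) (fun n => Eventually.of_forall fun x => ?_) ?_
    · rw [← sub_smul, norm_smul]
      refine mul_le_mul_of_nonneg_right ?_ (norm_nonneg _)
      refine (norm_sub_le _ _).trans ?_
      have a1 := hH.deriv_le ((w (ns n)).1 x)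
      have a2 := hH.deriv_le (w₀.1 x)
      rw [Real.norm_eq_abs, Real.norm_eq_abs]
      linarith
    · filter_upwards [hns] with x hx
      exact ((hH.continuous_deriv.tendsto _).comp ((continuous_fst.tendsto _).comp hx)).smul_const _
  have t2 : Tendsto (fun n => K * ‖(w n).2 - w₀.2‖) atTop (𝓝 0) := by
    have : Tendsto (fun n => (w n).2) atTop (𝓝 w₀.2) := (continuous_snd.tendsto w₀).comp hw
    have := (tendsto_iff_norm_sub_tendsto_zero.1 this).const_mul (K : ℝ)
    simpa using this
  have t3 : Tendsto (fun n => (hH.memLp_smul (Lp.aestronglyMeasurable (w n).1)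
      (Lp.memLp (w n).2)).toLp _ - (hB n).toLp _) atTop (𝓝 0) := by
    refine squeeze_zero_norm (fun n => ?_) t2
    refine Lp.norm_le_mul_norm_of_ae_le_mul ?_
    filter_upwards [Lp.coeFn_sub ((hH.memLp_smul (Lp.aestronglyMeasurable (w n).1)
      (Lp.memLp (w n).2)).toLp _) ((hB n).toLp _), Lp.coeFn_sub (w n).2 w₀.2, (hB n).coeFn_toLp,
      (hH.memLp_smul (Lp.aestronglyMeasurable (w n).1) (Lp.memLp (w n).2)).coeFn_toLp]
      with x h1 h2 h3 h4
    rw [h1, h2, Pi.sub_apply, Pi.sub_apply, h3, h4, ← smul_sub, norm_smul]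
    exact mul_le_mul_of_nonneg_right (hH.deriv_le _) (norm_nonneg _)
  have := t3.add t1
  simp only [sub_add_cancel, zero_add] at this
  exact this

theorem IsTruncation.norm_chain_le {H : ℝ → ℝ} {K : ℝ≥0} (hH : IsTruncation H K) {p : ℝ≥0∞}
    [Fact (1 ≤ p)] (w : Lp ℝ p μ × Lp F p μ) : ‖hH.chain w‖ ≤ K * ‖w‖ := by
  refine norm_prod_le_iff.2 ⟨?_, ?_⟩
  · exact (hH.lipschitz.norm_compLp_le hH.zero w.1).trans
      (mul_le_mul_of_nonneg_left (norm_fst_le w) K.2)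
  · refine (Lp.norm_le_mul_norm_of_ae_le_mul (c := K) (g := w.2) ?_).trans
      (mul_le_mul_of_nonneg_left (norm_snd_le w) K.2)
    filter_upwards [(hH.memLp_smul (Lp.aestronglyMeasurable w.1) (Lp.memLp w.2)).coeFn_toLp]
      with x hx
    refine le_of_eq_of_le (congrArg norm hx) ?_
    rw [norm_smul]
    exact mul_le_mul_of_nonneg_right (hH.deriv_le _) (norm_nonneg _)

end LpTools

/-! ### Measurability of Carathéodory superpositions -/

section Caratheodory

variable {α : Type*} {mα : MeasurableSpace α} {μ : Measure α} {Z F : Type*} [TopologicalSpace Z]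
  [NormedAddCommGroup F]

/-- For a simple function in the second argument the superposition is a finite sum of measurable
pieces; continuity in that argument passes this to pointwise limits. -/
theorem aestronglyMeasurable_caratheodory {b : α → Z → F}
    (hm : ∀ z, AEStronglyMeasurable (fun x => b x z) μ) (hc : ∀ᵐ x ∂μ, Continuous (b x))
    {g : α → Z} (hg : AEStronglyMeasurable g μ) : AEStronglyMeasurable (fun x => b x (g x)) μ := by
  obtain ⟨g', hg', hgg'⟩ := hg
  have hs : ∀ s : SimpleFunc α Z, AEStronglyMeasurable (fun x => b x (s x)) μ := by
    classical
    intro s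
    have e : (fun x => b x (s x)) =
        fun x => ∑ z ∈ s.range, (s ⁻¹' {z}).indicator (fun x => b x z) x := by
      funext x
      rw [Finset.sum_eq_single (s x)]
      · simp
      · intro z _ hz
        exact indicator_of_notMem (by simpa using hz.symm) _
      · intro h
        exact absurd (s.mem_range_self x) h
    rw [e]
    exact Finset.aestronglyMeasurable_fun_sum _ fun z _ =>
      (hm z).indicator (s.measurableSet_preimage {z})
  have h1 : AEStronglyMeasurable (fun x => b x (g' x)) μ := by
    refine aestronglyMeasurable_of_tendsto_ae atTop (fun n => hs (hg'.approx n)) ?_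
    filter_upwards [hc] with x hx
    exact (hx.tendsto _).comp (hg'.tendsto_approx x)
  refine h1.congr ?_
  filter_upwards [hgg'] with x hx
  rw [hx]

end Caratheodory
end Obstacle

/-! ### Superposition operators on `W_0^{1,p}(D)` and uniqueness of the gradient -/

namespace Obstacle

section Sobolev

variable {d : ℕ} {D : Set (Euc d)}

theorem IsTest.zero {X : Type*} [NormedAddCommGroup X] [NormedSpace ℝ X] (U : Set X) :
    IsTest U (fun _ => (0 : ℝ)) := by
  refine ⟨contDiff_const, HasCompactSupport.zero, ?_⟩
  have : tsupport (fun _ : X => (0 : ℝ)) = ∅ := tsupport_eq_empty_iff.2 rfl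
  simp [this]

theorem IsTest.add {X : Type*} [NormedAddCommGroup X] [NormedSpace ℝ X] {U : Set X} {φ ψ : X → ℝ}
    (hφ : IsTest U φ) (hψ : IsTest U ψ) : IsTest U (fun x => φ x + ψ x) :=
  ⟨hφ.smooth.add hψ.smooth, hφ.compact.add hψ.compact,
    (tsupport_add φ ψ).trans (union_subset hφ.support hψ.support)⟩

theorem IsTest.comp {X : Type*} [NormedAddCommGroup X] [NormedSpace ℝ X] {U : Set X} {φ : X → ℝ}
    (hφ : IsTest U φ) {H : ℝ → ℝ} (hH : ContDiff ℝ (⊤ : ℕ∞) H) (h0 : H 0 = 0) :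
    IsTest U (fun x => H (φ x)) :=
  ⟨hH.comp hφ.smooth, hφ.compact.comp_left h0, (tsupport_comp_subset h0 φ).trans hφ.support⟩

theorem IsTest.continuous_gradient {φ : Euc d → ℝ} (hφ : IsTest D φ) : Continuous (∇ φ) :=
  (InnerProductSpace.toDual ℝ (Euc d)).symm.continuous.comp (hφ.smooth.continuous_fderiv (by simp))

theorem IsTest.hasCompactSupport_gradient {φ : Euc d → ℝ} (hφ : IsTest D φ) :
    HasCompactSupport (∇ φ) :=
  (hφ.compact.fderiv ℝ).comp_left (g := (InnerProductSpace.toDual ℝ (Euc d)).symm) (map_zero _)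

theorem IsTest.gradient_add {φ ψ : Euc d → ℝ} (hφ : IsTest D φ) (hψ : IsTest D ψ) (x : Euc d) :
    ∇ (fun x => φ x + ψ x) x = ∇ φ x + ∇ ψ x := by
  unfold gradient
  rw [fderiv_fun_add (hφ.smooth.differentiable (by simp) x) (hψ.smooth.differentiable (by simp) x),
    map_add]

theorem IsTest.gradient_comp {φ : Euc d → ℝ} (hφ : IsTest D φ) {H : ℝ → ℝ} (hH : Differentiable ℝ H)
    (x : Euc d) : ∇ (fun x => H (φ x)) x = deriv H (φ x) • ∇ φ x := by
  unfold gradient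
  have : HasFDerivAt (fun x => H (φ x)) (deriv H (φ x) • fderiv ℝ φ x) x :=
    (hH (φ x)).hasDerivAt.comp_hasFDerivAt x (hφ.smooth.differentiable (by simp) x).hasFDerivAt
  rw [this.fderiv, map_smul]

variable {p : ℝ≥0∞} [Fact (1 ≤ p)]

theorem IsTest.memLp {φ : Euc d → ℝ} (hφ : IsTest D φ) (r : ℝ≥0∞) : MemLp φ r (spaceMeas D) :=
  hφ.smooth.continuous.memLp_of_hasCompactSupport hφ.compact

theorem IsTest.memLp_gradient {φ : Euc d → ℝ} (hφ : IsTest D φ) (r : ℝ≥0∞) :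
    MemLp (∇ φ) r (spaceMeas D) :=
  hφ.continuous_gradient.memLp_of_hasCompactSupport hφ.hasCompactSupport_gradient

/-- A test function as an element of `W_0^{1,p}(D)`. -/
noncomputable def V.ofTest {φ : Euc d → ℝ} (hφ : IsTest D φ) : V p D :=
  ⟨((hφ.memLp p).toLp φ, (hφ.memLp_gradient p).toLp (∇ φ)),
    subset_closure (Submodule.subset_span ⟨φ, hφ, (hφ.memLp p).coeFn_toLp,
      (hφ.memLp_gradient p).coeFn_toLp⟩)⟩

theorem V.fn_ofTest {φ : Euc d → ℝ} (hφ : IsTest D φ) :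
    (V.ofTest hφ : V p D).fn =ᵐ[spaceMeas D] φ := (hφ.memLp p).coeFn_toLp

theorem V.grad_ofTest {φ : Euc d → ℝ} (hφ : IsTest D φ) :
    (V.ofTest hφ : V p D).grad =ᵐ[spaceMeas D] ∇ φ :=
  (hφ.memLp_gradient p).coeFn_toLp

theorem V.ext_ae {w w' : V p D} (h1 : w.fn =ᵐ[spaceMeas D] w'.fn)
    (h2 : w.grad =ᵐ[spaceMeas D] w'.grad) : w = w' :=
  Subtype.ext (Prod.ext (Lp.ext h1) (Lp.ext h2))

/-- The generating pairs already form a linear subspace, so taking the span adds nothing and test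
functions themselves are dense. -/
theorem exists_test_of_mem_span {w : Lp ℝ p (spaceMeas D) × Lp (Euc d) p (spaceMeas D)}
    (hw : w ∈ Submodule.span ℝ {w | ∃ φ : Euc d → ℝ, IsTest D φ ∧
      w.1 =ᵐ[spaceMeas D] φ ∧ w.2 =ᵐ[spaceMeas D] fun x => ∇ φ x}) :
    ∃ (φ : Euc d → ℝ) (hφ : IsTest D φ), w = (V.ofTest hφ : V p D) := by
  suffices h : ∃ φ : Euc d → ℝ, IsTest D φ ∧
      w.1 =ᵐ[spaceMeas D] φ ∧ w.2 =ᵐ[spaceMeas D] fun x => ∇ φ x by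
    obtain ⟨φ, hφ, h1, h2⟩ := h
    exact ⟨φ, hφ, Prod.ext (Lp.ext (h1.trans (V.fn_ofTest hφ).symm))
      (Lp.ext (h2.trans (V.grad_ofTest hφ).symm))⟩
  induction hw using Submodule.span_induction with
  | mem x h => exact h
  | zero =>
    refine ⟨fun _ => 0, IsTest.zero D, Lp.coeFn_zero _ _ _, ?_⟩
    refine (Lp.coeFn_zero _ _ _).trans (Eventually.of_forall fun x => ?_)
    simp [gradient]
  | add x y _ _ hx hy =>
    obtain ⟨φ, hφ, h1, h2⟩ := hx
    obtain ⟨ψ, hψ, h3, h4⟩ := hy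
    refine ⟨fun x => φ x + ψ x, hφ.add hψ, (Lp.coeFn_add _ _).trans (h1.add h3), ?_⟩
    refine ((Lp.coeFn_add _ _).trans (h2.add h4)).trans (Eventually.of_forall fun x => ?_)
    exact (hφ.gradient_add hψ x).symm
  | smul c x _ hx =>
    obtain ⟨φ, hφ, h1, h2⟩ := hx
    have hc : ContDiff ℝ (⊤ : ℕ∞) fun s : ℝ => c * s := contDiff_const.mul contDiff_id
    refine ⟨fun x => c * φ x, hφ.comp hc (mul_zero c), (Lp.coeFn_smul c _).trans (h1.const_smul c),
      ?_⟩
    refine ((Lp.coeFn_smul c _).trans (h2.const_smul c)).trans (Eventually.of_forall fun x => ?_)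
    refine Eq.trans ?_ (hφ.gradient_comp (hc.differentiable (by simp)) x).symm
    simp

theorem V.induction_closed {P : V p D → Prop} (hP : IsClosed {w | P w})
    (h : ∀ (φ : Euc d → ℝ) (hφ : IsTest D φ), P (V.ofTest hφ)) (w : V p D) : P w := by
  obtain ⟨x, hx, hlim⟩ := mem_closure_iff_seq_limit.1 w.2
  choose φ hφ he using fun n => exists_test_of_mem_span (hx n)
  have hlim' : Tendsto (fun n => (V.ofTest (hφ n) : V p D)) atTop (𝓝 w) := by
    rw [tendsto_subtype_rng]
    exact hlim.congr fun n => he n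
  exact hP.mem_of_tendsto hlim' (Eventually.of_forall fun n => h _ (hφ n))

theorem IsTruncation.chain_ofTest {H : ℝ → ℝ} {K : ℝ≥0} (hH : IsTruncation H K)
    (hs : ContDiff ℝ (⊤ : ℕ∞) H) {φ : Euc d → ℝ} (hφ : IsTest D φ) :
    hH.chain ((V.ofTest hφ : V p D) : Lp ℝ p (spaceMeas D) × Lp (Euc d) p (spaceMeas D)) =
      (V.ofTest (hφ.comp hs hH.zero) : V p D) := by
  refine Prod.ext (Lp.ext ?_) (Lp.ext ?_)
  · filter_upwards [hH.lipschitz.coeFn_compLp hH.zero (V.ofTest hφ : V p D).fn,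
      V.fn_ofTest (p := p) hφ, V.fn_ofTest (p := p) (hφ.comp hs hH.zero)] with x h1 h2 h3
    refine h1.trans (Eq.trans ?_ h3.symm)
    simp only [Function.comp_apply, h2]
  · filter_upwards [(hH.memLp_smul (Lp.aestronglyMeasurable (V.ofTest hφ : V p D).fn)
      (Lp.memLp (V.ofTest hφ : V p D).grad)).coeFn_toLp, V.fn_ofTest (p := p) hφ,
      V.grad_ofTest (p := p) hφ, V.grad_ofTest (p := p) (hφ.comp hs hH.zero)] with x h1 h2 h3 h4
    refine h1.trans (Eq.trans ?_ h4.symm)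
    rw [h2, h3, hφ.gradient_comp (hs.differentiable (by simp))]

/-- A smooth `H` with `H 0 = 0` maps test functions to test functions, and the chain rule map is
continuous, so it preserves the closure. -/
theorem IsTruncation.chain_mem {H : ℝ → ℝ} {K : ℝ≥0} (hH : IsTruncation H K)
    (hs : ContDiff ℝ (⊤ : ℕ∞) H) (hp : p ≠ ∞) (w : V p D) :
    hH.chain (w : Lp ℝ p (spaceMeas D) × Lp (Euc d) p (spaceMeas D)) ∈ W01 p D := by
  refine V.induction_closed (P := fun w : V p D =>
    hH.chain (w : Lp ℝ p (spaceMeas D) × Lp (Euc d) p (spaceMeas D)) ∈ W01 p D) ?_ ?_ w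
  · exact (Submodule.isClosed_topologicalClosure _).preimage
      ((hH.continuous_chain hp).comp continuous_subtype_val)
  · intro φ hφ
    rw [hH.chain_ofTest hs hφ]
    exact Subtype.coe_prop _

/-- The superposition operator `w ↦ H(w)` on `W_0^{1,p}(D)`. -/
noncomputable def V.superpose {H : ℝ → ℝ} {K : ℝ≥0} (hH : IsTruncation H K)
    (hs : ContDiff ℝ (⊤ : ℕ∞) H) (hp : p ≠ ∞) (w : V p D) : V p D :=
  ⟨hH.chain (w : Lp ℝ p (spaceMeas D) × Lp (Euc d) p (spaceMeas D)), hH.chain_mem hs hp w⟩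

section Superpose

variable {H : ℝ → ℝ} {K : ℝ≥0} (hH : IsTruncation H K) (hs : ContDiff ℝ (⊤ : ℕ∞) H) (hp : p ≠ ∞)

theorem V.continuous_superpose : Continuous (V.superpose hH hs hp : V p D → V p D) :=
  ((hH.continuous_chain hp).comp continuous_subtype_val).subtype_mk _

theorem V.norm_superpose_le (w : V p D) : ‖V.superpose hH hs hp w‖ ≤ K * ‖w‖ :=
  hH.norm_chain_le _

theorem V.fn_superpose (w : V p D) :
    (V.superpose hH hs hp w).fn =ᵐ[spaceMeas D] fun x => H (w.fn x) :=
  hH.lipschitz.coeFn_compLp hH.zero w.fn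

theorem V.grad_superpose (w : V p D) :
    (V.superpose hH hs hp w).grad =ᵐ[spaceMeas D] fun x => deriv H (w.fn x) • w.grad x :=
  (hH.memLp_smul (Lp.aestronglyMeasurable w.fn) (Lp.memLp w.grad)).coeFn_toLp

theorem V.superpose_ofTest {φ : Euc d → ℝ} (hφ : IsTest D φ) :
    V.superpose hH hs hp (V.ofTest hφ : V p D) = V.ofTest (hφ.comp hs hH.zero) :=
  Subtype.ext (hH.chain_ofTest hs hφ)

end Superpose

/-! #### Uniqueness of the weak gradient -/

theorem continuous_integral_mul {q : ℝ≥0∞} [Fact (1 ≤ q)] [p.HolderConjugate q] {m : Euc d → ℝ}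
    (hm : MemLp m q (spaceMeas D)) :
    Continuous fun u : Lp ℝ p (spaceMeas D) => ∫ x, u x * m x ∂(spaceMeas D) := by
  have := (((ContinuousLinearMap.mul ℝ ℝ).lpPairing (spaceMeas D) p q).flip (hm.toLp m)).continuous
  refine this.congr fun u => ?_
  change (ContinuousLinearMap.mul ℝ ℝ).lpPairing (spaceMeas D) p q u (hm.toLp m) = _
  rw [ContinuousLinearMap.lpPairing_eq_integral]
  refine integral_congr_ae ?_
  filter_upwards [hm.coeFn_toLp] with x hx
  simp [hx]

theorem IsTest.fderiv_apply {ζ : Euc d → ℝ} (hζ : IsTest D ζ) (e : Euc d) :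
    IsTest D (fun x => fderiv ℝ ζ x e) := by
  refine ⟨?_, hζ.compact.fderiv_apply ℝ e, (tsupport_fderiv_apply_subset ℝ e).trans hζ.support⟩
  have h : ContDiff ℝ (⊤ : ℕ∞) (fderiv ℝ ζ) := hζ.smooth.fderiv_right (by norm_cast)
  exact h.clm_apply contDiff_const

theorem inner_gradient {φ : Euc d → ℝ} (x e : Euc d) : inner ℝ (∇ φ x) e = fderiv ℝ φ x e := by
  unfold gradient
  exact InnerProductSpace.toDual_symm_apply

/-- Classical integration by parts for test functions; both sides are continuous in `w`. It
identifies the second component of an element of the closure as a weak gradient. -/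
theorem V.integral_fn_mul_fderiv {q : ℝ≥0∞} [Fact (1 ≤ q)] [p.HolderConjugate q]
    {ζ : Euc d → ℝ} (hζ : IsTest D ζ) (e : Euc d) (w : V p D) :
    ∫ x, w.fn x * fderiv ℝ ζ x e ∂(spaceMeas D) =
      - ∫ x, inner ℝ e (w.grad x) * ζ x ∂(spaceMeas D) := by
  refine V.induction_closed (P := fun w : V p D => ∫ x, w.fn x * fderiv ℝ ζ x e ∂(spaceMeas D) =
      - ∫ x, inner ℝ e (w.grad x) * ζ x ∂(spaceMeas D)) ?_ ?_ w
  · have c1 : Continuous fun w : V p D => ∫ x, w.fn x * fderiv ℝ ζ x e ∂(spaceMeas D) :=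
      (continuous_integral_mul ((hζ.fderiv_apply e).memLp q)).comp
        (continuous_fst.comp continuous_subtype_val)
    have c2 : Continuous fun w : V p D => ∫ x, inner ℝ e (w.grad x) * ζ x ∂(spaceMeas D) := by
      have := (continuous_integral_mul (p := p) (hζ.memLp q)).comp
        (((innerSL ℝ e).compLpL p (spaceMeas D)).continuous.comp
          (continuous_snd.comp (continuous_subtype_val (p := fun w => w ∈ W01 p D))))
      refine this.congr fun w => integral_congr_ae ?_
      filter_upwards [(innerSL ℝ e).coeFn_compLpL (p := p) (μ := spaceMeas D) (V.grad w)] with x hx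
      exact congrArg (· * ζ x) hx
    exact isClosed_eq c1 c2.neg
  · intro φ hφ
    have hsm : ∀ {f : Euc d → ℝ}, (∀ x, x ∉ D → f x = 0) →
        ∫ x, f x ∂(spaceMeas D) = ∫ x, f x := fun hf =>
      setIntegral_eq_integral_of_forall_compl_eq_zero hf
    have hζ0 : ∀ x, x ∉ D → ζ x = 0 := fun x hx => image_eq_zero_of_notMem_tsupport
      fun h => hx (hζ.support h)
    have hφ0 : ∀ x, x ∉ D → φ x = 0 := fun x hx => image_eq_zero_of_notMem_tsupport
      fun h => hx (hφ.support h)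
    have e1 : ∫ x, (V.ofTest hφ : V p D).fn x * fderiv ℝ ζ x e ∂(spaceMeas D) =
        ∫ x, φ x * fderiv ℝ ζ x e := by
      rw [← hsm fun x hx => by rw [hφ0 x hx, zero_mul]]
      refine integral_congr_ae ?_
      filter_upwards [V.fn_ofTest (p := p) hφ] with x hx
      rw [hx]
    have e2 : ∫ x, inner ℝ e ((V.ofTest hφ : V p D).grad x) * ζ x ∂(spaceMeas D) =
        ∫ x, fderiv ℝ φ x e * ζ x := by
      rw [← hsm fun x hx => by rw [hζ0 x hx, mul_zero]]
      refine integral_congr_ae ?_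
      filter_upwards [V.grad_ofTest (p := p) hφ] with x hx
      rw [hx, real_inner_comm, inner_gradient]
    rw [e1, e2]
    have ci : ∀ {f g : Euc d → ℝ}, IsTest D f → IsTest D g → Integrable (fun x => f x * g x) :=
      fun hf hg => (hf.smooth.continuous.mul hg.smooth.continuous).integrable_of_hasCompactSupport
        hf.compact.mul_right
    exact integral_mul_fderiv_eq_neg_fderiv_mul_of_integrable (ci (hφ.fderiv_apply e) hζ)
      (ci hφ (hζ.fderiv_apply e)) (ci hφ hζ)
      (fun x _ => hφ.smooth.differentiable (by simp) x)
      (fun x _ => hζ.smooth.differentiable (by simp) x)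

/-- Elements are pairs in a closure, so it is not automatic that the function determines the
gradient. Integration by parts makes each component of the gradient orthogonal to all test functions
on the open set `D`. -/
theorem V.grad_eq_zero_of_fn_eq_zero {q : ℝ≥0∞} [Fact (1 ≤ q)] [p.HolderConjugate q]
    (hD : IsOpen D) {w : V p D} (hw : w.fn =ᵐ[spaceMeas D] 0) : w.grad =ᵐ[spaceMeas D] 0 := by
  have hloc : LocallyIntegrableOn (w.grad : Euc d → Euc d) D volume := by
    rw [locallyIntegrableOn_iff hD.isLocallyClosed]
    intro k hk hkc
    have : IsFiniteMeasure ((spaceMeas D).restrict k) :=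
      ⟨by
        rw [Measure.restrict_apply_univ]
        exact (Measure.restrict_apply_le _ _).trans_lt hkc.measure_lt_top⟩
    have h1 : Integrable (w.grad : Euc d → Euc d) ((spaceMeas D).restrict k) :=
      ((Lp.memLp w.grad).restrict k).integrable Fact.out
    rwa [Measure.restrict_restrict_of_subset hk] at h1
  have key : ∀ e : Euc d, ∀ᵐ x, x ∈ D → inner ℝ e (w.grad x) = 0 := by
    intro e
    refine hD.ae_eq_zero_of_integral_contDiff_smul_eq_zero ?_ ?_
    · exact fun x hx => (hloc x hx).imp fun s hs =>
        ⟨hs.1, (innerSL ℝ e).integrable_comp hs.2⟩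
    · intro ζ h1 h2 h3
      have hζ : IsTest D ζ := ⟨h1, h2, h3⟩
      have := V.integral_fn_mul_fderiv (q := q) hζ e w
      have z : ∫ x, w.fn x * fderiv ℝ ζ x e ∂(spaceMeas D) = 0 := by
        refine (integral_congr_ae (g := fun _ => 0) ?_).trans (by simp)
        filter_upwards [hw] with x hx
        simp [hx]
      rw [z, setIntegral_eq_integral_of_forall_compl_eq_zero] at this
      · simp only [smul_eq_mul, mul_comm (ζ _)]
        linarith
      · intro x hx
        rw [image_eq_zero_of_notMem_tsupport fun h => hx (h3 h), mul_zero]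
  have hall : ∀ᵐ x, ∀ i : Fin d, x ∈ D → inner ℝ (EuclideanSpace.single i (1 : ℝ)) (w.grad x) = 0 :=
    ae_all_iff.2 fun i => key _
  filter_upwards [ae_restrict_of_ae hall, ae_restrict_mem hD.measurableSet] with x hx hxD
  ext i
  have := hx i hxD
  rw [EuclideanSpace.inner_single_left] at this
  simpa using this

end Sobolev
end Obstacle

/-! ### Smooth approximations of the absolute value and the sign -/

namespace Obstacle

section Approx

/-- A smooth convex approximation of the absolute value. -/
noncomputable def absApprox (δ s : ℝ) : ℝ := √(s ^ 2 + δ ^ 2) - δ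

/-- A smooth increasing approximation of the sign, the derivative of `absApprox`. -/
noncomputable def signApprox (δ s : ℝ) : ℝ := s / √(s ^ 2 + δ ^ 2)

theorem sq_add_sq_pos {δ : ℝ} (hδ : 0 < δ) (s : ℝ) : 0 < s ^ 2 + δ ^ 2 := by positivity

theorem sqrt_pos_of_pos {δ : ℝ} (hδ : 0 < δ) (s : ℝ) : 0 < √(s ^ 2 + δ ^ 2) :=
  Real.sqrt_pos.2 (sq_add_sq_pos hδ s)

theorem le_sqrt_sq_add_sq (δ s : ℝ) : δ ≤ √(s ^ 2 + δ ^ 2) :=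
  Real.le_sqrt_of_sq_le (by nlinarith [sq_nonneg s])

theorem abs_le_sqrt_sq_add_sq {δ : ℝ} (s : ℝ) : |s| ≤ √(s ^ 2 + δ ^ 2) :=
  Real.abs_le_sqrt (by nlinarith [sq_nonneg δ])

theorem hasDerivAt_sqrt_sq_add_sq {δ : ℝ} (hδ : 0 < δ) (s : ℝ) :
    HasDerivAt (fun s => √(s ^ 2 + δ ^ 2)) (signApprox δ s) s := by
  have h : HasDerivAt (fun s : ℝ => s ^ 2 + δ ^ 2) (2 * s) s := by
    simpa using ((hasDerivAt_id s).pow 2).add_const (δ ^ 2)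
  have h2 := h.sqrt (sq_add_sq_pos hδ s).ne'
  rwa [mul_div_mul_left _ _ two_ne_zero] at h2

theorem hasDerivAt_absApprox {δ : ℝ} (hδ : 0 < δ) (s : ℝ) :
    HasDerivAt (absApprox δ) (signApprox δ s) s :=
  (hasDerivAt_sqrt_sq_add_sq hδ s).sub_const δ

theorem hasDerivAt_signApprox {δ : ℝ} (hδ : 0 < δ) (s : ℝ) :
    HasDerivAt (signApprox δ) (δ ^ 2 / √(s ^ 2 + δ ^ 2) ^ 3) s := by
  have hp := sqrt_pos_of_pos hδ s
  have := (hasDerivAt_id s).div (hasDerivAt_sqrt_sq_add_sq hδ s) hp.ne'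
  refine this.congr_deriv ?_
  have hsq : √(s ^ 2 + δ ^ 2) ^ 2 = s ^ 2 + δ ^ 2 := Real.sq_sqrt (sq_add_sq_pos hδ s).le
  simp only [id, show signApprox δ s = s / √(s ^ 2 + δ ^ 2) from rfl]
  field_simp
  rw [hsq]
  ring

theorem deriv_signApprox {δ : ℝ} (hδ : 0 < δ) (s : ℝ) :
    deriv (signApprox δ) s = δ ^ 2 / √(s ^ 2 + δ ^ 2) ^ 3 :=
  (hasDerivAt_signApprox hδ s).deriv

theorem deriv_signApprox_nonneg {δ : ℝ} (hδ : 0 < δ) (s : ℝ) : 0 ≤ deriv (signApprox δ) s := by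
  rw [deriv_signApprox hδ]; positivity

theorem deriv_signApprox_le {δ : ℝ} (hδ : 0 < δ) (s : ℝ) : deriv (signApprox δ) s ≤ 1 / δ := by
  rw [deriv_signApprox hδ, div_le_div_iff₀ (by have := sqrt_pos_of_pos hδ s; positivity) hδ]
  have : δ ^ 3 ≤ √(s ^ 2 + δ ^ 2) ^ 3 := by
    gcongr
    exact le_sqrt_sq_add_sq δ s
  nlinarith

theorem abs_signApprox_le_one {δ : ℝ} (hδ : 0 < δ) (s : ℝ) : |signApprox δ s| ≤ 1 := by
  unfold signApprox
  rw [abs_div, abs_of_pos (sqrt_pos_of_pos hδ s), div_le_one (sqrt_pos_of_pos hδ s)]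
  exact abs_le_sqrt_sq_add_sq s

/-- Both `|s|` and `δ` are at most `√(s² + δ²)`. This bound, uniform in `δ`, supplies the domination
for the flux error. -/
theorem abs_mul_deriv_signApprox_le_one {δ : ℝ} (hδ : 0 < δ) (s : ℝ) :
    |s| * deriv (signApprox δ) s ≤ 1 := by
  have hp := sqrt_pos_of_pos hδ s
  rw [deriv_signApprox hδ, ← mul_div_assoc, div_le_one (by positivity)]
  have h1 : |s| ≤ √(s ^ 2 + δ ^ 2) := abs_le_sqrt_sq_add_sq s
  have h2 : δ ^ 2 ≤ √(s ^ 2 + δ ^ 2) ^ 2 := by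
    gcongr
    exact le_sqrt_sq_add_sq δ s
  calc |s| * δ ^ 2 ≤ √(s ^ 2 + δ ^ 2) * √(s ^ 2 + δ ^ 2) ^ 2 := by gcongr
    _ = _ := by ring

/-- The tangent line inequality for a convex function; here it is Cauchy–Schwarz for the vectors
`(b, δ)` and `(a, δ)`. -/
theorem absApprox_sub_le {δ : ℝ} (hδ : 0 < δ) (b a : ℝ) :
    absApprox δ b - absApprox δ a ≤ signApprox δ b * (b - a) := by
  have hb := sqrt_pos_of_pos hδ b
  have ha := sqrt_pos_of_pos hδ a
  have hsb : √(b ^ 2 + δ ^ 2) ^ 2 = b ^ 2 + δ ^ 2 := Real.sq_sqrt (sq_add_sq_pos hδ b).le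
  have hcs : b * a + δ ^ 2 ≤ √(b ^ 2 + δ ^ 2) * √(a ^ 2 + δ ^ 2) := by
    rw [← Real.sqrt_mul (sq_add_sq_pos hδ b).le]
    exact Real.le_sqrt_of_sq_le (by nlinarith [sq_nonneg (δ * (a - b))])
  unfold absApprox signApprox
  rw [div_mul_eq_mul_div, le_div_iff₀ hb]
  nlinarith

theorem absApprox_nonneg (δ s : ℝ) : 0 ≤ absApprox δ s :=
  sub_nonneg.2 (le_sqrt_sq_add_sq δ s)

theorem absApprox_le_abs {δ : ℝ} (hδ : 0 < δ) (s : ℝ) : absApprox δ s ≤ |s| := by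
  unfold absApprox
  rw [sub_le_iff_le_add, Real.sqrt_le_left (by positivity)]
  nlinarith [sq_abs s, abs_nonneg s, mul_nonneg (abs_nonneg s) hδ.le]

theorem abs_sub_le_absApprox {δ : ℝ} (s : ℝ) : |s| - δ ≤ absApprox δ s :=
  sub_le_sub_right (abs_le_sqrt_sq_add_sq s) δ

/-- For `u ≤ v` the left side is non-positive; otherwise `u - v ≤ u` and the root is at least `δ`.
The bound makes the approximate sign comparable with `u`, on which the reflection vanishes. -/
theorem signApprox_sub_le {δ : ℝ} (hδ : 0 < δ) {u v : ℝ} (hu : 0 ≤ u) (hv : 0 ≤ v) :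
    signApprox δ (u - v) ≤ u / δ := by
  unfold signApprox
  rcases le_total (u - v) 0 with h | h
  · exact (div_nonpos_of_nonpos_of_nonneg h (Real.sqrt_nonneg _)).trans (by positivity)
  · exact div_le_div₀ hu (by linarith) hδ (le_sqrt_sq_add_sq δ _)

theorem contDiff_sqrt_sq_add_sq {δ : ℝ} (hδ : 0 < δ) {n : WithTop ℕ∞} :
    ContDiff ℝ n fun s : ℝ => √(s ^ 2 + δ ^ 2) :=
  ((contDiff_id.pow 2).add contDiff_const).sqrt fun s => (sq_add_sq_pos hδ s).ne'

theorem contDiff_absApprox {δ : ℝ} (hδ : 0 < δ) {n : WithTop ℕ∞} : ContDiff ℝ n (absApprox δ) :=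
  (contDiff_sqrt_sq_add_sq hδ).sub contDiff_const

theorem contDiff_signApprox {δ : ℝ} (hδ : 0 < δ) {n : WithTop ℕ∞} : ContDiff ℝ n (signApprox δ) :=
  contDiff_id.div (contDiff_sqrt_sq_add_sq hδ) fun s => (sqrt_pos_of_pos hδ s).ne'

theorem isTruncation_absApprox {δ : ℝ} (hδ : 0 < δ) : IsTruncation (absApprox δ) 1 where
  contDiff := contDiff_absApprox hδ
  zero := by simp [absApprox, Real.sqrt_sq hδ.le]
  deriv_le s := by
    rw [(hasDerivAt_absApprox hδ s).deriv]
    exact abs_signApprox_le_one hδ s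

theorem isTruncation_signApprox {δ : ℝ} (hδ : 0 < δ) : IsTruncation (signApprox δ) (1 / δ).toNNReal where
  contDiff := contDiff_signApprox hδ
  zero := by simp [signApprox]
  deriv_le s := by
    rw [abs_of_nonneg (deriv_signApprox_nonneg hδ s), Real.coe_toNNReal _ (by positivity)]
    exact deriv_signApprox_le hδ s

theorem tendsto_sqrt_sq_add_sq (s : ℝ) {δ : ℕ → ℝ} (hδ : Tendsto δ atTop (𝓝 0)) :
    Tendsto (fun n => √(s ^ 2 + δ n ^ 2)) atTop (𝓝 |s|) := by
  have h1 : Tendsto (fun n => s ^ 2 + δ n ^ 2) atTop (𝓝 (s ^ 2 + 0 ^ 2)) :=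
    (hδ.pow 2).const_add _
  have := h1.sqrt
  rwa [zero_pow two_ne_zero, add_zero, Real.sqrt_sq_eq_abs] at this

theorem tendsto_abs_mul_deriv_signApprox (s : ℝ) {δ : ℕ → ℝ} (hδ : Tendsto δ atTop (𝓝 0))
    (hpos : ∀ n, 0 < δ n) :
    Tendsto (fun n => |s| * deriv (signApprox (δ n)) s) atTop (𝓝 0) := by
  rcases eq_or_ne s 0 with rfl | hs
  · simp
  · simp only [deriv_signApprox (hpos _)]
    have h1 := ((hδ.pow 2).div ((tendsto_sqrt_sq_add_sq s hδ).pow 3)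
      (pow_ne_zero 3 (abs_ne_zero.2 hs))).const_mul |s|
    simpa using h1

end Approx

/-! ### Gradients on zero sets and density of non-negative test functions -/

section Positivity

variable {d : ℕ} {D : Set (Euc d)} {p : ℝ≥0∞} [Fact (1 ≤ p)]

theorem V.tendsto_of_dominated (hp : p ≠ ∞) {w : ℕ → V p D}
    {w₀ : Lp ℝ p (spaceMeas D) × Lp (Euc d) p (spaceMeas D)} {b₁ b₂ : Euc d → ℝ}
    (hb₁ : MemLp b₁ p (spaceMeas D)) (hb₂ : MemLp b₂ p (spaceMeas D))
    (h₁ : ∀ n, ∀ᵐ x ∂(spaceMeas D), ‖(w n).fn x - w₀.1 x‖ ≤ b₁ x)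
    (h₂ : ∀ n, ∀ᵐ x ∂(spaceMeas D), ‖(w n).grad x - w₀.2 x‖ ≤ b₂ x)
    (l₁ : ∀ᵐ x ∂(spaceMeas D), Tendsto (fun n => (w n).fn x) atTop (𝓝 (w₀.1 x)))
    (l₂ : ∀ᵐ x ∂(spaceMeas D), Tendsto (fun n => (w n).grad x) atTop (𝓝 (w₀.2 x))) :
    Tendsto (fun n => (w n : Lp ℝ p (spaceMeas D) × Lp (Euc d) p (spaceMeas D))) atTop (𝓝 w₀) := by
  have t1 := tendsto_toLp_of_dominated hp (fun n => Lp.memLp (w n).fn) (Lp.memLp w₀.1) hb₁ h₁ l₁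
  have t2 := tendsto_toLp_of_dominated hp (fun n => Lp.memLp (w n).grad) (Lp.memLp w₀.2) hb₂ h₂ l₂
  simp only [Lp.toLp_coeFn] at t1 t2
  exact t1.prodMk_nhds t2

theorem tendsto_inv_nat_add_one : Tendsto (fun n : ℕ => 1 / ((n : ℝ) + 1)) atTop (𝓝 0) :=
  tendsto_one_div_add_atTop_nhds_zero_nat

/-- The elements `δ S_δ(w)` tend to `0`, while their gradients `(δ/√(w² + δ²))³ ∇w` tend to `∇w` on
`{w = 0}` and to `0` elsewhere. The limit pair `(0, 1_{w = 0} ∇w)` lies in the closed space, and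
uniqueness of the gradient makes its second component vanish. -/
theorem V.grad_ae_eq_zero {q : ℝ≥0∞} [Fact (1 ≤ q)] [p.HolderConjugate q] (hp : p ≠ ∞)
    (hD : IsOpen D) (w : V p D) : ∀ᵐ x ∂(spaceMeas D), w.fn x = 0 → w.grad x = 0 := by
  classical
  let δ : ℕ → ℝ := fun n => 1 / ((n : ℝ) + 1)
  have hpos : ∀ n, 0 < δ n := fun n => Nat.one_div_pos_of_nat
  have hlim : Tendsto δ atTop (𝓝 0) := tendsto_inv_nat_add_one
  let x : ℕ → V p D := fun n => δ n • V.superpose (isTruncation_signApprox (hpos n))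
    (contDiff_signApprox (hpos n)) hp w
  have hxf : ∀ n, (x n).fn =ᵐ[spaceMeas D] fun y => δ n * signApprox (δ n) (w.fn y) := by
    intro n
    filter_upwards [Lp.coeFn_smul (δ n) (V.superpose (isTruncation_signApprox (hpos n))
      (contDiff_signApprox (hpos n)) hp w).fn, V.fn_superpose (isTruncation_signApprox (hpos n))
      (contDiff_signApprox (hpos n)) hp w] with y h1 h2
    refine h1.trans ?_
    rw [Pi.smul_apply, h2, smul_eq_mul]
  have hxg : ∀ n, (x n).grad =ᵐ[spaceMeas D]
      fun y => (δ n * deriv (signApprox (δ n)) (w.fn y)) • w.grad y := by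
    intro n
    filter_upwards [Lp.coeFn_smul (δ n) (V.superpose (isTruncation_signApprox (hpos n))
      (contDiff_signApprox (hpos n)) hp w).grad, V.grad_superpose (isTruncation_signApprox (hpos n))
      (contDiff_signApprox (hpos n)) hp w] with y h1 h2
    refine h1.trans ?_
    rw [Pi.smul_apply, h2, mul_smul]
  have hfm : AEStronglyMeasurable (fun y => if w.fn y = 0 then (1 : ℝ) else 0) (spaceMeas D) := by
    have hm : Measurable fun s : ℝ => if s = 0 then (1 : ℝ) else 0 :=
      Measurable.ite (measurableSet_singleton 0) measurable_const measurable_const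
    exact (hm.comp_aemeasurable (Lp.aestronglyMeasurable w.fn).aemeasurable).aestronglyMeasurable
  have hZ : MemLp (fun y => (if w.fn y = 0 then (1 : ℝ) else 0) • w.grad y) p (spaceMeas D) := by
    refine MemLp.of_le (Lp.memLp w.grad) (hfm.smul (Lp.aestronglyMeasurable _))
      (Eventually.of_forall fun y => ?_)
    split_ifs <;> simp
  let w₀ : Lp ℝ p (spaceMeas D) × Lp (Euc d) p (spaceMeas D) := (0, hZ.toLp _)
  have hbd : ∀ n s, |δ n * signApprox (δ n) s| ≤ |s| := by
    intro n s
    rw [abs_mul, abs_of_pos (hpos n), signApprox, abs_div, abs_of_pos (sqrt_pos_of_pos (hpos n) s),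
      ← mul_div_assoc, div_le_iff₀ (sqrt_pos_of_pos (hpos n) s), mul_comm]
    exact mul_le_mul_of_nonneg_left (le_sqrt_sq_add_sq (δ n) s) (abs_nonneg s)
  have hbd' : ∀ n s, |δ n * deriv (signApprox (δ n)) s| ≤ 1 := by
    intro n s
    rw [abs_mul, abs_of_pos (hpos n), abs_of_nonneg (deriv_signApprox_nonneg (hpos n) s)]
    calc _ ≤ δ n * (1 / δ n) := mul_le_mul_of_nonneg_left (deriv_signApprox_le (hpos n) s) (hpos n).le
      _ = 1 := mul_one_div_cancel (hpos n).ne'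
  have ht : Tendsto (fun n => (x n : Lp ℝ p (spaceMeas D) × Lp (Euc d) p (spaceMeas D))) atTop
      (𝓝 w₀) := by
    refine V.tendsto_of_dominated hp (Lp.memLp w.fn).norm ((Lp.memLp w.grad).norm.const_mul 2)
      (fun n => ?_) (fun n => ?_) ?_ ?_
    · filter_upwards [hxf n, Lp.coeFn_zero ℝ p (spaceMeas D)] with y h1 h2
      rw [h1, h2, Pi.zero_apply, sub_zero]
      exact hbd n _
    · filter_upwards [hxg n, hZ.coeFn_toLp] with y h1 h2
      rw [h1, h2, ← sub_smul, norm_smul]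
      refine mul_le_mul_of_nonneg_right ?_ (norm_nonneg _)
      refine (norm_sub_le _ _).trans ?_
      have := hbd' n (w.fn y)
      rw [Real.norm_eq_abs]
      have h3 : ‖(if w.fn y = 0 then (1 : ℝ) else 0)‖ ≤ 1 := by split_ifs <;> simp
      linarith
    · filter_upwards [ae_all_iff.2 hxf, Lp.coeFn_zero ℝ p (spaceMeas D)] with y h1 h2
      rw [h2, Pi.zero_apply]
      refine squeeze_zero_norm (a := δ) (fun n => ?_) hlim
      rw [h1, norm_mul, Real.norm_of_nonneg (hpos n).le]
      exact mul_le_of_le_one_right (hpos n).le (abs_signApprox_le_one (hpos n) _)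
    · filter_upwards [ae_all_iff.2 hxg, hZ.coeFn_toLp] with y h1 h2
      rw [h2]
      simp only [h1]
      refine Tendsto.smul_const ?_ _
      by_cases h0 : w.fn y = 0
      · simp only [h0, if_true]
        refine tendsto_const_nhds.congr fun n => ?_
        rw [deriv_signApprox (hpos n), zero_pow two_ne_zero, zero_add, Real.sqrt_sq (hpos n).le]
        have := (hpos n).ne'
        field_simp
      · simp only [h0, if_false]
        have h3 := (hlim.mul (tendsto_abs_mul_deriv_signApprox (w.fn y) hlim hpos)).div_const
          |w.fn y|
        rw [mul_zero, zero_div] at h3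
        refine h3.congr fun n => ?_
        have := abs_ne_zero.2 h0
        field_simp
  have hmem : w₀ ∈ W01 p D := (Submodule.isClosed_topologicalClosure _).mem_of_tendsto ht
    (Eventually.of_forall fun n => (x n).2)
  have hz := V.grad_eq_zero_of_fn_eq_zero (q := q) hD (w := (⟨w₀, hmem⟩ : V p D))
    (Lp.coeFn_zero ℝ p (spaceMeas D))
  filter_upwards [hz, hZ.coeFn_toLp] with y h1 h2 h0
  have h3 := h2.symm.trans h1
  simpa [h0] using h3

/-- Non-negative elements of `W_0^{1,p}(D)` are limits of non-negative test functions. -/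
theorem V.nonneg_induction {q : ℝ≥0∞} [Fact (1 ≤ q)] [p.HolderConjugate q] (hp : p ≠ ∞)
    (hD : IsOpen D) {P : V p D → Prop} (hP : IsClosed {w | P w})
    (h : ∀ (φ : Euc d → ℝ) (hφ : IsTest D φ), (∀ x, 0 ≤ φ x) → P (V.ofTest hφ)) (w : V p D)
    (hw : 0 ≤ᵐ[spaceMeas D] w.fn) : P w := by
  let δ : ℕ → ℝ := fun n => 1 / ((n : ℝ) + 1)
  have hpos : ∀ n, 0 < δ n := fun n => Nat.one_div_pos_of_nat
  have hlim : Tendsto δ atTop (𝓝 0) := tendsto_inv_nat_add_one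
  -- The smoothed modulus `A_δ(w)` is a limit of the non-negative test functions `A_δ(φ)`, whatever
  -- the sign of `w`.
  have hPn : ∀ n, P (V.superpose (isTruncation_absApprox (hpos n)) (contDiff_absApprox (hpos n))
      hp w) := by
    intro n
    refine V.induction_closed (P := fun w => P (V.superpose (isTruncation_absApprox (hpos n))
      (contDiff_absApprox (hpos n)) hp w)) ?_ ?_ w
    · exact hP.preimage (V.continuous_superpose _ _ hp)
    · intro φ hφ
      rw [V.superpose_ofTest]
      exact h _ _ fun x => absApprox_nonneg (δ n) _
  refine hP.mem_of_tendsto (b := atTop) ?_ (Eventually.of_forall hPn)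
  rw [tendsto_subtype_rng]
  have hfn := fun n => V.fn_superpose (isTruncation_absApprox (hpos n))
    (contDiff_absApprox (hpos n)) hp w
  have hgr := fun n => V.grad_superpose (isTruncation_absApprox (hpos n))
    (contDiff_absApprox (hpos n)) hp w
  refine V.tendsto_of_dominated hp ((Lp.memLp w.fn).norm.const_mul 2)
    ((Lp.memLp w.grad).norm.const_mul 2) (fun n => ?_) (fun n => ?_) ?_ ?_
  · filter_upwards [hfn n] with y h1
    rw [h1]
    refine (norm_sub_le _ _).trans ?_
    rw [Real.norm_of_nonneg (absApprox_nonneg (δ n) _)]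
    have := absApprox_le_abs (hpos n) (w.fn y)
    change _ + ‖w.fn y‖ ≤ _
    rw [Real.norm_eq_abs]
    linarith
  · filter_upwards [hgr n] with y h1
    rw [h1, (hasDerivAt_absApprox (hpos n) _).deriv]
    refine (norm_sub_le _ _).trans ?_
    rw [norm_smul, Real.norm_eq_abs]
    have := mul_le_mul_of_nonneg_right (abs_signApprox_le_one (hpos n) (w.fn y))
      (norm_nonneg (w.grad y))
    change _ + ‖w.grad y‖ ≤ _
    linarith
  · filter_upwards [ae_all_iff.2 hfn, hw] with y h1 h2
    simp only [h1]
    have := (tendsto_sqrt_sq_add_sq (w.fn y) hlim).sub hlim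
    rwa [sub_zero, abs_of_nonneg h2] at this
  -- The gradients `S_δ(w) ∇w` converge to `∇w`: where `w > 0` because `S_δ(w) → 1`, and where `w =
  -- 0` because `∇w` vanishes there.
  · filter_upwards [ae_all_iff.2 hgr, hw, V.grad_ae_eq_zero (q := q) hp hD w] with y h1 h2 h3
    simp only [h1, (hasDerivAt_absApprox (hpos _) _).deriv]
    change Tendsto _ _ (𝓝 (w.grad y))
    by_cases h0 : w.fn y = 0
    · rw [h3 h0]; simp
    · have h4 : Tendsto (fun n => signApprox (δ n) (w.fn y)) atTop (𝓝 (w.fn y / |w.fn y|)) :=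
        tendsto_const_nhds.div (tendsto_sqrt_sq_add_sq (w.fn y) hlim) (abs_ne_zero.2 h0)
      rw [abs_of_nonneg h2, div_self h0] at h4
      simpa using h4.smul_const (w.grad y)

end Positivity
end Obstacle

/-! ### Embedding into `L²(D)` and positivity of the reflection functional -/

namespace Obstacle

variable {d : ℕ} {D : Set (Euc d)} {p : ℝ≥0∞} [Fact (1 ≤ p)]

/-- The embedding of `W_0^{1,p}(D)` into `L²(D)`. -/
noncomputable def V.toL2 [IsFiniteMeasure (spaceMeas D)] (hp2 : 2 ≤ p) : V p D →L[ℝ] L2 D :=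
  LinearMap.mkContinuous
    { toFun := fun w => ((Lp.memLp w.fn).mono_exponent hp2).toLp w.fn
      map_add' := fun w w' => Lp.ext <| by
        filter_upwards [((Lp.memLp (w + w').fn).mono_exponent hp2).coeFn_toLp,
          ((Lp.memLp w.fn).mono_exponent hp2).coeFn_toLp,
          ((Lp.memLp w'.fn).mono_exponent hp2).coeFn_toLp, Lp.coeFn_add w.fn w'.fn,
          Lp.coeFn_add (((Lp.memLp w.fn).mono_exponent hp2).toLp w.fn)
            (((Lp.memLp w'.fn).mono_exponent hp2).toLp w'.fn)] with x h1 h2 h3 h4 h5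
        rw [h1, h5, Pi.add_apply, h2, h3]
        exact h4
      map_smul' := fun c w => Lp.ext <| by
        filter_upwards [((Lp.memLp (c • w).fn).mono_exponent hp2).coeFn_toLp,
          ((Lp.memLp w.fn).mono_exponent hp2).coeFn_toLp, Lp.coeFn_smul c w.fn,
          Lp.coeFn_smul c (((Lp.memLp w.fn).mono_exponent hp2).toLp w.fn)] with x h1 h2 h4 h5
        rw [h1, RingHom.id_apply, h5, Pi.smul_apply, h2]
        exact h4 }
    ((spaceMeas D) univ ^ (1 / (2 : ℝ≥0∞).toReal - 1 / p.toReal)).toReal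
    (fun w => by
      change ‖((Lp.memLp w.fn).mono_exponent hp2).toLp w.fn‖ ≤ _
      have h1 := eLpNorm_le_eLpNorm_mul_rpow_measure_univ hp2 (Lp.aestronglyMeasurable w.fn)
      have hexp : 0 ≤ 1 / (2 : ℝ≥0∞).toReal - 1 / p.toReal := by
        rcases eq_or_ne p ∞ with rfl | hp
        · simp
        · rw [sub_nonneg]
          exact one_div_le_one_div_of_le (by norm_num) (ENNReal.toReal_mono hp hp2)
      have hfin : (spaceMeas D) univ ^ (1 / (2 : ℝ≥0∞).toReal - 1 / p.toReal) ≠ ∞ :=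
        ENNReal.rpow_ne_top_of_nonneg hexp (measure_ne_top _ _)
      rw [Lp.norm_toLp]
      have h2 := ENNReal.toReal_mono (ENNReal.mul_ne_top (Lp.memLp w.fn).2.ne hfin) h1
      rw [ENNReal.toReal_mul, mul_comm] at h2
      refine h2.trans (mul_le_mul_of_nonneg_left ?_ ENNReal.toReal_nonneg)
      exact norm_fst_le (w : Lp ℝ p (spaceMeas D) × Lp (Euc d) p (spaceMeas D)))

theorem V.coeFn_toL2 [IsFiniteMeasure (spaceMeas D)] (hp2 : 2 ≤ p) (w : V p D) :
    V.toL2 hp2 w =ᵐ[spaceMeas D] w.fn := ((Lp.memLp w.fn).mono_exponent hp2).coeFn_toLp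

theorem V.separable (hp : p ≠ ∞) : SecondCountableTopology (V p D) := by
  have : Fact (p ≠ ∞) := ⟨hp⟩
  have h1 : SecondCountableTopology (Lp ℝ p (spaceMeas D)) := Lp.SecondCountableTopology
  have h2 : SecondCountableTopology (Lp (Euc d) p (spaceMeas D)) := Lp.SecondCountableTopology
  exact TopologicalSpace.Subtype.secondCountableTopology _

/-! #### Tensor products of test functions -/

theorem tsupport_mul_prod_subset {X Y : Type*} [TopologicalSpace X] [TopologicalSpace Y]
    (θ : X → ℝ) (φ : Y → ℝ) :
    tsupport (fun y : X × Y => θ y.1 * φ y.2) ⊆ tsupport θ ×ˢ tsupport φ := by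
  refine closure_minimal ?_ ((isClosed_tsupport _).prod (isClosed_tsupport _))
  intro y hy
  exact ⟨subset_tsupport _ (left_ne_zero_of_mul hy), subset_tsupport _ (right_ne_zero_of_mul hy)⟩

theorem isTest_tensor {T : ℝ} {θ : ℝ → ℝ} {φ : Euc d → ℝ} (hθ : IsTest (Ioo 0 T) θ)
    (hφ : IsTest D φ) : IsTest (cyl T D) fun y => θ y.1 * φ y.2 where
  smooth := (hθ.smooth.comp contDiff_fst).mul (hφ.smooth.comp contDiff_snd)
  compact := (hθ.compact.prod hφ.compact).of_isClosed_subset (isClosed_tsupport _)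
    (tsupport_mul_prod_subset θ φ)
  support := (tsupport_mul_prod_subset θ φ).trans (prod_mono hθ.support hφ.support)

theorem memLp_smul_const {T : ℝ} {θ : ℝ → ℝ} (hθ : IsTest (Ioo 0 T) θ) (w : V p D) :
    MemLp (fun t => θ t • w) p (timeMeas T) :=
  (hθ.smooth.continuous.smul continuous_const).memLp_of_hasCompactSupport hθ.compact.smul_right

theorem IsFunctional.integral_tensor {q : ℝ≥0∞} {T : ℝ} {η : Measure (ℝ × Euc d)}
    {g : LqV' p q T D} (hg : IsFunctional η g) {θ : ℝ → ℝ} {φ : Euc d → ℝ}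
    (hθ : IsTest (Ioo 0 T) θ) (hφ : IsTest D φ) :
    ∫ t, θ t * g t (V.ofTest hφ) ∂(timeMeas T) = ∫ y, θ y.1 * φ y.2 ∂η := by
  have hm := memLp_smul_const (p := p) hθ (V.ofTest hφ)
  rw [← hg _ (hm.toLp _) (isTest_tensor hθ hφ) ?_]
  · refine integral_congr_ae ?_
    filter_upwards [hm.coeFn_toLp] with t ht
    rw [ht, map_smul, smul_eq_mul]
  · filter_upwards [hm.coeFn_toLp] with t ht
    rw [ht]
    filter_upwards [V.fn_ofTest (p := p) hφ,
      Lp.coeFn_smul (θ t) (V.ofTest hφ : V p D).fn] with x h1 h2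
    refine h2.trans ?_
    rw [Pi.smul_apply, h1, smul_eq_mul]

theorem integrable_apply_const {q : ℝ≥0∞} [hq : Fact (1 ≤ q)] {T : ℝ} {g : ℝ → V' p D}
    (hg : MemLp g q (timeMeas T)) (w : V p D) : Integrable (fun t => g t w) (timeMeas T) :=
  (ContinuousLinearMap.apply ℝ ℝ w).integrable_comp (hg.integrable hq.out)

/-- Testing with products `θ(t) φ(x)` gives `g t φ ≥ 0` for a.e. `t`, with a null set depending on
`φ`. Separability reduces to countably many `φ`, which yields one null set; density of non-negative
test functions extends the sign to all non-negative elements. -/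
theorem IsFunctional.ae_nonneg {q : ℝ≥0∞} [Fact (1 ≤ q)] [p.HolderConjugate q] (hp : p ≠ ∞)
    (hD : IsOpen D) {T : ℝ} {η : Measure (ℝ × Euc d)} {g : LqV' p q T D}
    (hg : IsFunctional η g) :
    ∀ᵐ t ∂(timeMeas T), ∀ w : V p D, 0 ≤ᵐ[spaceMeas D] w.fn → 0 ≤ g t w := by
  let S : Set (V p D) :=
    {x | ∃ (φ : Euc d → ℝ) (hφ : IsTest D φ), (∀ x, 0 ≤ φ x) ∧ x = V.ofTest hφ}
  have hS : ∀ x ∈ S, ∀ᵐ t ∂(timeMeas T), 0 ≤ g t x := by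
    rintro x ⟨φ, hφ, h0, rfl⟩
    refine ae_nonneg_of_integral_test_mul_nonneg
      (integrable_apply_const (Lp.memLp g) _) fun θ hθ hθ0 => ?_
    rw [hg.integral_tensor hθ hφ]
    exact integral_nonneg fun y => mul_nonneg (hθ0 _) (h0 _)
  have := V.separable (p := p) (D := D) hp
  obtain ⟨c, hcS, hc, hcl⟩ :=
    (TopologicalSpace.IsSeparable.of_separableSpace S).exists_countable_dense_subset
  have hall : ∀ᵐ t ∂(timeMeas T), ∀ x ∈ c, 0 ≤ g t x :=
    (ae_ball_iff hc).2 fun x hx => hS x (hcS hx)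
  filter_upwards [hall] with t ht w hw
  have hclosed : IsClosed {w : V p D | 0 ≤ g t w} := isClosed_le continuous_const (g t).continuous
  refine V.nonneg_induction (q := q) (P := fun w => 0 ≤ g t w) hp hD hclosed ?_ w hw
  intro φ hφ h0
  exact closure_minimal (fun x hx => ht x hx) hclosed (hcl ⟨φ, hφ, h0, rfl⟩)

end Obstacle

/-! ### Conjugate exponents and the flux as a map into `L^{p'}(D)` -/

namespace Obstacle

theorem ne_top_of_holderConjugate_of_two_le {p q : ℝ≥0∞} [h : p.HolderConjugate q] (hp2 : 2 ≤ p) :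
    q ≠ ∞ := by
  rintro rfl
  have h1 := h.inv_add_inv_eq_inv
  simp only [ENNReal.inv_top, add_zero, inv_one, ENNReal.inv_eq_one] at h1
  rw [h1] at hp2
  norm_num at hp2

theorem conj_mul_ofReal_sub_one {p q : ℝ≥0∞} [p.HolderConjugate q] (hp : p ≠ ∞) (hp2 : 2 ≤ p) :
    q * ENNReal.ofReal (p.toReal - 1) = p := by
  have hq := ne_top_of_holderConjugate_of_two_le (q := q) hp2
  have hq0 : q ≠ 0 := ENNReal.HolderConjugate.ne_zero q p
  rw [ENNReal.ofReal_sub _ zero_le_one, ENNReal.ofReal_toReal hp, ENNReal.ofReal_one,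
    ← ENNReal.HolderConjugate.div_conj_eq_sub_one (p := p) (q := q), ENNReal.mul_div_cancel hq0 hq]

theorem toReal_sub_one_pos {p : ℝ≥0∞} (hp : p ≠ ∞) (hp2 : 2 ≤ p) : 0 < p.toReal - 1 := by
  have : (2 : ℝ) ≤ p.toReal := by simpa using ENNReal.toReal_mono hp hp2
  linarith

section Power

variable {α : Type*} {mα : MeasurableSpace α} {μ : Measure α} {E : Type*} [NormedAddCommGroup E]
  {p q : ℝ≥0∞} [p.HolderConjugate q] (hp : p ≠ ∞) (hp2 : 2 ≤ p) {f : α → E}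

include hp hp2

theorem eLpNorm_rpow_sub_one (f : α → E) :
    eLpNorm (fun x => ‖f x‖ ^ (p.toReal - 1)) q μ = eLpNorm f p μ ^ (p.toReal - 1) := by
  rw [eLpNorm_norm_rpow f (toReal_sub_one_pos hp hp2), conj_mul_ofReal_sub_one hp hp2]

theorem memLp_rpow_sub_one (hf : MemLp f p μ) : MemLp (fun x => ‖f x‖ ^ (p.toReal - 1)) q μ := by
  refine ⟨(hf.1.norm.aemeasurable.pow_const _).aestronglyMeasurable, ?_⟩
  rw [eLpNorm_rpow_sub_one hp hp2]
  exact ENNReal.rpow_lt_top_of_nonneg (toReal_sub_one_pos hp hp2).le hf.2.ne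

theorem toReal_eLpNorm_const_mul_rpow_sub_one {c : ℝ} (hc : 0 ≤ c) (f : α → E) :
    (eLpNorm (fun x => c * ‖f x‖ ^ (p.toReal - 1)) q μ).toReal =
      c * (eLpNorm f p μ).toReal ^ (p.toReal - 1) := by
  have : eLpNorm (fun x => c * ‖f x‖ ^ (p.toReal - 1)) q μ =
      ‖c‖ₑ * eLpNorm f p μ ^ (p.toReal - 1) := by
    rw [← eLpNorm_rpow_sub_one (q := q) hp hp2]
    exact eLpNorm_const_smul c (fun x => ‖f x‖ ^ (p.toReal - 1)) q μ
  rw [this, ENNReal.toReal_mul, ← ENNReal.toReal_rpow, toReal_enorm, Real.norm_of_nonneg hc]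

end Power

section Clip

variable {F : Type*} [NormedAddCommGroup F] [NormedSpace ℝ F]

/-- A continuous retraction of a normed space into the ball of radius `R`. -/
noncomputable def clip (R : ℝ) (y : F) : F := (R / (R + ‖y‖)) • y

theorem continuous_clip {R : ℝ} (hR : 0 < R) : Continuous (clip R : F → F) := by
  refine Continuous.smul (continuous_const.div (by fun_prop) fun y => ?_) continuous_id
  positivity

theorem norm_clip_le {R : ℝ} (hR : 0 < R) (y : F) : ‖clip R y‖ ≤ R := by
  rw [clip, norm_smul, Real.norm_of_nonneg (by positivity), div_mul_eq_mul_div,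
    div_le_iff₀ (by positivity)]
  nlinarith [norm_nonneg y]

theorem norm_clip_le_norm {R : ℝ} (hR : 0 < R) (y : F) : ‖clip R y‖ ≤ ‖y‖ := by
  rw [clip, norm_smul, Real.norm_of_nonneg (by positivity)]
  refine mul_le_of_le_one_left (norm_nonneg _) ?_
  rw [div_le_one (by positivity)]
  linarith [norm_nonneg y]

theorem tendsto_clip (y : F) :
    Tendsto (fun n : ℕ => clip ((n : ℝ) + 1) y) atTop (𝓝 y) := by
  have h1 : Tendsto (fun n : ℕ => ‖y‖ / ((n : ℝ) + 1 + ‖y‖)) atTop (𝓝 0) := by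
    refine Tendsto.div_atTop tendsto_const_nhds ?_
    exact tendsto_atTop_add_const_right _ _
      (tendsto_atTop_add_const_right _ _ tendsto_natCast_atTop_atTop)
  have h2 := (h1.const_sub 1).smul_const y
  rw [sub_zero, one_smul] at h2
  refine h2.congr fun n => ?_
  unfold clip
  congr 1
  have : (n : ℝ) + 1 + ‖y‖ ≠ 0 := by positivity
  field_simp
  ring

end Clip

section Flux

variable {d : ℕ} {D : Set (Euc d)} {p q : ℝ≥0∞} [Fact (1 ≤ p)] [Fact (1 ≤ q)]
  [p.HolderConjugate q] {a : Euc d → ℝ → Euc d → Euc d}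

namespace IsAdmissible

variable (ha : IsAdmissible p q D a)
include ha

omit [Fact (1 ≤ q)] [p.HolderConjugate q] in
theorem aestronglyMeasurable_flux (w : V p D) :
    AEStronglyMeasurable (fun x => a x (w.fn x) (w.grad x)) (spaceMeas D) :=
  aestronglyMeasurable_caratheodory (b := fun x (z : ℝ × Euc d) => a x z.1 z.2)
    (fun z => ha.measurable z.1 z.2) ha.continuous
    ((Lp.aestronglyMeasurable w.fn).prodMk (Lp.aestronglyMeasurable w.grad))

/-- Growth of order `p - 1` maps `L^p` into `L^{p'}` because `p' (p - 1) = p`. The constants do not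
depend on `w`, as the integrability in time requires. -/
theorem exists_flux_bound (hp : p ≠ ∞) (hp2 : 2 ≤ p) :
    ∃ C B : ℝ, 0 ≤ C ∧ 0 ≤ B ∧ ∀ w : V p D,
      MemLp (fun x => a x (w.fn x) (w.grad x)) q (spaceMeas D) ∧
      (eLpNorm (fun x => a x (w.fn x) (w.grad x)) q (spaceMeas D)).toReal ≤
        C * ‖w‖ ^ (p.toReal - 1) + B := by
  obtain ⟨C₂, C₃, g, h2, h3, hg, hg0, hle⟩ := ha.growth
  have hr := toReal_sub_one_pos hp hp2
  refine ⟨C₂ + C₃, (eLpNorm g q (spaceMeas D)).toReal, by positivity, ENNReal.toReal_nonneg,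
    fun w => ?_⟩
  have m1 := (memLp_rpow_sub_one (q := q) hp hp2 (Lp.memLp w.grad)).const_mul C₂
  have m2 := (memLp_rpow_sub_one (q := q) hp hp2 (Lp.memLp w.fn)).const_mul C₃
  have hb : ∀ᵐ x ∂(spaceMeas D), ‖a x (w.fn x) (w.grad x)‖ ≤
      ‖C₂ * ‖w.grad x‖ ^ (p.toReal - 1) + C₃ * ‖w.fn x‖ ^ (p.toReal - 1) + g x‖ := by
    filter_upwards [hle] with x hx
    exact (hx _ _).trans (le_abs_self _)
  have hsum := (m1.add m2).add hg
  have hmem : MemLp (fun x => a x (w.fn x) (w.grad x)) q (spaceMeas D) :=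
    hsum.of_le (ha.aestronglyMeasurable_flux w) hb
  refine ⟨hmem, ?_⟩
  have n1 : (eLpNorm w.grad p (spaceMeas D)).toReal ≤ ‖w‖ :=
    norm_snd_le (w : Lp ℝ p (spaceMeas D) × Lp (Euc d) p (spaceMeas D))
  have n2 : (eLpNorm w.fn p (spaceMeas D)).toReal ≤ ‖w‖ :=
    norm_fst_le (w : Lp ℝ p (spaceMeas D) × Lp (Euc d) p (spaceMeas D))
  have hq1 : 1 ≤ q := Fact.out
  have t1 := (eLpNorm_mono_ae hb).trans ((eLpNorm_add_le (m1.add m2).1 hg.1 hq1).trans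
    (add_le_add (eLpNorm_add_le m1.1 m2.1 hq1) le_rfl))
  have t2 := ENNReal.toReal_mono (ENNReal.add_ne_top.2
    ⟨ENNReal.add_ne_top.2 ⟨m1.2.ne, m2.2.ne⟩, hg.2.ne⟩) t1
  rw [ENNReal.toReal_add (ENNReal.add_ne_top.2 ⟨m1.2.ne, m2.2.ne⟩) hg.2.ne,
    ENNReal.toReal_add m1.2.ne m2.2.ne, toReal_eLpNorm_const_mul_rpow_sub_one hp hp2 h2,
    toReal_eLpNorm_const_mul_rpow_sub_one hp hp2 h3] at t2
  refine t2.trans ?_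
  rw [add_mul]
  gcongr

/-- The flux `a(·, w, ∇w)` as an element of `L^{p'}(D)`. -/
noncomputable def flux (hp : p ≠ ∞) (hp2 : 2 ≤ p) (w : V p D) : Lp (Euc d) q (spaceMeas D) :=
  ((ha.exists_flux_bound hp hp2).choose_spec.choose_spec.2.2 w).1.toLp _

theorem coeFn_flux (hp : p ≠ ∞) (hp2 : 2 ≤ p) (w : V p D) :
    ha.flux hp hp2 w =ᵐ[spaceMeas D] fun x => a x (w.fn x) (w.grad x) :=
  ((ha.exists_flux_bound hp hp2).choose_spec.choose_spec.2.2 w).1.coeFn_toLp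

theorem exists_norm_flux_le (hp : p ≠ ∞) (hp2 : 2 ≤ p) :
    ∃ C B : ℝ, 0 ≤ C ∧ 0 ≤ B ∧ ∀ w : V p D,
      ‖ha.flux hp hp2 w‖ ≤ C * ‖w‖ ^ (p.toReal - 1) + B := by
  obtain ⟨C, B, hC, hB, h⟩ := ha.exists_flux_bound hp hp2
  refine ⟨C, B, hC, hB, fun w => ?_⟩
  rw [flux, Lp.norm_toLp]
  exact (h w).2

theorem memLp_clip_flux [IsFiniteMeasure (spaceMeas D)] {R : ℝ} (hR : 0 < R) (w : V p D) :
    MemLp (fun x => clip R (a x (w.fn x) (w.grad x))) q (spaceMeas D) :=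
  MemLp.of_bound ((continuous_clip hR).comp_aestronglyMeasurable (ha.aestronglyMeasurable_flux w))
    R (Eventually.of_forall fun _ => norm_clip_le hR _)

theorem continuous_clip_flux [IsFiniteMeasure (spaceMeas D)] (hp2 : 2 ≤ p)
    {R : ℝ} (hR : 0 < R) :
    Continuous fun w : V p D => (ha.memLp_clip_flux hR w).toLp _ := by
  refine continuous_iff_seqContinuous.2 fun w w₀ hw => ?_
  have hw' := (continuous_subtype_val.tendsto w₀).comp hw
  refine tendsto_of_subseq_ae hw' fun ns hns => ?_
  refine tendsto_toLp_of_dominated (ne_top_of_holderConjugate_of_two_le (q := q) hp2)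
    (fun i => ha.memLp_clip_flux hR (w (ns i))) (ha.memLp_clip_flux hR w₀)
    (memLp_const (R + R)) (fun i => Eventually.of_forall fun x => ?_) ?_
  · exact (norm_sub_le _ _).trans (add_le_add (norm_clip_le hR _) (norm_clip_le hR _))
  · filter_upwards [hns, ha.continuous] with x hx hc
    exact ((continuous_clip hR).tendsto _).comp ((hc.tendsto _).comp hx)

/-- The truncated flux is bounded on a set of finite measure, so it depends continuously on `w` by
dominated convergence with a constant bound. The flux is a pointwise limit of its truncations, so
measurability follows without proving continuity of the full flux. -/
theorem aestronglyMeasurable_flux_comp [IsFiniteMeasure (spaceMeas D)] (hp : p ≠ ∞) (hp2 : 2 ≤ p)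
    {α : Type*} {mα : MeasurableSpace α} {ν : Measure α} {u : α → V p D}
    (hu : AEStronglyMeasurable u ν) : AEStronglyMeasurable (fun t => ha.flux hp hp2 (u t)) ν := by
  have hpos : ∀ n : ℕ, (0 : ℝ) < (n : ℝ) + 1 := fun n => by positivity
  refine aestronglyMeasurable_of_tendsto_ae atTop
    (f := fun n t => (ha.memLp_clip_flux (hpos n) (u t)).toLp _)
    (fun n => (ha.continuous_clip_flux hp2 (hpos n)).comp_aestronglyMeasurable hu)
    (Eventually.of_forall fun t => ?_)
  have hm := ((ha.exists_flux_bound hp hp2).choose_spec.choose_spec.2.2 (u t)).1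
  refine tendsto_toLp_of_dominated (ne_top_of_holderConjugate_of_two_le (q := q) hp2)
    (fun n => ha.memLp_clip_flux (hpos n) (u t)) hm (hm.norm.const_mul 2)
    (fun n => Eventually.of_forall fun x => ?_) (Eventually.of_forall fun x => tendsto_clip _)
  have := norm_clip_le_norm (hpos n) (a x ((u t).fn x) ((u t).grad x))
  refine (norm_sub_le _ _).trans ?_
  linarith

theorem memLp_flux_comp [IsFiniteMeasure (spaceMeas D)] (hp : p ≠ ∞) (hp2 : 2 ≤ p)
    {α : Type*} {mα : MeasurableSpace α} {ν : Measure α} [IsFiniteMeasure ν] {u : α → V p D}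
    (hu : MemLp u p ν) : MemLp (fun t => ha.flux hp hp2 (u t)) q ν := by
  obtain ⟨C, B, hC, hB, h⟩ := ha.exists_norm_flux_le hp hp2
  refine (((memLp_rpow_sub_one (q := q) hp hp2 hu).const_mul C).add (memLp_const B)).of_le
    (ha.aestronglyMeasurable_flux_comp hp hp2 hu.1) (Eventually.of_forall fun t => ?_)
  exact (h (u t)).trans (le_abs_self _)

end IsAdmissible

/-- The functional `ψ ↦ ∫ F · ∇ψ` on `W_0^{1,p}(D)` given by a vector field `F ∈ L^{p'}(D)`. -/
noncomputable def V.divergence : Lp (Euc d) q (spaceMeas D) →L[ℝ] V' p D :=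
  (ContinuousLinearMap.compL ℝ (V p D) (Lp (Euc d) p (spaceMeas D)) ℝ).flip
      ((ContinuousLinearMap.snd ℝ _ _).comp (W01 p D).subtypeL) ∘L
    (innerSL ℝ : Euc d →L[ℝ] Euc d →L[ℝ] ℝ).lpPairing (spaceMeas D) q p

theorem V.divergence_apply (F : Lp (Euc d) q (spaceMeas D)) (ψ : V p D) :
    V.divergence F ψ = ∫ x, inner ℝ (F x) (ψ.grad x) ∂(spaceMeas D) :=
  ContinuousLinearMap.lpPairing_eq_integral _ F ψ.grad

end Flux
end Obstacle

/-! ### Estimates at a fixed time for the difference tested with the approximate sign -/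

namespace Obstacle

theorem integrable_mul_conj {α : Type*} {mα : MeasurableSpace α} {μ : Measure α} {p q : ℝ≥0∞}
    [p.HolderConjugate q] {k l : α → ℝ} (hk : MemLp k q μ) (hl : MemLp l p μ) :
    Integrable (fun x => k x * l x) μ ∧
      ∫ x, k x * l x ∂μ ≤ (eLpNorm k q μ).toReal * (eLpNorm l p μ).toReal := by
  have hG : MemLp (fun x => ContinuousLinearMap.mul ℝ ℝ (k x)) q μ :=
    (ContinuousLinearMap.mul ℝ ℝ).comp_memLp' hk
  have e : eLpNorm (fun x => ContinuousLinearMap.mul ℝ ℝ (k x)) q μ = eLpNorm k q μ :=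
    eLpNorm_congr_norm_ae (Eventually.of_forall fun x => ContinuousLinearMap.opNorm_mul_apply _ _ _)
  obtain ⟨h1, h2⟩ := integrable_pairing hG hl
  rw [e] at h2
  exact ⟨h1, (integral_mono h1 h1.norm fun x => le_abs_self _).trans h2⟩

theorem integrable_inner_conj {n : ℕ} {p q : ℝ≥0∞} [p.HolderConjugate q]
    {μ : Measure (Euc n)} (F : Lp (Euc n) q μ)
    (w : Lp (Euc n) p μ) : Integrable (fun x => (inner ℝ (F x) (w x) : ℝ)) μ := by
  refine (integrable_mul_conj (Lp.memLp F).norm (Lp.memLp w).norm).1.mono'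
    ((Lp.aestronglyMeasurable F).inner (Lp.aestronglyMeasurable w)) (Eventually.of_forall fun x => ?_)
  exact norm_inner_le_norm _ _

theorem conj_le_of_two_le {p q : ℝ≥0∞} [h : p.HolderConjugate q] (hp2 : 2 ≤ p) : q ≤ p := by
  have h1 := h.inv_add_inv_eq_inv
  rw [inv_one] at h1
  have h2 : p⁻¹ ≤ 2⁻¹ := ENNReal.inv_le_inv.2 hp2
  have h3 : 2⁻¹ ≤ q⁻¹ := by
    by_contra hc
    have := ENNReal.add_lt_add_of_le_of_lt (ENNReal.inv_ne_top.2
      (by rintro rfl; simp at hp2)) h2 (not_le.1 hc)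
    rw [h1, ENNReal.inv_two_add_inv_two] at this
    exact lt_irrefl _ this
  exact (ENNReal.inv_le_inv.1 h3).trans hp2

section Static

variable {d : ℕ} {D : Set (Euc d)} {p q : ℝ≥0∞} [Fact (1 ≤ p)] [Fact (1 ≤ q)]
  [p.HolderConjugate q] {a : Euc d → ℝ → Euc d → Euc d}

/-- The superposition operator of the approximate sign. -/
noncomputable def V.sign {δ : ℝ} (hδ : 0 < δ) (hp : p ≠ ∞) (w : V p D) : V p D :=
  V.superpose (isTruncation_signApprox hδ) (contDiff_signApprox hδ) hp w

theorem V.coeFn_sub (u v : V p D) :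
    (u - v).fn =ᵐ[spaceMeas D] fun x => u.fn x - v.fn x := Lp.coeFn_sub u.fn v.fn

theorem V.coeFn_grad_sub (u v : V p D) :
    (u - v).grad =ᵐ[spaceMeas D] fun x => u.grad x - v.grad x := Lp.coeFn_sub u.grad v.grad

/-- The element `u/δ - S_δ(u - v)` is non-negative, `γ` is positive and `γ u = 0`. This is how the
complementarity condition enters. -/
theorem V.apply_sign_sub_nonpos {δ : ℝ} (hδ : 0 < δ) (hp : p ≠ ∞) {u v : V p D}
    (hu : 0 ≤ᵐ[spaceMeas D] u.fn) (hv : 0 ≤ᵐ[spaceMeas D] v.fn) {γ : V' p D}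
    (hγ : ∀ w : V p D, 0 ≤ᵐ[spaceMeas D] w.fn → 0 ≤ γ w) (hγu : γ u = 0) :
    γ (V.sign hδ hp (u - v)) ≤ 0 := by
  have h := hγ (δ⁻¹ • u - V.sign hδ hp (u - v)) ?_
  · rw [map_sub, map_smul, hγu] at h
    simpa using h
  · filter_upwards [V.coeFn_sub (δ⁻¹ • u) (V.sign hδ hp (u - v)), Lp.coeFn_smul δ⁻¹ u.fn,
      V.fn_superpose (isTruncation_signApprox hδ) (contDiff_signApprox hδ) hp (u - v),
      V.coeFn_sub u v, hu, hv] with x h1 h2 h3 h4 h5 h6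
    have h2' : (δ⁻¹ • u).fn x = δ⁻¹ * u.fn x := h2
    have h3' : (V.sign hδ hp (u - v)).fn x = signApprox δ ((u - v).fn x) := h3
    have := signApprox_sub_le hδ h5 h6
    rw [Pi.zero_apply, h1, h2', h3', h4, inv_mul_eq_div]
    exact sub_nonneg.2 this

theorem signApprox_neg (δ s : ℝ) : signApprox δ (-s) = -signApprox δ s := by
  simp [signApprox, neg_div]

theorem V.sign_sub_comm {δ : ℝ} (hδ : 0 < δ) (hp : p ≠ ∞) (u v : V p D) :
    V.sign hδ hp (v - u) = - V.sign hδ hp (u - v) := by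
  have hd : ∀ s, deriv (signApprox δ) (-s) = deriv (signApprox δ) s := fun s => by
    simp [deriv_signApprox hδ]
  have hneg : v - u = -(u - v) := (neg_sub u v).symm
  rw [hneg]
  refine V.ext_ae ?_ ?_
  · filter_upwards [V.fn_superpose (isTruncation_signApprox hδ) (contDiff_signApprox hδ) hp (u - v),
      V.fn_superpose (isTruncation_signApprox hδ) (contDiff_signApprox hδ) hp (-(u - v)),
      Lp.coeFn_neg (u - v).fn, Lp.coeFn_neg (V.sign hδ hp (u - v)).fn] with x h1 h2 h3 h4
    refine h2.trans (Eq.trans ?_ h4.symm)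
    rw [Pi.neg_apply]
    refine Eq.trans ?_ (congrArg Neg.neg h1.symm)
    rw [← signApprox_neg]
    exact congrArg _ h3
  · filter_upwards [V.grad_superpose (isTruncation_signApprox hδ) (contDiff_signApprox hδ) hp
      (u - v), V.grad_superpose (isTruncation_signApprox hδ) (contDiff_signApprox hδ) hp (-(u - v)),
      Lp.coeFn_neg (u - v).fn, Lp.coeFn_neg (u - v).grad,
      Lp.coeFn_neg (V.sign hδ hp (u - v)).grad] with x h1 h2 h3 h5 h4
    refine h2.trans (Eq.trans ?_ h4.symm)
    rw [Pi.neg_apply]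
    refine Eq.trans ?_ (congrArg Neg.neg h1.symm)
    have h3' : (-(u - v)).fn x = -((u - v).fn x) := h3
    have h5' : (-(u - v)).grad x = -((u - v).grad x) := h5
    rw [h3', h5', hd, smul_neg]

/-- The error term coming from the dependence of the flux on the solution itself. -/
noncomputable def fluxError (k : V p D → Euc d → ℝ) (δ : ℝ) (u v : V p D) : ℝ :=
  ∫ x, k v x * ‖(u - v).grad x‖ * (|(u - v).fn x| * deriv (signApprox δ) ((u - v).fn x))
    ∂(spaceMeas D)

/-- Used with `A = a(x,u,∇u)`, `B = a(x,u,∇v)` and `C = a(x,v,∇v)`. The step from `A` to `B` is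
monotone, and the step from `B` to `C` only changes the second argument of `a`. -/
theorem neg_inner_smul_le {E : Type*} [NormedAddCommGroup E] [InnerProductSpace ℝ E]
    {H k : ℝ} (hH : 0 ≤ H) {A B C g : E} (h1 : (0 : ℝ) ≤ inner ℝ (A - B) g) (h2 : ‖B - C‖ ≤ k) :
    -inner ℝ (A - C) (H • g) ≤ k * ‖g‖ * H := by
  have e : (inner ℝ (A - C) g : ℝ) = inner ℝ (A - B) g + inner ℝ (B - C) g := by
    rw [← inner_add_left, sub_add_sub_cancel]
  have m : -inner ℝ (B - C) g ≤ k * ‖g‖ := (neg_le_abs _).trans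
    ((abs_real_inner_le_norm _ _).trans (mul_le_mul_of_nonneg_right h2 (norm_nonneg _)))
  rw [inner_smul_right, e, ← mul_neg, mul_comm]
  exact mul_le_mul_of_nonneg_right (by linarith) hH

theorem IsAdmissible.neg_divergence_flux_sub_le (ha : IsAdmissible p q D a) (hp : p ≠ ∞)
    (hp2 : 2 ≤ p) {C₄ : ℝ} {h : Euc d → ℝ}
    (hle : ∀ᵐ x ∂(spaceMeas D), ∀ (l₁ l₂ : ℝ) (ξ : Euc d),
      ‖a x l₁ ξ - a x l₂ ξ‖ ≤ (C₄ * ‖ξ‖ ^ (p.toReal - 1) + h x) * |l₁ - l₂|)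
    {δ : ℝ} (hδ : 0 < δ) (u v : V p D)
    (hint : Integrable (fun x => (C₄ * ‖v.grad x‖ ^ (p.toReal - 1) + h x) * ‖(u - v).grad x‖ *
      (|(u - v).fn x| * deriv (signApprox δ) ((u - v).fn x))) (spaceMeas D)) :
    - V.divergence (ha.flux hp hp2 u - ha.flux hp hp2 v) (V.sign hδ hp (u - v)) ≤
      fluxError (fun v x => C₄ * ‖v.grad x‖ ^ (p.toReal - 1) + h x) δ u v := by
  rw [V.divergence_apply, ← integral_neg]
  refine integral_mono_ae (integrable_inner_conj _ _).neg hint ?_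
  filter_upwards [Lp.coeFn_sub (ha.flux hp hp2 u) (ha.flux hp hp2 v), ha.coeFn_flux hp hp2 u,
    ha.coeFn_flux hp hp2 v, V.grad_superpose (isTruncation_signApprox hδ)
    (contDiff_signApprox hδ) hp (u - v), V.coeFn_sub u v, V.coeFn_grad_sub u v, hle, ha.monotone]
    with x h1 h2 h3 h4 h5 h6 h7 h8
  have h4' : (V.sign hδ hp (u - v)).grad x =
    deriv (signApprox δ) ((u - v).fn x) • (u - v).grad x := h4
  rw [h1, Pi.sub_apply, h2, h3, h4']
  have m1 := h8 (u.fn x) (u.grad x) (v.grad x)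
  have m2 := h7 (u.fn x) (v.fn x) (v.grad x)
  rw [← h6] at m1
  rw [← h5] at m2
  refine (neg_inner_smul_le (deriv_signApprox_nonneg hδ _) m1 m2).trans (le_of_eq ?_)
  ring

/-- The weight `k v = C₄ |∇v|^{p-1} + h` is in `L^{p'}` and `|∇(u - v)|` is in `L^p`, so their
product is an integrable majorant independent of `δ`. It gives both a bound that can be integrated
in time and, since `|s| S_δ'(s) → 0`, convergence of the error to `0`. -/
theorem IsAdmissible.exists_fluxError (ha : IsAdmissible p q D a) (hp : p ≠ ∞) (hp2 : 2 ≤ p) :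
    ∃ (k : V p D → Euc d → ℝ) (C B : ℝ), 0 ≤ C ∧ 0 ≤ B ∧
      (∀ (δ : ℝ) (hδ : 0 < δ) (u v : V p D),
        - V.divergence (ha.flux hp hp2 u - ha.flux hp hp2 v) (V.sign hδ hp (u - v)) ≤
          fluxError k δ u v) ∧
      (∀ (δ : ℝ) (_ : 0 < δ) (u v : V p D),
        fluxError k δ u v ≤ (C * ‖v‖ ^ (p.toReal - 1) + B) * ‖u - v‖) ∧
      ∀ (δ : ℕ → ℝ) (_ : ∀ n, 0 < δ n) (_ : Tendsto δ atTop (𝓝 0)) (u v : V p D),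
        Tendsto (fun n => fluxError k (δ n) u v) atTop (𝓝 0) := by
  obtain ⟨C₄, h, hC₄, hh, hh0, hle⟩ := ha.lipschitz
  let k : V p D → Euc d → ℝ := fun v x => C₄ * ‖v.grad x‖ ^ (p.toReal - 1) + h x
  have hk0 : ∀ v x, 0 ≤ k v x := fun v x => add_nonneg (by positivity) (hh0 x)
  have hk1 : ∀ v : V p D, MemLp (fun x => C₄ * ‖v.grad x‖ ^ (p.toReal - 1)) q (spaceMeas D) :=
    fun v => (memLp_rpow_sub_one (q := q) hp hp2 (Lp.memLp v.grad)).const_mul C₄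
  have hk : ∀ v, MemLp (k v) q (spaceMeas D) := fun v => (hk1 v).add hh
  have hkl := fun (u v : V p D) => integrable_mul_conj (hk v) (Lp.memLp (u - v).grad).norm
  have hmeas : ∀ {δ : ℝ} (_ : 0 < δ) (u v : V p D), AEStronglyMeasurable (fun x =>
      k v x * ‖(u - v).grad x‖ * (|(u - v).fn x| * deriv (signApprox δ) ((u - v).fn x)))
      (spaceMeas D) := by
    intro δ hδ u v
    have hc : Continuous fun s => |s| * deriv (signApprox δ) s :=
      continuous_abs.mul (isTruncation_signApprox hδ).continuous_deriv
    exact (hkl u v).1.1.mul (hc.comp_aestronglyMeasurable (Lp.aestronglyMeasurable (u - v).fn))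
  have hb0 : ∀ {δ : ℝ} (_ : 0 < δ) (s : ℝ), 0 ≤ |s| * deriv (signApprox δ) s := fun hδ s =>
    mul_nonneg (abs_nonneg _) (deriv_signApprox_nonneg hδ s)
  have hbd : ∀ {δ : ℝ} (_ : 0 < δ) (u v : V p D) (x : Euc d),
      k v x * ‖(u - v).grad x‖ * (|(u - v).fn x| * deriv (signApprox δ) ((u - v).fn x)) ≤
        k v x * ‖(u - v).grad x‖ := fun hδ u v x =>
    mul_le_of_le_one_right (mul_nonneg (hk0 v x) (norm_nonneg _))
      (abs_mul_deriv_signApprox_le_one hδ _)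
  have hnn : ∀ {δ : ℝ} (_ : 0 < δ) (u v : V p D) (x : Euc d),
      0 ≤ k v x * ‖(u - v).grad x‖ * (|(u - v).fn x| * deriv (signApprox δ) ((u - v).fn x)) :=
    fun hδ u v x => mul_nonneg (mul_nonneg (hk0 v x) (norm_nonneg _)) (hb0 hδ _)
  have hint : ∀ {δ : ℝ} (_ : 0 < δ) (u v : V p D), Integrable (fun x =>
      k v x * ‖(u - v).grad x‖ * (|(u - v).fn x| * deriv (signApprox δ) ((u - v).fn x)))
      (spaceMeas D) := fun hδ u v =>
    (hkl u v).1.mono' (hmeas hδ u v) (Eventually.of_forall fun x => by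
      rw [Real.norm_of_nonneg (hnn hδ u v x)]
      exact hbd hδ u v x)
  refine ⟨k, C₄, (eLpNorm h q (spaceMeas D)).toReal, hC₄, ENNReal.toReal_nonneg, ?_, ?_, ?_⟩
  · intro δ hδ u v
    exact ha.neg_divergence_flux_sub_le hp hp2 hle hδ u v (hint hδ u v)
  · intro δ hδ u v
    refine (integral_mono (hint hδ u v) (hkl u v).1 (hbd hδ u v)).trans ((hkl u v).2.trans ?_)
    rw [eLpNorm_norm]
    have n1 : (eLpNorm v.grad p (spaceMeas D)).toReal ≤ ‖v‖ :=
      norm_snd_le (v : Lp ℝ p (spaceMeas D) × Lp (Euc d) p (spaceMeas D))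
    have n2 : (eLpNorm (u - v).grad p (spaceMeas D)).toReal ≤ ‖u - v‖ :=
      norm_snd_le ((u - v : V p D) : Lp ℝ p (spaceMeas D) × Lp (Euc d) p (spaceMeas D))
    have t := ENNReal.toReal_mono (ENNReal.add_ne_top.2 ⟨(hk1 v).2.ne, hh.2.ne⟩)
      (eLpNorm_add_le (hk1 v).1 hh.1 (Fact.out : 1 ≤ q))
    rw [ENNReal.toReal_add (hk1 v).2.ne hh.2.ne,
      toReal_eLpNorm_const_mul_rpow_sub_one hp hp2 hC₄] at t
    have hr := toReal_sub_one_pos hp hp2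
    refine mul_le_mul (t.trans ?_) n2 ENNReal.toReal_nonneg (by positivity)
    gcongr
  · intro δ hδ hlim u v
    have : Tendsto (fun n => fluxError k (δ n) u v) atTop (𝓝 (∫ _, (0 : ℝ) ∂(spaceMeas D))) := by
      refine tendsto_integral_of_dominated_convergence _ (fun n => hmeas (hδ n) u v) (hkl u v).1
        (fun n => Eventually.of_forall fun x => ?_) (Eventually.of_forall fun x => ?_)
      · rw [Real.norm_of_nonneg (hnn (hδ n) u v x)]
        exact hbd (hδ n) u v x
      · simpa using (tendsto_abs_mul_deriv_signApprox ((u - v).fn x) hlim hδ).const_mul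
          (k v x * ‖(u - v).grad x‖)
    simpa using this

/-! #### The lower order term and integral functionals on `L²(D)` -/

variable [IsFiniteMeasure (spaceMeas D)]

/-- `L²(D)` as a subspace of `W^{-1,p'}(D)`. -/
noncomputable def V.ofL2 (hp2 : 2 ≤ p) : L2 D →L[ℝ] V' p D :=
  (ContinuousLinearMap.compL ℝ (V p D) (L2 D) ℝ).flip (V.toL2 hp2) ∘L innerSL ℝ

omit [Fact (1 ≤ q)] [p.HolderConjugate q] in
theorem V.ofL2_apply (hp2 : 2 ≤ p) (x : L2 D) (w : V p D) :
    V.ofL2 hp2 x w = inner ℝ x (V.toL2 hp2 w) := rfl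

/-- Integration over `D` as a functional on `L²(D)`. -/
noncomputable def integralL2 : L2 D →L[ℝ] ℝ :=
  (ContinuousLinearMap.mul ℝ ℝ).lpPairing (spaceMeas D) 2 2 ((memLp_const (1 : ℝ)).toLp _)

theorem integralL2_apply (x : L2 D) : integralL2 x = ∫ y, x y ∂(spaceMeas D) := by
  rw [integralL2, ContinuousLinearMap.lpPairing_eq_integral]
  refine integral_congr_ae ?_
  filter_upwards [(memLp_const (μ := spaceMeas D) (p := 2) (1 : ℝ)).coeFn_toLp] with y hy
  rw [hy]; simp

/-- The `L¹` norm on `L²(D)`. -/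
noncomputable def normL1 (x : L2 D) : ℝ := ∫ y, |x y| ∂(spaceMeas D)

theorem lipschitzWith_abs : LipschitzWith 1 (fun s : ℝ => |s|) :=
  LipschitzWith.of_dist_le_mul fun x y => by
    rw [NNReal.coe_one, one_mul]; exact abs_abs_sub_abs_le x y

theorem integralL2_compLp {K : ℝ≥0} {H : ℝ → ℝ} (hH : LipschitzWith K H) (h0 : H 0 = 0) (x : L2 D) :
    integralL2 (hH.compLp h0 x) = ∫ y, H (x y) ∂(spaceMeas D) := by
  rw [integralL2_apply]
  exact integral_congr_ae (hH.coeFn_compLp h0 x)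

theorem continuous_integral_comp {K : ℝ≥0} {H : ℝ → ℝ} (hH : LipschitzWith K H) (h0 : H 0 = 0) :
    Continuous fun x : L2 D => ∫ y, H (x y) ∂(spaceMeas D) :=
  (integralL2.continuous.comp (hH.continuous_compLp h0)).congr (integralL2_compLp hH h0)

theorem memLp_integral_comp {α : Type*} {mα : MeasurableSpace α} {ν : Measure α} {r : ℝ≥0∞}
    {K : ℝ≥0} {H : ℝ → ℝ} (hH : LipschitzWith K H) (h0 : H 0 = 0) {z : α → L2 D}
    (hz : MemLp z r ν) : MemLp (fun t => ∫ y, H (z t y) ∂(spaceMeas D)) r ν := by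
  have h1 : MemLp (fun t => hH.compLp h0 (z t)) r ν :=
    (hH.lipschitzWith_compLp h0).comp_memLp (hH.compLp_zero h0) hz
  have h2 := integralL2.comp_memLp' h1
  exact h2.congr_norm ((continuous_integral_comp hH h0).comp_aestronglyMeasurable hz.1)
    (Eventually.of_forall fun t => congrArg norm (integralL2_compLp hH h0 (z t)))

theorem continuous_normL1 : Continuous (normL1 : L2 D → ℝ) :=
  continuous_integral_comp lipschitzWith_abs abs_zero

theorem integrable_L2 (x : L2 D) : Integrable x (spaceMeas D) :=
  (Lp.memLp x).integrable one_le_two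

theorem integrable_comp_L2 {K : ℝ≥0} {H : ℝ → ℝ} (hH : LipschitzWith K H) (h0 : H 0 = 0)
    (x : L2 D) : Integrable (fun y => H (x y)) (spaceMeas D) :=
  (integrable_L2 (hH.compLp h0 x)).congr (hH.coeFn_compLp h0 x)

theorem ofReal_normL1 (x : L2 D) : ENNReal.ofReal (normL1 x) = eLpNorm x 1 (spaceMeas D) := by
  rw [eLpNorm_one_eq_lintegral_enorm, ← ofReal_integral_norm_eq_lintegral_enorm (integrable_L2 x)]
  rfl

omit [Fact (1 ≤ q)] [p.HolderConjugate q] in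
theorem neg_inner_compLp_sub_le {f : ℝ → ℝ} {L : ℝ≥0} (hf : LipschitzWith L f) (hf0 : f 0 = 0)
    (hp : p ≠ ∞) (hp2 : 2 ≤ p) {δ : ℝ} (hδ : 0 < δ) (u v : V p D) :
    - V.ofL2 hp2 (hf.compLp hf0 (V.toL2 hp2 u) - hf.compLp hf0 (V.toL2 hp2 v))
      (V.sign hδ hp (u - v)) ≤ L * normL1 (V.toL2 hp2 (u - v)) := by
  rw [V.ofL2_apply, L2.inner_def, ← integral_neg, normL1, ← integral_const_mul]
  refine integral_mono_ae (L2.integrable_inner _ _).neg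
    ((integrable_L2 _).abs.const_mul _) ?_
  filter_upwards [Lp.coeFn_sub (hf.compLp hf0 (V.toL2 hp2 u)) (hf.compLp hf0 (V.toL2 hp2 v)),
    hf.coeFn_compLp hf0 (V.toL2 hp2 u), hf.coeFn_compLp hf0 (V.toL2 hp2 v),
    V.coeFn_toL2 hp2 (V.sign hδ hp (u - v)),
    V.fn_superpose (isTruncation_signApprox hδ) (contDiff_signApprox hδ) hp (u - v),
    Lp.coeFn_sub (V.toL2 hp2 u) (V.toL2 hp2 v)] with x h1 h2 h3 h4 h5 h6
  have h5' : (V.sign hδ hp (u - v)).fn x = signApprox δ ((u - v).fn x) := h5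
  rw [map_sub, h1, h6, Pi.sub_apply, Pi.sub_apply, h2, h3, h4, h5']
  simp only [Function.comp_apply]
  refine (neg_le_abs _).trans ?_
  rw [← Real.norm_eq_abs]
  refine (norm_inner_le_norm _ _).trans ?_
  have b1 := hf.dist_le_mul (V.toL2 hp2 u x) (V.toL2 hp2 v x)
  rw [dist_eq_norm, dist_eq_norm] at b1
  exact (mul_le_of_le_one_right (norm_nonneg _) (abs_signApprox_le_one hδ _)).trans b1

end Static
end Obstacle

/-! ### The equation as an evolution in `W^{-1,p'}(D)` -/

namespace Obstacle

section WeakForm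

variable {d : ℕ} {D : Set (Euc d)} {p q : ℝ≥0∞} [Fact (1 ≤ p)] [Fact (1 ≤ q)]
  [p.HolderConjugate q] {a : Euc d → ℝ → Euc d → Euc d}

theorem IsTest.gradient_const_mul {φ : Euc d → ℝ} (hφ : IsTest D φ) (c : ℝ) (x : Euc d) :
    ∇ (fun y => c * φ y) x = c • ∇ φ x := by
  rw [gradient, gradient, fderiv_const_mul (hφ.smooth.differentiable (by simp) x), map_smul]

theorem IsAdmissible.divergence_flux_ofTest (ha : IsAdmissible p q D a) (hp : p ≠ ∞) (hp2 : 2 ≤ p)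
    {φ : Euc d → ℝ} (hφ : IsTest D φ) (c : ℝ) (w : V p D) :
    ∫ x, inner ℝ (a x (w.fn x) (w.grad x)) (∇ (fun y => c * φ y) x) ∂(spaceMeas D) =
      c * V.divergence (ha.flux hp hp2 w) (V.ofTest hφ : V p D) := by
  rw [V.divergence_apply, ← integral_const_mul]
  refine integral_congr_ae ?_
  filter_upwards [ha.coeFn_flux hp hp2 w, V.grad_ofTest (p := p) hφ] with x h1 h2
  rw [hφ.gradient_const_mul, h1, h2, inner_smul_right]

variable [IsFiniteMeasure (spaceMeas D)]

omit [Fact (1 ≤ q)] [p.HolderConjugate q] in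
theorem V.inner_toL2_ofTest (hp2 : 2 ≤ p) {φ : Euc d → ℝ} (hφ : IsTest D φ) (x : L2 D) :
    inner ℝ x (V.toL2 hp2 (V.ofTest hφ : V p D)) = ∫ y, x y * φ y ∂(spaceMeas D) := by
  rw [L2.inner_def]
  refine integral_congr_ae ?_
  filter_upwards [V.coeFn_toL2 hp2 (V.ofTest hφ : V p D), V.fn_ofTest (p := p) hφ] with y h1 h2
  rw [h1, h2]
  simp [mul_comm]

omit [Fact (1 ≤ q)] [p.HolderConjugate q] in
theorem V.ofL2_compLp_ofTest {f : ℝ → ℝ} {L : ℝ≥0} (hf : LipschitzWith L f) (hf0 : f 0 = 0)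
    (hp2 : 2 ≤ p) {φ : Euc d → ℝ} (hφ : IsTest D φ) (c : ℝ) (w : V p D) :
    ∫ x, f (w.fn x) * (c * φ x) ∂(spaceMeas D) =
      c * V.ofL2 hp2 (hf.compLp hf0 (V.toL2 hp2 w)) (V.ofTest hφ) := by
  rw [V.ofL2_apply, V.inner_toL2_ofTest, ← integral_const_mul]
  refine integral_congr_ae ?_
  filter_upwards [hf.coeFn_compLp hf0 (V.toL2 hp2 w), V.coeFn_toL2 hp2 w] with x h1 h2
  rw [h1, Function.comp_apply, h2]
  ring

omit [Fact (1 ≤ q)] [p.HolderConjugate q] in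
theorem V.integral_sub_mul_ofTest (hp2 : 2 ≤ p) {φ : Euc d → ℝ} (hφ : IsTest D φ) (c : ℝ)
    (w : V p D) (x : L2 D) :
    ∫ y, (w.fn y - x y) * (c * φ y) ∂(spaceMeas D) =
      c * inner ℝ (V.toL2 hp2 w - x) (V.toL2 hp2 (V.ofTest hφ : V p D)) := by
  rw [V.inner_toL2_ofTest, ← integral_const_mul]
  refine integral_congr_ae ?_
  filter_upwards [Lp.coeFn_sub (V.toL2 hp2 w) x, V.coeFn_toL2 hp2 w] with y h1 h2
  rw [h1, Pi.sub_apply, h2]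
  ring

/-- The time derivative `η + div a(·, w, ∇w) - f(w)` at a fixed time. -/
noncomputable def IsAdmissible.drift (ha : IsAdmissible p q D a) (hp : p ≠ ∞) (hp2 : 2 ≤ p)
    {f : ℝ → ℝ} {L : ℝ≥0} (hf : LipschitzWith L f) (hf0 : f 0 = 0) (γ : V' p D) (w : V p D) :
    V' p D :=
  γ - V.divergence (ha.flux hp hp2 w) - V.ofL2 hp2 (hf.compLp hf0 (V.toL2 hp2 w))

variable {f : ℝ → ℝ} {L : ℝ≥0} {T : ℝ}

omit [Fact (1 ≤ q)] in
theorem V.memLp_ofL2_compLp (hf : LipschitzWith L f) (hf0 : f 0 = 0) (hp2 : 2 ≤ p)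
    {α : Type*} {mα : MeasurableSpace α} {ν : Measure α} [IsFiniteMeasure ν] {u : α → V p D}
    (hu : MemLp u p ν) :
    MemLp (fun t => V.ofL2 hp2 (hf.compLp hf0 (V.toL2 hp2 (u t)))) q ν := by
  have h1 : MemLp (fun t => hf.compLp hf0 (V.toL2 hp2 (u t))) p ν :=
    (hf.lipschitzWith_compLp hf0).comp_memLp (hf.compLp_zero hf0)
      ((V.toL2 hp2).comp_memLp' hu)
  exact ((V.ofL2 hp2).comp_memLp' h1).mono_exponent (conj_le_of_two_le hp2)

theorem IsAdmissible.memLp_divergence_flux (ha : IsAdmissible p q D a) (hp : p ≠ ∞) (hp2 : 2 ≤ p)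
    {α : Type*} {mα : MeasurableSpace α} {ν : Measure α} [IsFiniteMeasure ν] {u : α → V p D}
    (hu : MemLp u p ν) :
    MemLp (fun t => (V.divergence (ha.flux hp hp2 (u t)) : V' p D)) q ν :=
  V.divergence.comp_memLp' (ha.memLp_flux_comp hp hp2 hu)

theorem IsAdmissible.memLp_drift (ha : IsAdmissible p q D a) (hp : p ≠ ∞) (hp2 : 2 ≤ p)
    (hf : LipschitzWith L f) (hf0 : f 0 = 0)
    {α : Type*} {mα : MeasurableSpace α} {ν : Measure α} [IsFiniteMeasure ν] {u : α → V p D}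
    (hu : MemLp u p ν) {g : α → V' p D} (hg : MemLp g q ν) :
    MemLp (fun t => ha.drift hp hp2 hf hf0 (g t) (u t)) q ν :=
  (hg.sub (ha.memLp_divergence_flux hp hp2 hu)).sub
    (V.memLp_ofL2_compLp hf hf0 hp2 hu)

omit [Fact (1 ≤ p)] [IsFiniteMeasure (spaceMeas D)] in
theorem IsTest.integrable_mul {θ : ℝ → ℝ} (hθ : IsTest (Ioo 0 T) θ) {γ : ℝ → ℝ}
    (hγ : Integrable γ (timeMeas T)) : Integrable (fun t => θ t * γ t) (timeMeas T) := by
  obtain ⟨M, hM⟩ := hθ.compact.exists_bound_of_continuous hθ.smooth.continuous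
  exact hγ.bdd_mul hθ.smooth.continuous.aestronglyMeasurable (Eventually.of_forall hM)

/-- The weak formulation tested with products `θ(t) φ(x)`. -/
theorem IsAdmissible.weak_form (ha : IsAdmissible p q D a) (hp : p ≠ ∞) (hp2 : 2 ≤ p)
    (hf : LipschitzWith L f) (hf0 : f 0 = 0) {u : LpV p T D} {I : ℝ → L2 D}
    {η : Measure (ℝ × Euc d)} {g : LqV' p q T D} (hg : IsFunctional η g)
    (heq : ∀ φ : ℝ × Euc d → ℝ, IsTest (cyl T D) φ →
      - (∫ t, ∫ x, ((u t).fn x - I t x) *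
          deriv (fun s => φ (s, x)) t ∂(spaceMeas D) ∂(timeMeas T))
      + (∫ t, ∫ x, inner ℝ (a x ((u t).fn x) ((u t).grad x)) (∇ (fun y => φ (t, y)) x)
          ∂(spaceMeas D) ∂(timeMeas T))
      + (∫ t, ∫ x, f ((u t).fn x) * φ (t, x) ∂(spaceMeas D) ∂(timeMeas T))
      = ∫ y, φ y ∂η)
    {θ : ℝ → ℝ} (hθ : IsTest (Ioo 0 T) θ) {φ : Euc d → ℝ} (hφ : IsTest D φ) :
    ∫ t, deriv θ t * inner ℝ (V.toL2 hp2 (u t) - I t) (V.toL2 hp2 (V.ofTest hφ : V p D))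
        ∂(timeMeas T) =
      - ∫ t, θ t * ha.drift hp hp2 hf hf0 (g t) (u t) (V.ofTest hφ) ∂(timeMeas T) := by
  have h := heq _ (isTest_tensor hθ hφ)
  have hd : ∀ t x, deriv (fun s => θ s * φ x) t = deriv θ t * φ x := fun t x =>
    deriv_mul_const_field _
  simp only [hd, V.integral_sub_mul_ofTest hp2 hφ, ha.divergence_flux_ofTest hp hp2 hφ,
    V.ofL2_compLp_ofTest hf hf0 hp2 hφ, ← hg.integral_tensor hθ hφ] at h
  have i1 := hθ.integrable_mul (integrable_apply_const (Lp.memLp g) (V.ofTest hφ))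
  have i2 := hθ.integrable_mul (integrable_apply_const
    (ha.memLp_divergence_flux hp hp2 (Lp.memLp u)) (V.ofTest hφ : V p D))
  have i3 := hθ.integrable_mul (integrable_apply_const
    (V.memLp_ofL2_compLp (q := q) hf hf0 hp2 (Lp.memLp u)) (V.ofTest hφ : V p D))
  have e : ∫ t, θ t * ha.drift hp hp2 hf hf0 (g t) (u t) (V.ofTest hφ) ∂(timeMeas T) =
      ∫ t, θ t * g t (V.ofTest hφ) ∂(timeMeas T)
      - ∫ t, θ t * V.divergence (ha.flux hp hp2 (u t)) (V.ofTest hφ : V p D) ∂(timeMeas T)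
      - ∫ t, θ t * V.ofL2 hp2 (hf.compLp hf0 (V.toL2 hp2 (u t))) (V.ofTest hφ)
        ∂(timeMeas T) := by
    rw [← integral_sub i1 i2]
    refine Eq.trans ?_ (integral_sub (i1.sub i2) i3)
    refine integral_congr_ae (Eventually.of_forall fun t => ?_)
    simp only [IsAdmissible.drift, sub_apply]
    ring
  rw [e]
  linarith

end WeakForm
end Obstacle

/-! ### Gronwall's inequality and the integrated equation -/

namespace Obstacle

theorem le_mul_exp_of_le_add_integral {y : ℝ → ℝ} {T L : ℝ} (hT : 0 < T) (hL : 0 ≤ L)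
    (hc : ContinuousOn y (Icc 0 T)) {c : ℝ} (hc0 : 0 ≤ c)
    (h : ∀ t ∈ Icc 0 T, y t ≤ c + L * ∫ r in (0 : ℝ)..t, y r) :
    ∀ t ∈ Icc 0 T, y t ≤ c * Real.exp (L * T) := by
  -- The constant extension makes `Y` continuous on the whole line, so that `F` is differentiable
  -- everywhere; Gronwall is applied to `F`, which dominates `Y` on `[0, T]`.
  let Y : ℝ → ℝ := IccExtend hT.le ((Icc 0 T).domRestrict y)
  have hY : Continuous Y := (continuousOn_iff_continuous_domRestrict.1 hc).Icc_extend'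
  have hYy : ∀ t ∈ Icc 0 T, Y t = y t := fun t ht => IccExtend_of_mem hT.le _ ht
  let F : ℝ → ℝ := fun t => c + L * ∫ r in (0 : ℝ)..t, Y r
  have hF : ∀ t, HasDerivAt F (L * Y t) t := fun t =>
    ((hY.integral_hasStrictDerivAt 0 t).hasDerivAt.const_mul L).const_add c
  have hyF : ∀ t ∈ Icc 0 T, Y t ≤ F t := by
    intro t ht
    rw [hYy t ht]
    refine (h t ht).trans (le_of_eq ?_)
    simp only [F]
    congr 2
    refine intervalIntegral.integral_congr fun r hr => ?_
    rw [uIcc_of_le ht.1] at hr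
    exact (hYy r ⟨hr.1, hr.2.trans ht.2⟩).symm
  have g := le_gronwallBound_of_liminf_deriv_right_le (f := F) (f' := fun t => L * Y t)
    (δ := c) (K := L) (ε := 0) (a := 0) (b := T)
    (fun t _ => (hF t).continuousAt.continuousWithinAt)
    (fun t _ r hr => (hF t).hasDerivWithinAt.liminf_right_slope_le hr)
    (by simp [F])
    (fun t ht => by
      rw [add_zero]
      exact mul_le_mul_of_nonneg_left (hyF t (Ico_subset_Icc_self ht)) hL)
  intro t ht
  have g' := g t ht
  rw [gronwallBound_ε0, sub_zero] at g'
  rw [← hYy t ht]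
  refine (hyF t ht).trans (g'.trans ?_)
  gcongr
  exact ht.2

section Identity

variable {d : ℕ} {D : Set (Euc d)} {p q : ℝ≥0∞} [Fact (1 ≤ p)] [Fact (1 ≤ q)]
  [p.HolderConjugate q] [IsFiniteMeasure (spaceMeas D)] {T : ℝ}

omit [p.HolderConjugate q] in
-- For a fixed test function this is the scalar fundamental lemma, valid at every time by
-- right-continuity. Both sides are continuous in `ψ`, since `∫ G` is itself an element of the dual,
-- so density gives all `ψ`.
theorem inner_sub_eq_integral_of_weak (hp2 : 2 ≤ p) {w : ℝ → V p D} {G : ℝ → V' p D}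
    (hw : MemLp w p (timeMeas T)) (hG : MemLp G q (timeMeas T))
    (hweak : ∀ (θ : ℝ → ℝ) (φ : Euc d → ℝ) (_ : IsTest (Ioo 0 T) θ) (hφ : IsTest D φ),
      ∫ t, deriv θ t * inner ℝ (V.toL2 hp2 (w t)) (V.toL2 hp2 (V.ofTest hφ : V p D))
        ∂(timeMeas T) = - ∫ t, θ t * G t (V.ofTest hφ) ∂(timeMeas T))
    {z : ℝ → L2 D} (hz : ∀ t ∈ Ico 0 T, ContinuousWithinAt z (Ici t) t)
    (hzw : ∀ᵐ t ∂(timeMeas T), z t = V.toL2 hp2 (w t))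
    {s t : ℝ} (hs : 0 ≤ s) (hst : s ≤ t) (ht : t < T) (ψ : V p D) :
    inner ℝ (z t - z s) (V.toL2 hp2 ψ) = ∫ r in s..t, G r ψ := by
  have hsub : Ioc s t ⊆ Ioo 0 T := fun r hr => ⟨hs.trans_lt hr.1, hr.2.trans_lt ht⟩
  have hGi : IntegrableOn G (Ioc s t) :=
    (show IntegrableOn G (Ioo 0 T) volume from hG.integrable Fact.out).mono_set hsub
  have happ : ∀ ψ : V p D, ∫ r in s..t, G r ψ = (∫ r in s..t, G r) ψ := fun ψ => by
    rw [intervalIntegral.integral_of_le hst, intervalIntegral.integral_of_le hst,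
      ContinuousLinearMap.integral_apply hGi]
  refine V.induction_closed (P := fun ψ : V p D =>
    inner ℝ (z t - z s) (V.toL2 hp2 ψ) = ∫ r in s..t, G r ψ) ?_ ?_ ψ
  · simp only [happ]
    exact isClosed_eq (continuous_const.inner (V.toL2 hp2).continuous)
      (ContinuousLinearMap.continuous _)
  · intro φ hφ
    let ψ : V p D := V.ofTest hφ
    let Λ : L2 D →L[ℝ] ℝ := innerSL ℝ (V.toL2 hp2 ψ)
    have hΛ : ∀ x, Λ x = inner ℝ x (V.toL2 hp2 ψ) := fun x => by
      rw [innerSL_apply_apply, real_inner_comm]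
    have hmw : (fun r => Λ (z r)) =ᵐ[timeMeas T] fun r => Λ (V.toL2 hp2 (w r)) := by
      filter_upwards [hzw] with r hr
      rw [hr]
    have hi : Integrable (fun r => Λ (V.toL2 hp2 (w r))) (timeMeas T) :=
      (Λ.comp (V.toL2 hp2)).integrable_comp (hw.integrable Fact.out)
    have h := eq_integral_of_weak_deriv (m := fun r => Λ (z r)) (γ := fun r => G r ψ)
      (fun r hr => Λ.continuous.continuousAt.comp_continuousWithinAt (hz r hr))
      (hi.congr hmw.symm) (integrable_apply_const hG ψ) (fun θ hθ => ?_) hs hst ht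
    · rw [← h, hΛ, hΛ, inner_sub_left]
    · rw [← hweak θ φ hθ hφ]
      refine integral_congr_ae ?_
      filter_upwards [hmw] with r hr
      simp only [hr, hΛ]
      rfl

end Identity
end Obstacle

/-! ### The `L¹` estimate and the continuous extension for the difference -/

namespace Obstacle

section Contraction

variable {d : ℕ} {D : Set (Euc d)} {p q : ℝ≥0∞} [Fact (1 ≤ p)] [Fact (1 ≤ q)]
  [p.HolderConjugate q] {a : Euc d → ℝ → Euc d → Euc d} [IsFiniteMeasure (spaceMeas D)] {T : ℝ}
  {f : ℝ → ℝ} {L : ℝ≥0}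

omit [Fact (1 ≤ q)] [p.HolderConjugate q] in
-- The tangent line inequality integrated over `D`; it is the subgradient hypothesis of
-- `energy_inequality` with `N = S_δ`.
theorem V.integral_absApprox_sub_le [p.HolderConjugate q] {δ : ℝ} (hδ : 0 < δ) (hp : p ≠ ∞)
    (hp2 : 2 ≤ p) (x : V p D) (b : L2 D) :
    ∫ y, absApprox δ (V.toL2 hp2 x y) ∂(spaceMeas D) - ∫ y, absApprox δ (b y) ∂(spaceMeas D) ≤
      inner ℝ (V.toL2 hp2 x - b) (V.toL2 hp2 (V.sign hδ hp x)) := by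
  have hT := isTruncation_absApprox hδ
  have i1 := integrable_comp_L2 hT.lipschitz hT.zero (V.toL2 hp2 x)
  have i2 := integrable_comp_L2 hT.lipschitz hT.zero b
  rw [← integral_sub i1 i2, L2.inner_def]
  refine integral_mono_ae (i1.sub i2) (L2.integrable_inner _ _) ?_
  filter_upwards [Lp.coeFn_sub (V.toL2 hp2 x) b, V.coeFn_toL2 hp2 x,
    V.coeFn_toL2 hp2 (V.sign hδ hp x),
    V.fn_superpose (isTruncation_signApprox hδ) (contDiff_signApprox hδ) hp x] with y h1 h2 h3 h4
  have h4' : (V.sign hδ hp x).fn y = signApprox δ (x.fn y) := h4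
  rw [h1, h3, h4', Pi.sub_apply, h2]
  exact (absApprox_sub_le hδ _ _).trans (le_of_eq (by simp))

theorem integral_absApprox_le_normL1 {δ : ℝ} (hδ : 0 < δ) (x : L2 D) :
    ∫ y, absApprox δ (x y) ∂(spaceMeas D) ≤ normL1 x :=
  integral_mono (integrable_comp_L2 (isTruncation_absApprox hδ).lipschitz
    (isTruncation_absApprox hδ).zero x) (integrable_L2 x).abs fun _ => absApprox_le_abs hδ _

theorem normL1_sub_le_integral_absApprox {δ : ℝ} (hδ : 0 < δ) (x : L2 D) :
    normL1 x - δ * (spaceMeas D).real univ ≤ ∫ y, absApprox δ (x y) ∂(spaceMeas D) := by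
  have h := integral_mono ((integrable_L2 x).abs.sub (integrable_const δ))
    (integrable_comp_L2 (isTruncation_absApprox hδ).lipschitz (isTruncation_absApprox hδ).zero x)
    fun y => abs_sub_le_absApprox (δ := δ) (x y)
  have e : ∫ y, (|x y| - δ) ∂(spaceMeas D) =
      normL1 x - δ * (spaceMeas D).real univ := by
    refine (integral_sub (integrable_L2 x).abs (integrable_const δ)).trans ?_
    rw [integral_const, smul_eq_mul, mul_comm]
    rfl
  exact e.symm.le.trans h

theorem IsAdmissible.drift_sub_apply_sign_le (ha : IsAdmissible p q D a) (hp : p ≠ ∞) (hp2 : 2 ≤ p)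
    (hf : LipschitzWith L f) (hf0 : f 0 = 0) {δ : ℝ} (hδ : 0 < δ) {u v : V p D} {e : ℝ}
    (he : - V.divergence (ha.flux hp hp2 u - ha.flux hp hp2 v) (V.sign hδ hp (u - v)) ≤ e)
    (hu : 0 ≤ᵐ[spaceMeas D] u.fn) (hv : 0 ≤ᵐ[spaceMeas D] v.fn) {γ γ' : V' p D}
    (hγ : ∀ w : V p D, 0 ≤ᵐ[spaceMeas D] w.fn → 0 ≤ γ w) (hγu : γ u = 0)
    (hγ' : ∀ w : V p D, 0 ≤ᵐ[spaceMeas D] w.fn → 0 ≤ γ' w) (hγv : γ' v = 0) :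
    (ha.drift hp hp2 hf hf0 γ u - ha.drift hp hp2 hf hf0 γ' v) (V.sign hδ hp (u - v)) ≤
      e + L * normL1 (V.toL2 hp2 (u - v)) := by
  have h1 := V.apply_sign_sub_nonpos hδ hp hu hv hγ hγu
  have h2 := V.apply_sign_sub_nonpos hδ hp hv hu hγ' hγv
  rw [V.sign_sub_comm, map_neg] at h2
  have h3 := neg_inner_compLp_sub_le hf hf0 hp hp2 hδ u v
  rw [map_sub, sub_apply] at he h3
  simp only [IsAdmissible.drift, sub_apply]
  linarith

/-- The energy inequality for `∫ A_δ(z)`, followed by `δ → 0`: `A_δ` differs from the absolute value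
by at most `δ`, `D` has finite measure, and the errors `E n` disappear in the limit. -/
theorem normL1_le_add_integral (hp : p ≠ ∞) (hp2 : 2 ≤ p) {w : ℝ → V p D} {G : ℝ → V' p D}
    (hw : MemLp w p (timeMeas T)) (hG : MemLp G q (timeMeas T))
    {z : ℝ → L2 D} (hz : ∀ t ∈ Ico 0 T, ContinuousWithinAt z (Ici t) t)
    (hzw : ∀ᵐ t ∂(timeMeas T), z t = V.toL2 hp2 (w t))
    (heq : ∀ s t, 0 ≤ s → s ≤ t → t < T → ∀ ψ : V p D,
      inner ℝ (z t - z s) (V.toL2 hp2 ψ) = ∫ r in s..t, G r ψ)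
    {δ : ℕ → ℝ} (hδ : ∀ n, 0 < δ n) (hlim : Tendsto δ atTop (𝓝 0)) {E : ℕ → ℝ → ℝ} {B : ℝ → ℝ}
    (hGE : ∀ᵐ t ∂(timeMeas T), ∀ n, G t (V.sign (hδ n) hp (w t)) ≤
      E n t + L * normL1 (V.toL2 hp2 (w t)))
    (hB : Integrable B (timeMeas T)) (hEB : ∀ n t, E n t ≤ B t)
    (hE : ∀ t, Tendsto (fun n => E n t) atTop (𝓝 0)) {t : ℝ} (ht : t ∈ Ico 0 T) :
    normL1 (z t) ≤ normL1 (z 0) + L * ∫ r in (0 : ℝ)..t, normL1 (z r) := by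
  have hq := ne_top_of_holderConjugate_of_two_le (p := p) (q := q) hp2
  have hsub : ∀ {s t : ℝ}, 0 ≤ s → t < T → Ioc s t ⊆ Ioo 0 T := fun hs ht r hr =>
    ⟨hs.trans_lt hr.1, hr.2.trans_lt ht⟩
  -- Translations need functions on the whole line; extension by zero changes nothing inside `(0,
  -- T)`.
  let w' : ℝ → V p D := (Ioo 0 T).indicator w
  let G' : ℝ → V' p D := (Ioo 0 T).indicator G
  have hw' : MemLp w' p volume := (memLp_indicator_iff_restrict measurableSet_Ioo).2 hw
  have hG' : MemLp G' q volume := (memLp_indicator_iff_restrict measurableSet_Ioo).2 hG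
  have hind : ∀ {r}, r ∈ Ioo 0 T → w' r = w r ∧ G' r = G r := fun hr =>
    ⟨indicator_of_mem hr _, indicator_of_mem hr _⟩
  have hzw' : ∀ᵐ r : ℝ, r ∈ Ioo 0 T → z r = V.toL2 hp2 (w' r) := by
    filter_upwards [(ae_restrict_iff' measurableSet_Ioo).1 hzw] with r h hr
    rw [h hr, (hind hr).1]
  have heq' : ∀ s t, 0 ≤ s → s ≤ t → t < T → ∀ ψ : V p D,
      inner ℝ (z t - z s) (V.toL2 hp2 ψ) = ∫ r in s..t, G' r ψ := by
    intro s t hs hst ht ψ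
    rw [heq s t hs hst ht, intervalIntegral.integral_of_le hst,
      intervalIntegral.integral_of_le hst]
    refine setIntegral_congr_fun measurableSet_Ioc fun r hr => ?_
    simp only [(hind (hsub hs ht hr)).2]
  have hsm : ∀ n, MemLp (fun r => V.sign (hδ n) hp (w r)) p (timeMeas T) := fun n =>
    MemLp.of_le_mul hw ((V.continuous_superpose _ _ hp).comp_aestronglyMeasurable hw.1)
      (Eventually.of_forall fun r => V.norm_superpose_le _ _ hp _)
  have hsm' : ∀ n, MemLp (fun r => V.sign (hδ n) hp (w' r)) p volume := fun n =>
    MemLp.of_le_mul hw' ((V.continuous_superpose _ _ hp).comp_aestronglyMeasurable hw'.1)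
      (Eventually.of_forall fun r => V.norm_superpose_le _ _ hp _)
  have hzm : MemLp z p (timeMeas T) :=
    MemLp.ae_eq (Filter.EventuallyEq.symm hzw) ((V.toL2 hp2).comp_memLp' hw)
  let μ : Measure ℝ := volume.restrict (Ioc 0 t)
  have hμ : μ ≤ timeMeas T := Measure.restrict_mono (hsub le_rfl ht.2) le_rfl
  have hN : Integrable (fun r => normL1 (V.toL2 hp2 (w r))) (timeMeas T) :=
    (memLp_integral_comp lipschitzWith_abs abs_zero ((V.toL2 hp2).comp_memLp' hw)).integrable
      Fact.out
  have hS : ∀ n, Integrable (fun r => G r (V.sign (hδ n) hp (w r))) (timeMeas T) := fun n =>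
    (integrable_pairing hG (hsm n)).1
  -- Measurability of `E n` in time is not assumed. The positive part of the excess is measurable,
  -- bounded by `max 0 (E n)`, and takes the place of `E n` under the integral.
  let F : ℕ → ℝ → ℝ := fun n r =>
    max 0 (G r (V.sign (hδ n) hp (w r)) - L * normL1 (V.toL2 hp2 (w r)))
  have hFi : ∀ n, Integrable (F n) (timeMeas T) := fun n =>
    (integrable_zero _ _ _).sup ((hS n).sub (hN.const_mul _))
  have hFE : ∀ᵐ r ∂(timeMeas T), ∀ n, F n r ≤ max 0 (E n r) := by
    filter_upwards [hGE] with r hr n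
    exact max_le_max le_rfl (sub_le_iff_le_add.2 (hr n))
  have hF0 : ∀ n r, 0 ≤ F n r := fun n r => le_max_left _ _
  have hFlim : Tendsto (fun n => ∫ r, F n r ∂μ) atTop (𝓝 0) := by
    have : Tendsto (fun n => ∫ r, F n r ∂μ) atTop (𝓝 (∫ _, (0 : ℝ) ∂μ)) := by
      refine tendsto_integral_of_dominated_convergence (fun r => |B r|)
        (fun n => ((hFi n).mono_measure hμ).1) (hB.abs.mono_measure hμ) (fun n => ?_) ?_
      · filter_upwards [ae_mono hμ hFE] with r hr
        rw [Real.norm_of_nonneg (hF0 n r)]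
        exact (hr n).trans (max_le (abs_nonneg _) ((hEB n r).trans (le_abs_self _)))
      · filter_upwards [ae_mono hμ hFE] with r hr
        refine squeeze_zero (fun n => hF0 n r) hr ?_
        simpa using (tendsto_const_nhds (x := (0 : ℝ))).max (hE r)
    simpa using this
  have key : ∀ n, normL1 (z t) - δ n * (spaceMeas D).real univ ≤
      normL1 (z 0) + (∫ r, F n r ∂μ + L * ∫ r in (0 : ℝ)..t, normL1 (z r)) := by
    intro n
    have hTr := isTruncation_absApprox (hδ n)
    have he := energy_inequality hp hq hz hzw' hG' heq'
      (J := fun x : L2 D => ∫ y, absApprox (δ n) (x y) ∂(spaceMeas D))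
      (continuous_integral_comp hTr.lipschitz hTr.zero) (hsm' n)
      ((memLp_integral_comp hTr.lipschitz hTr.zero hzm).integrable Fact.out)
      (fun x b => V.integral_absApprox_sub_le (q := q) (hδ n) hp hp2 x b) le_rfl ht.1 ht.2
    have e1 : ∫ r in (0 : ℝ)..t, G' r (V.sign (hδ n) hp (w' r)) =
        ∫ r, G r (V.sign (hδ n) hp (w r)) ∂μ := by
      rw [intervalIntegral.integral_of_le ht.1]
      refine setIntegral_congr_fun measurableSet_Ioc fun r hr => ?_
      simp only [(hind (hsub le_rfl ht.2 hr)).1, (hind (hsub le_rfl ht.2 hr)).2]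
    have e2 : ∫ r in (0 : ℝ)..t, normL1 (z r) = ∫ r, normL1 (V.toL2 hp2 (w r)) ∂μ := by
      rw [intervalIntegral.integral_of_le ht.1]
      refine integral_congr_ae ?_
      filter_upwards [ae_mono hμ hzw] with r hr
      rw [hr]
    have e3 : ∫ r, G r (V.sign (hδ n) hp (w r)) ∂μ ≤
        ∫ r, F n r ∂μ + L * ∫ r, normL1 (V.toL2 hp2 (w r)) ∂μ := by
      rw [← integral_const_mul, ← integral_add ((hFi n).mono_measure hμ)
        ((hN.const_mul _).mono_measure hμ)]
      refine integral_mono ((hS n).mono_measure hμ) (((hFi n).mono_measure hμ).add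
        ((hN.const_mul _).mono_measure hμ)) fun r => ?_
      exact sub_le_iff_le_add.1 (le_max_right _ _)
    rw [e1] at he
    rw [e2]
    have b1 := integral_absApprox_le_normL1 (hδ n) (z 0)
    have b2 := normL1_sub_le_integral_absApprox (hδ n) (z t)
    linarith
  have l1 : Tendsto (fun n => normL1 (z t) - δ n * (spaceMeas D).real univ) atTop
      (𝓝 (normL1 (z t))) := by
    simpa using (hlim.mul_const ((spaceMeas D).real univ)).const_sub (normL1 (z t))
  have l2 : Tendsto (fun n => normL1 (z 0) + (∫ r, F n r ∂μ + L * ∫ r in (0 : ℝ)..t, normL1 (z r)))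
      atTop (𝓝 (normL1 (z 0) + L * ∫ r in (0 : ℝ)..t, normL1 (z r))) := by
    simpa using (hFlim.add_const (L * ∫ r in (0 : ℝ)..t, normL1 (z r))).const_add (normL1 (z 0))
  exact le_of_tendsto_of_tendsto' l1 l2 key

/-- The modulus of continuity consists of the increment of `z` at time `0`, small by
right-continuity, and of translation errors of `G` and `w` extended by zero. -/
theorem exists_continuousOn_of_identity (hT : 0 < T) (hp : p ≠ ∞) (hp2 : 2 ≤ p) {w : ℝ → V p D}
    {G : ℝ → V' p D} (hw : MemLp w p (timeMeas T)) (hG : MemLp G q (timeMeas T))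
    {z : ℝ → L2 D} (hz : ∀ t ∈ Ico 0 T, ContinuousWithinAt z (Ici t) t)
    (hzw : ∀ᵐ t ∂(timeMeas T), z t = V.toL2 hp2 (w t))
    (heq : ∀ s t, 0 ≤ s → s ≤ t → t < T → ∀ ψ : V p D,
      inner ℝ (z t - z s) (V.toL2 hp2 ψ) = ∫ r in s..t, G r ψ) :
    ∃ Z : ℝ → L2 D, ContinuousOn Z (Icc 0 T) ∧ ∀ t ∈ Ico 0 T, Z t = z t := by
  have hq := ne_top_of_holderConjugate_of_two_le (p := p) (q := q) hp2
  let w' : ℝ → V p D := (Ioo 0 T).indicator w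
  let G' : ℝ → V' p D := (Ioo 0 T).indicator G
  have hw' : MemLp w' p volume := (memLp_indicator_iff_restrict measurableSet_Ioo).2 hw
  have hG' : MemLp G' q volume := (memLp_indicator_iff_restrict measurableSet_Ioo).2 hG
  have hzw' : ∀ᵐ r : ℝ, r ∈ Ioo 0 T → z r = V.toL2 hp2 (w' r) := by
    filter_upwards [(ae_restrict_iff' measurableSet_Ioo).1 hzw] with r h hr
    rw [h hr]
    exact congrArg _ (indicator_of_mem hr _).symm
  have heq' : ∀ s t, 0 ≤ s → s ≤ t → t < T → ∀ ψ : V p D,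
      inner ℝ (z t - z s) (V.toL2 hp2 ψ) = ∫ r in s..t, G' r ψ := by
    intro s t hs hst ht ψ
    rw [heq s t hs hst ht, intervalIntegral.integral_of_le hst,
      intervalIntegral.integral_of_le hst]
    refine setIntegral_congr_fun measurableSet_Ioc fun r hr => ?_
    have hr' : r ∈ Ioo 0 T := ⟨hs.trans_lt hr.1, hr.2.trans_lt ht⟩
    exact congrArg (fun γ : V' p D => γ ψ) (indicator_of_mem hr' G).symm
  have h := fun t h ht hh hth => norm_translate_sub_le (t := t) (h := h) hp hq hz hzw' hG' hw' hp2
    heq' ht hh hth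
  refine exists_continuousOn_Icc_of_translate hT (ρ := fun h => ‖z h - z 0‖ ^ 2 +
    2 * ((eLpNorm (fun r => G' (r + h) - G' r) q volume).toReal *
      (eLpNorm (fun r => w' (r + h) - w' r) p volume).toReal)) ?_ fun t s ht hs hts => ?_
  · have l1 : Tendsto (fun h => ‖z h - z 0‖ ^ 2) (𝓝[≥] 0) (𝓝 0) := by
      have := ((hz 0 ⟨le_rfl, hT⟩).sub_const (z 0)).norm.pow 2
      simpa [ContinuousWithinAt] using this
    have l2 := ((tendsto_eLpNorm_translate_sub hq hG').mul
      (tendsto_eLpNorm_translate_sub hp hw')).mono_left (nhdsWithin_le_nhds (s := Ici (0 : ℝ)))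
    simpa using l1.add (l2.const_mul 2)
  · linarith [h t s ht hs hts]

end Contraction
end Obstacle

/-! ### The contraction for a fixed realization -/

namespace Obstacle

section Pathwise

variable {d : ℕ} {D : Set (Euc d)} {p q : ℝ≥0∞} [Fact (1 ≤ p)] [Fact (1 ≤ q)]
  [p.HolderConjugate q] {a : Euc d → ℝ → Euc d → Euc d} [IsFiniteMeasure (spaceMeas D)] {T : ℝ}
  {f : ℝ → ℝ} {L : ℝ≥0}

omit [IsFiniteMeasure (spaceMeas D)] in
-- Complementarity holds only integrated in time, but the integrand is non-negative by positivity of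
-- the functional, so it vanishes a.e.
theorem IsFunctional.ae_apply_eq_zero (hp : p ≠ ∞) (hD : IsOpen D) {η : Measure (ℝ × Euc d)}
    {g : LqV' p q T D} (hg : IsFunctional η g) {u : LpV p T D}
    (hu : ∀ᵐ t ∂(timeMeas T), 0 ≤ᵐ[spaceMeas D] (u t).fn)
    (h0 : ∫ t, g t (u t) ∂(timeMeas T) = 0) : ∀ᵐ t ∂(timeMeas T), g t (u t) = 0 := by
  have hnn : 0 ≤ᵐ[timeMeas T] fun t => g t (u t) := by
    filter_upwards [hg.ae_nonneg hp hD, hu] with t h1 h2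
    exact h1 _ h2
  exact (integral_eq_zero_iff_of_nonneg_ae hnn
    (integrable_pairing (Lp.memLp g) (Lp.memLp u)).1).1 h0

theorem IsAdmissible.normL1_contraction (ha : IsAdmissible p q D a) (hT : 0 < T) (hD : IsOpen D)
    (hp : p ≠ ∞) (hp2 : 2 ≤ p) (hf : LipschitzWith L f) (hf0 : f 0 = 0) {u v : LpV p T D}
    {η ν : Measure (ℝ × Euc d)} {g g' : LqV' p q T D} (hg : IsFunctional η g)
    (hg' : IsFunctional ν g') (hgu : ∫ t, g t (u t) ∂(timeMeas T) = 0)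
    (hgv : ∫ t, g' t (v t) ∂(timeMeas T) = 0)
    (hu : ∀ᵐ t ∂(timeMeas T), 0 ≤ᵐ[spaceMeas D] (u t).fn)
    (hv : ∀ᵐ t ∂(timeMeas T), 0 ≤ᵐ[spaceMeas D] (v t).fn)
    {z : ℝ → L2 D} (hz : ∀ t ∈ Ico 0 T, ContinuousWithinAt z (Ici t) t)
    (hzw : ∀ᵐ t ∂(timeMeas T), z t = V.toL2 hp2 (u t - v t))
    (hweak : ∀ (θ : ℝ → ℝ) (φ : Euc d → ℝ) (_ : IsTest (Ioo 0 T) θ) (hφ : IsTest D φ),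
      ∫ t, deriv θ t * inner ℝ (V.toL2 hp2 (u t - v t)) (V.toL2 hp2 (V.ofTest hφ : V p D))
        ∂(timeMeas T) = - ∫ t, θ t * (ha.drift hp hp2 hf hf0 (g t) (u t) -
          ha.drift hp hp2 hf hf0 (g' t) (v t)) (V.ofTest hφ) ∂(timeMeas T)) :
    ∃ Z : ℝ → L2 D, ContinuousOn Z (Icc 0 T) ∧ (∀ t ∈ Ico 0 T, Z t = z t) ∧
      ∀ t ∈ Icc 0 T, normL1 (Z t) ≤ normL1 (z 0) * Real.exp (L * T) := by
  have mu := Lp.memLp u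
  have mv := Lp.memLp v
  have mw : MemLp (fun t => u t - v t) p (timeMeas T) := mu.sub mv
  have mG : MemLp (fun t => ha.drift hp hp2 hf hf0 (g t) (u t) -
      ha.drift hp hp2 hf hf0 (g' t) (v t)) q (timeMeas T) :=
    (ha.memLp_drift hp hp2 hf hf0 mu (Lp.memLp g)).sub
      (ha.memLp_drift hp hp2 hf hf0 mv (Lp.memLp g'))
  have heq : ∀ s t, 0 ≤ s → s ≤ t → t < T → ∀ ψ : V p D, _ := fun s t hs hst ht ψ =>
    inner_sub_eq_integral_of_weak hp2 mw mG hweak hz hzw hs hst ht ψ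
  obtain ⟨Z, hZc, hZ⟩ := exists_continuousOn_of_identity hT hp hp2 mw mG hz hzw heq
  obtain ⟨k, C, B, hC, hB, hk1, hk2, hk3⟩ := ha.exists_fluxError hp hp2
  let δ : ℕ → ℝ := fun n => 1 / ((n : ℝ) + 1)
  have hδ : ∀ n, 0 < δ n := fun n => by positivity
  have hlim : Tendsto δ atTop (𝓝 0) := tendsto_inv_nat_add_one
  -- The errors are dominated in time by `(C ‖v‖^{p-1} + B) ‖u - v‖`, a product of an `L^{p'}` and
  -- an `L^p` function of `t`.
  have main : ∀ t ∈ Ico 0 T, normL1 (z t) ≤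
      normL1 (z 0) + L * ∫ r in (0 : ℝ)..t, normL1 (z r) := fun t ht => by
    refine normL1_le_add_integral (E := fun n t => fluxError k (δ n) (u t) (v t))
      (B := fun t => (C * ‖v t‖ ^ (p.toReal - 1) + B) * ‖u t - v t‖)
      hp hp2 mw mG hz hzw heq hδ hlim ?_ ?_ (fun n t => hk2 _ (hδ n) _ _)
      (fun t => hk3 δ hδ hlim _ _) ht
    · filter_upwards [hg.ae_nonneg hp hD, hg'.ae_nonneg hp hD, hg.ae_apply_eq_zero hp hD hu hgu,
        hg'.ae_apply_eq_zero hp hD hv hgv, hu, hv] with t h1 h2 h3 h4 h5 h6 n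
      exact ha.drift_sub_apply_sign_le hp hp2 hf hf0 (hδ n) (hk1 _ (hδ n) _ _) h5 h6 h1 h3 h2 h4
    · exact (integrable_mul_conj (((memLp_rpow_sub_one (q := q) hp hp2 mv).const_mul C).add
        (memLp_const B)) mw.norm).1
  refine ⟨Z, hZc, hZ, ?_⟩
  have hN : ContinuousOn (fun t => normL1 (Z t)) (Icc 0 T) :=
    continuous_normL1.comp_continuousOn hZc
  have hint : ContinuousOn (fun t => ∫ r in (0 : ℝ)..t, normL1 (Z r)) (Icc 0 T) := by
    have := intervalIntegral.continuousOn_primitive_interval (μ := volume) (a := 0) (b := T)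
      (f := fun r => normL1 (Z r)) (by rw [uIcc_of_le hT.le]; exact hN.integrableOn_Icc)
    rwa [uIcc_of_le hT.le] at this
  -- The integral inequality extends to the endpoint `T` because both sides are continuous for the
  -- extension `Z`.
  have hclosed : ∀ t ∈ Icc 0 T, normL1 (Z t) ≤
      normL1 (z 0) + L * ∫ r in (0 : ℝ)..t, normL1 (Z r) := by
    have hcl : closure (Ico (0 : ℝ) T) = Icc 0 T := closure_Ico hT.ne
    intro t ht
    refine ContinuousWithinAt.closure_le (s := Ico 0 T) (f := fun t => normL1 (Z t))
      (g := fun t => normL1 (z 0) + L * ∫ r in (0 : ℝ)..t, normL1 (Z r)) (hcl ▸ ht)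
      ((hN t ht).mono Ico_subset_Icc_self)
      (((continuousOn_const.add (continuousOn_const.mul hint)) t ht).mono Ico_subset_Icc_self)
      fun t ht => ?_
    rw [hZ t ht]
    refine (main t ht).trans (le_of_eq ?_)
    congr 2
    refine intervalIntegral.integral_congr fun r hr => ?_
    rw [uIcc_of_le ht.1] at hr
    simp only [hZ r ⟨hr.1, hr.2.trans_lt ht.2⟩]
  exact le_mul_exp_of_le_add_integral hT L.2 hN
    (integral_nonneg fun _ => abs_nonneg _) hclosed

end Pathwise
end Obstacle

/-! ### Cancellation of the noise -/

namespace Obstacle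

/-- Pathwise continuity is the only property of the stochastic integral that the proof uses. The
default process `0` in the definition has it as well. -/
theorem ae_continuousOn_itoIntegral {Ω : Type*} {mΩ : MeasurableSpace Ω} {H : Type*}
    [NormedAddCommGroup H] [InnerProductSpace ℝ H] (P : Measure Ω) (𝓕 : Filtration ℝ≥0 mΩ)
    (T : ℝ) (W : H → ℝ≥0 → Ω → ℝ) (Φ : ℝ≥0 → Ω → H →L[ℝ] H) :
    ∀ᵐ ω ∂P, ContinuousOn (fun t : ℝ => itoIntegral P 𝓕 T W Φ t.toNNReal ω) (Icc 0 T) := by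
  have h : ∀ᵐ ω ∂P, ContinuousOn (fun t => itoIntegral P 𝓕 T W Φ t ω) (Icc 0 T.toNNReal) := by
    unfold itoIntegral
    split_ifs with h
    · exact h.choose_spec.2.1
    · exact Eventually.of_forall fun ω => continuousOn_const
  filter_upwards [h] with ω hω
  exact hω.comp continuous_real_toNNReal.continuousOn fun t ht =>
    ⟨zero_le, Real.toNNReal_le_toNNReal ht.2⟩

section Difference

variable {d : ℕ} {D : Set (Euc d)} {p q : ℝ≥0∞} [Fact (1 ≤ p)] [Fact (1 ≤ q)]
  [IsFiniteMeasure (spaceMeas D)] {T : ℝ}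

omit [Fact (1 ≤ q)] in
theorem IsTest.integrable_deriv_mul_inner (hp2 : 2 ≤ p) {I : ℝ → L2 D}
    (hI : ContinuousOn I (Icc 0 T)) (u : LpV p T D) {θ : ℝ → ℝ} (hθ : IsTest (Ioo 0 T) θ)
    (x : L2 D) : Integrable (fun t => deriv θ t * inner ℝ (V.toL2 hp2 (u t) - I t) x)
      (timeMeas T) := by
  have h1 : Integrable (fun t => V.toL2 hp2 (u t)) (timeMeas T) :=
    (V.toL2 hp2).integrable_comp ((Lp.memLp u).integrable Fact.out)
  have h2 : Integrable I (timeMeas T) := hI.integrableOn_Icc.mono_set Ioo_subset_Icc_self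
  have hc : Continuous (deriv θ) := hθ.smooth.continuous_deriv (by simp)
  obtain ⟨M, hM⟩ := hθ.compact.deriv.exists_bound_of_continuous hc
  exact ((h1.sub h2).inner_const x).bdd_mul hc.aestronglyMeasurable (Eventually.of_forall hM)

/-- The same path `I` occurs in both equations and drops out. Its continuity makes it integrable, so
the two weak forms can be subtracted. -/
theorem weak_form_sub (hp2 : 2 ≤ p) {I : ℝ → L2 D} (hI : ContinuousOn I (Icc 0 T))
    {u v : LpV p T D} {G G' : ℝ → V' p D} (hG : MemLp G q (timeMeas T))
    (hG' : MemLp G' q (timeMeas T)) {θ : ℝ → ℝ} (hθ : IsTest (Ioo 0 T) θ) {ψ : V p D}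
    (hu : ∫ t, deriv θ t * inner ℝ (V.toL2 hp2 (u t) - I t) (V.toL2 hp2 ψ) ∂(timeMeas T) =
      - ∫ t, θ t * G t ψ ∂(timeMeas T))
    (hv : ∫ t, deriv θ t * inner ℝ (V.toL2 hp2 (v t) - I t) (V.toL2 hp2 ψ) ∂(timeMeas T) =
      - ∫ t, θ t * G' t ψ ∂(timeMeas T)) :
    ∫ t, deriv θ t * inner ℝ (V.toL2 hp2 (u t - v t)) (V.toL2 hp2 ψ) ∂(timeMeas T) =
      - ∫ t, θ t * (G t - G' t) ψ ∂(timeMeas T) := by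
  have i1 := hθ.integrable_deriv_mul_inner hp2 hI u (V.toL2 hp2 ψ)
  have i2 := hθ.integrable_deriv_mul_inner hp2 hI v (V.toL2 hp2 ψ)
  have j1 := hθ.integrable_mul (integrable_apply_const hG ψ)
  have j2 := hθ.integrable_mul (integrable_apply_const hG' ψ)
  have e1 : ∫ t, deriv θ t * inner ℝ (V.toL2 hp2 (u t - v t)) (V.toL2 hp2 ψ) ∂(timeMeas T) =
      ∫ t, deriv θ t * inner ℝ (V.toL2 hp2 (u t) - I t) (V.toL2 hp2 ψ) ∂(timeMeas T) -
      ∫ t, deriv θ t * inner ℝ (V.toL2 hp2 (v t) - I t) (V.toL2 hp2 ψ) ∂(timeMeas T) := by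
    rw [← integral_sub i1 i2]
    refine integral_congr_ae (Eventually.of_forall fun t => ?_)
    simp only [map_sub, inner_sub_left]
    ring
  have e2 : ∫ t, θ t * (G t - G' t) ψ ∂(timeMeas T) =
      ∫ t, θ t * G t ψ ∂(timeMeas T) - ∫ t, θ t * G' t ψ ∂(timeMeas T) := by
    rw [← integral_sub j1 j2]
    refine integral_congr_ae (Eventually.of_forall fun t => ?_)
    simp only [sub_apply, mul_sub]
  rw [e1, e2, hu, hv]
  ring

end Difference
end Obstacle

/-! ### The `L¹` contraction for solutions with regular reflection -/

theorem theorem2p2 (T : ℝ) (hT : 0 < T) (f : ℝ → ℝ) (hf : ∃ L : ℝ≥0, LipschitzWith L f)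
    (hf0 : f 0 = 0) :
    ∃ C : ℝ, 0 < C ∧
      ∀ (d : ℕ) (_ : 2 ≤ d) (D : Set (Obstacle.Euc d)) (_ : Obstacle.IsBoundedLipschitzDomain D)
        (p q : ℝ≥0∞) [Fact (1 ≤ p)] [Fact (1 ≤ q)] [p.HolderConjugate q] (_ : 2 ≤ p) (_ : p ≠ ∞)
        (a : Obstacle.Euc d → ℝ → Obstacle.Euc d → Obstacle.Euc d)
        (_ : Obstacle.IsAdmissible p q D a)
        (Ω : Type*) (mΩ : MeasurableSpace Ω) (P : Measure Ω) [IsProbabilityMeasure P]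
        (𝓕 : Filtration ℝ≥0 mΩ) [𝓕.IsRightContinuous]
        (_ : ∀ A : Set Ω, P A = 0 → MeasurableSet[𝓕 0] A)
        (W : Obstacle.L2 D → ℝ≥0 → Ω → ℝ) (_ : Obstacle.IsCylindricalWiener P 𝓕 W)
        (Φ : ℝ≥0 → Ω → Obstacle.L2 D →L[ℝ] Obstacle.L2 D) (_ : Obstacle.IsIntegrand P 𝓕 T Φ)
        (u₀ v₀ : Ω → Obstacle.L2 D) (_ : Obstacle.IsInitialValue P 𝓕 u₀)
        (_ : Obstacle.IsInitialValue P 𝓕 v₀)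
        (u v : Ω → Obstacle.LpV p T D) (η ν : Ω → Measure (ℝ × Obstacle.Euc d))
        (_ : Obstacle.IsRegularSolution p q T D P 𝓕 W Φ f a u₀ u η)
        (_ : Obstacle.IsRegularSolution p q T D P 𝓕 W Φ f a v₀ v ν)
        (ub vb : Ω → ℝ → Obstacle.L2 D) (_ : Obstacle.IsRightContRep P u₀ u ub)
        (_ : Obstacle.IsRightContRep P v₀ v vb),
        ∀ᵐ ω ∂P, ∃ z : ℝ → Obstacle.L2 D, ContinuousOn z (Icc 0 T) ∧
          (∀ t ∈ Ico 0 T, z t = ub ω t - vb ω t) ∧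
          ⨆ t ∈ Icc 0 T, eLpNorm (z t) 1 (volume.restrict D)
            ≤ ENNReal.ofReal C * eLpNorm (u₀ ω - v₀ ω) 1 (volume.restrict D) := by
  obtain ⟨L, hf⟩ := hf
  -- The Gronwall factor, with `L` a Lipschitz constant of `f`; it is fixed before all other data.
  refine ⟨Real.exp (L * T), Real.exp_pos _, ?_⟩
  intro d _ D hD p q _ _ _ hp2 hp a ha Ω mΩ P _ 𝓕 _ _ W _ Φ _ u₀ v₀ _ _ u v η ν hu hv ub vb hub hvb
  have hfin : IsFiniteMeasure (Obstacle.spaceMeas D) :=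
    isFiniteMeasure_restrict.2 hD.isBounded.measure_lt_top.ne
  filter_upwards [hub, hvb, hu.nonneg, hv.nonneg, hu.equation, hv.equation, hu.reflection,
    hv.reflection, Obstacle.ae_continuousOn_itoIntegral P 𝓕 T W Φ]
    with ω ⟨hub1, hub2, hub3⟩ ⟨hvb1, hvb2, hvb3⟩ hu0 hv0 hue hve ⟨g, hg, hgu⟩ ⟨g', hg', hgv⟩ hI
  -- The right-continuous representatives agree with the solutions for a.e. time, as elements of
  -- `L²(D)`.
  have hzw : ∀ᵐ t ∂(Obstacle.timeMeas T),
      ub ω t - vb ω t = Obstacle.V.toL2 hp2 (u ω t - v ω t) := by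
    filter_upwards [hub1, hvb1] with t h1 h2
    have e1 : ub ω t = Obstacle.V.toL2 hp2 (u ω t) :=
      Lp.ext (h1.trans (Obstacle.V.coeFn_toL2 hp2 _).symm)
    have e2 : vb ω t = Obstacle.V.toL2 hp2 (v ω t) :=
      Lp.ext (h2.trans (Obstacle.V.coeFn_toL2 hp2 _).symm)
    rw [e1, e2, map_sub]
  obtain ⟨Z, hZ, hZz, hle⟩ := ha.normL1_contraction hT hD.isOpen hp hp2 hf hf0 hg hg' hgu hgv
    hu0 hv0 (z := fun t => ub ω t - vb ω t) (fun t ht => (hub2 t ht).sub (hvb2 t ht)) hzw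
    fun θ φ hθ hφ => Obstacle.weak_form_sub hp2 hI
      (ha.memLp_drift hp hp2 hf hf0 (Lp.memLp (u ω)) (Lp.memLp g))
      (ha.memLp_drift hp hp2 hf hf0 (Lp.memLp (v ω)) (Lp.memLp g')) hθ
      (ha.weak_form hp hp2 hf hf0 hg hue hθ hφ) (ha.weak_form hp hp2 hf hf0 hg' hve hθ hφ)
  refine ⟨Z, hZ, hZz, iSup₂_le fun t ht => ?_⟩
  rw [← hub3, ← hvb3, ← Obstacle.ofReal_normL1, ← Obstacle.ofReal_normL1,
    ← ENNReal.ofReal_mul (Real.exp_pos _).le, mul_comm]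
  exact ENNReal.ofReal_le_ofReal (hle t ht)
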